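/- Let $M$ be a compact connected smooth $n$-manifold without boundary and $\mu$ a smooth volume form (positive smooth density) on $M$ with $\int_M\mu=1$. Let $s>n/2$ be real, or $s=\infty$ (with $H^\infty=C^\infty$). Put $$\mathrm{Dens}^s(M)=\Big\{\rho\in H^s(M)\;\Big|\;\rho>0,\ \int_M\rho\,\mu=1\Big\},\qquad T^*\mathrm{Dens}^s(M)=\mathrm{Dens}^s(M)\times H^s(M)/\mathbb R ,$$ where $H^s(M)$ denotes real-valued functions and $H^s(M)/\mathbb R$ is the quotient by the constants. A tangent vector of $T^*\mathrm{Dens}^s(M)$ at $(\rho,[\theta])$ is a pair $(\dot\rho,[\dot\theta])$ with $\dot\rho\in H^s(M)$, $\int_M\dot\rho\,\mu=0$, $\dot\theta\in H^s(M)$, where the representative $\dot\theta$ is normalized by $\int_M\dot\theta\rho\,\mu=0$. The Sasaki–Fisher–Rao metric is $$\mathsf G^*_{(\rho,[\theta])}\big((\dot\rho,\dot\theta),(\dot\rho,\dot\theta)\big)=\frac14\int_M\Big(\frac{\dot\rho^2}{\rho}+\dot\theta^2\rho\Big)\mu .$$ Let $\mathbb PH^s(M,\mathbb C)$ be the complex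 projective space of $H^s(M,\mathbb C)$, and $\mathbb PH^s(M,\mathbb C\setminus\{0\})$ its subset of classes of nowhere vanishing functions. The Fubini–Study metric is $$\mathsf{FS}_\psi(\dot\psi,\dot\psi)=\frac{\langle\dot\psi,\dot\psi\rangle_{L^2}}{\langle\psi,\psi\rangle_{L^2}}-\frac{\langle\psi,\dot\psi\rangle_{L^2}\langle\dot\psi,\psi\rangle_{L^2}}{\langle\psi,\psi\rangle_{L^2}^2},$$ where tangent vectors at $[\psi]$ are represented by $\dot\psi\in H^s(M,\mathbb C)$ modulo $\mathbb C\psi$. Both metrics are extended to pairs of vectors by polarization. All spaces carry the smooth structures coming from the Hilbert ($s<\infty$) or Fréchet ($s=\infty$) topology of $H^s$. Then the Madelung transform $$\mathbf\Phi\colon T^*\mathrm{Dens}^s(M)\to\mathbb PH^s(M,\mathbb C),\qquad \mathbf\Phi(\rho,[\theta])=\big[\sqrt\rho\,e^{\mathrm i\theta/2}\big],$$ is well defined and is an isometry, with respect to the Sasaki–Fisher–Rao and Fubini–Study metrics, onto an open subset of $\mathbb PH^s(M,\mathbb C\setminus\{0\})$. That is, $\mathbf\Phi$ is a diffeomorphism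 onto its open image and $\mathsf{FS}_{\mathbf\Phi(p)}(T_p\mathbf\Phi\,v,T_p\mathbf\Phi\,w)=\mathsf G^*_p(v,w)$ for all points $p$ and tangent vectors $v,w$ at $p$ (with $\mathsf{FS}$ on pairs the real part of the Hermitian form). The image consists of the classes $[\psi]$ with $\psi=|\psi|e^{\mathrm i\alpha}$ nowhere zero for some continuous $\alpha\colon M\to\mathbb R$. If $M$ is simply connected, the image is all of $\mathbb PH^s(M,\mathbb C\setminus\{0\})$. -/

import Mathlib

open Set Filter Topology MeasureTheory
open scoped Manifold ContDiff SchwartzMap ENNReal LinearAlgebra.Projectivization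

noncomputable section

namespace Madelung

universe u v

/-! ### Differential calculus in topological vector spaces -/

section Calculus

/-- `y` is the directional derivative `lim_{t → 0} (f (x + t v) - f x) / t`. -/
def HasDirDeriv {E : Type u} {F : Type v} [AddCommGroup E] [Module ℝ E]
    [AddCommGroup F] [Module ℝ F] [TopologicalSpace F]
    (f : E → F) (x v : E) (y : F) : Prop :=
  Tendsto (fun t : ℝ => t⁻¹ • (f (x + t • v) - f x)) (𝓝[≠] 0) (𝓝 y)

/-- `f` is of class `C^k` on the (open) set `U`, in the sense used for Fréchet spaces
(Michal, Bastiani, Hamilton, Milnor): `f` is continuous, its directional derivatives exist and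
`(x, v) ↦ df(x) v` is of class `C^{k-1}` on `U × E`. -/
def ContDiffOnTVS : (k : ℕ) → {E : Type u} → {F : Type v} →
    [AddCommGroup E] → [Module ℝ E] → [TopologicalSpace E] →
    [AddCommGroup F] → [Module ℝ F] → [TopologicalSpace F] →
    (f : E → F) → (U : Set E) → Prop
  | 0, _, _, _, _, _, _, _, _, f, U => ContinuousOn f U
  | k + 1, E, F, _, _, _, _, _, _, f, U =>
      ContinuousOn f U ∧ ∃ df : E × E → F,
        (∀ x ∈ U, ∀ v : E, HasDirDeriv f x v (df (x, v))) ∧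
        ContDiffOnTVS k df (U ×ˢ (univ : Set E))

/-- `f` is of class `C^∞` on the open set `U`. -/
def SmoothOnTVS {E : Type u} {F : Type v} [AddCommGroup E] [Module ℝ E] [TopologicalSpace E]
    [AddCommGroup F] [Module ℝ F] [TopologicalSpace F] (f : E → F) (U : Set E) : Prop :=
  ∀ k : ℕ, ContDiffOnTVS k f U

/-- The partially defined map `f` with domain `D ⊆ X`, read in the charts `e` of `X` and `κ` of
`Y`, is smooth on the set of chart points where this makes sense. -/
def SmoothInCharts {X Y : Type*} {E : Type u} {F : Type v}
    [AddCommGroup E] [Module ℝ E] [TopologicalSpace E]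
    [AddCommGroup F] [Module ℝ F] [TopologicalSpace F]
    (e : PartialEquiv X E) (κ : PartialEquiv Y F) (f : X → Y) (D : Set X) : Prop :=
  SmoothOnTVS (fun x => κ (f (e.symm x)))
    {x | x ∈ e.target ∧ e.symm x ∈ D ∧ f (e.symm x) ∈ κ.source}

end Calculus

/-! ### Sobolev spaces on a compact manifold -/

section Sobolev

/-- A chart `e` of the smooth structure of `M` and a smooth function `χ` supported in its domain. -/
structure LocalCutoff (n : ℕ) (M : Type u) [TopologicalSpace M]
    [ChartedSpace (EuclideanSpace ℝ (Fin n)) M] where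
  /-- the chart -/
  e : OpenPartialHomeomorph M (EuclideanSpace ℝ (Fin n))
  mem_atlas : e ∈ IsManifold.maximalAtlas (𝓡 n) ∞ M
  /-- the cutoff function -/
  χ : M → ℝ
  smooth : ContMDiff (𝓡 n) 𝓘(ℝ, ℝ) ∞ χ
  support_subset : tsupport χ ⊆ e.source

variable {n : ℕ} {M : Type u} [TopologicalSpace M] [ChartedSpace (EuclideanSpace ℝ (Fin n)) M]

/-- The function `χ f` in the coordinates of the chart, extended by zero to `ℝⁿ`. -/
def LocalCutoff.localize (c : LocalCutoff n M) (f : C(M, ℂ)) (x : EuclideanSpace ℝ (Fin n)) : ℂ :=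
  c.e.target.indicator (fun x => (c.χ (c.e.symm x) : ℂ) * f (c.e.symm x)) x

variable [CompactSpace M]

theorem LocalCutoff.localize_eq_zero (c : LocalCutoff n M) (f : C(M, ℂ))
    {x : EuclideanSpace ℝ (Fin n)} (hx : x ∉ c.e '' tsupport c.χ) : c.localize f x = 0 := by
  by_cases hxt : x ∈ c.e.target
  · have : c.e.symm x ∉ tsupport c.χ := fun h => hx ⟨_, h, c.e.right_inv hxt⟩
    simp [LocalCutoff.localize, hxt, image_eq_zero_of_notMem_tsupport this]
  · simp [LocalCutoff.localize, hxt]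

theorem LocalCutoff.isCompact_image (c : LocalCutoff n M) :
    IsCompact (c.e '' tsupport c.χ) :=
  (isClosed_tsupport c.χ).isCompact.image_of_continuousOn
    (c.e.continuousOn.mono c.support_subset)

theorem LocalCutoff.continuous_localize (c : LocalCutoff n M) (f : C(M, ℂ)) :
    Continuous (c.localize f) := by
  rw [continuous_iff_continuousAt]
  intro x
  by_cases hx : x ∈ c.e '' tsupport c.χ
  · have hxt : x ∈ c.e.target := by
      obtain ⟨y, hy, rfl⟩ := hx
      exact c.e.map_source (c.support_subset hy)
    have h1 : ContinuousAt (fun x => (c.χ (c.e.symm x) : ℂ) * f (c.e.symm x)) x := by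
      have hs := c.e.continuousAt_symm hxt
      exact (Complex.continuous_ofReal.continuousAt.comp
        (c.smooth.continuous.continuousAt.comp hs)).mul (f.continuous.continuousAt.comp hs)
    refine h1.congr ?_
    filter_upwards [c.e.open_target.mem_nhds hxt] with y hy
    simp [LocalCutoff.localize, hy]
  · refine (continuousAt_const (y := (0 : ℂ))).congr ?_
    filter_upwards [c.isCompact_image.isClosed.isOpen_compl.mem_nhds hx] with y hy
    exact (c.localize_eq_zero f hy).symm

theorem LocalCutoff.memLp_localize (c : LocalCutoff n M) (f : C(M, ℂ)) :
    MemLp (c.localize f) 2 (volume : Measure (EuclideanSpace ℝ (Fin n))) :=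
  (c.continuous_localize f).memLp_of_hasCompactSupport
    (HasCompactSupport.intro c.isCompact_image fun _ hx => c.localize_eq_zero f hx)

/-- `f ↦ (χ f) ∘ e⁻¹` as a linear map into `L²(ℝⁿ)`. -/
def LocalCutoff.toLp (c : LocalCutoff n M) :
    C(M, ℂ) →ₗ[ℂ] Lp ℂ 2 (volume : Measure (EuclideanSpace ℝ (Fin n))) where
  toFun f := (c.memLp_localize f).toLp _
  map_add' f g := by
    rw [← MemLp.toLp_add]
    congr 1
    funext x
    by_cases hx : x ∈ c.e.target <;> simp [LocalCutoff.localize, hx, mul_add]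
  map_smul' a f := by
    rw [RingHom.id_apply, ← MemLp.toLp_const_smul]
    congr 1
    funext x
    by_cases hx : x ∈ c.e.target <;> simp [LocalCutoff.localize, hx, mul_left_comm]

/-- `(χ f) ∘ e⁻¹` belongs to the Bessel potential space `H^r(ℝⁿ)`. -/
def LocalCutoff.MemH (c : LocalCutoff n M) (r : ℝ) (f : C(M, ℂ)) : Prop :=
  TemperedDistribution.MemSobolev r 2
    (c.toLp f : 𝓢'(EuclideanSpace ℝ (Fin n), ℂ))

variable (n M) in
/-- `H^s(M, ℂ)` for a real number `s > n/2` or `s = ∞`. By the Sobolev embedding theorem each class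
has a unique continuous representative, so we take continuous functions; `f` belongs to the
space if it is of class `H^s` in all charts. For `s = ∞` this reads: of class `H^r` for all `r`. -/
def sobolevSubmodule (s : WithTop ℝ) : Submodule ℂ C(M, ℂ) where
  carrier := {f | ∀ (c : LocalCutoff n M) (r : ℝ), (r : WithTop ℝ) ≤ s → c.MemH r f}
  add_mem' {f g} hf hg c r hr := by
    have h := (hf c r hr).add (hg c r hr)
    have e : ((c.toLp (f + g) : Lp ℂ 2 volume) : 𝓢'(EuclideanSpace ℝ (Fin n), ℂ))
        = (c.toLp f : 𝓢'(EuclideanSpace ℝ (Fin n), ℂ)) + (c.toLp g : 𝓢'(_, ℂ)) := by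
      simp only [map_add, ← Lp.toTemperedDistributionCLM_apply]
    rw [LocalCutoff.MemH, e]
    exact h
  zero_mem' c r _ := by
    have e : ((c.toLp 0 : Lp ℂ 2 volume) : 𝓢'(EuclideanSpace ℝ (Fin n), ℂ)) = 0 := by
      simp only [map_zero, ← Lp.toTemperedDistributionCLM_apply]
    rw [LocalCutoff.MemH, e]
    exact TemperedDistribution.memSobolev_fun_zero _ _ _ _
  smul_mem' a f hf c r hr := by
    have h := (hf c r hr).smul a
    have e : ((c.toLp (a • f) : Lp ℂ 2 volume) : 𝓢'(EuclideanSpace ℝ (Fin n), ℂ))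
        = a • (c.toLp f : 𝓢'(EuclideanSpace ℝ (Fin n), ℂ)) := by
      simp only [map_smul, ← Lp.toTemperedDistributionCLM_apply]
    rw [LocalCutoff.MemH, e]
    exact h

variable (n M) in
/-- The space `H^s(M, ℂ)`, with its own topology (not that of uniform convergence). -/
def HsC (s : WithTop ℝ) : Type u := ↥(sobolevSubmodule n M s)

variable {s : WithTop ℝ}

instance : AddCommGroup (HsC n M s) := inferInstanceAs (AddCommGroup ↥(sobolevSubmodule n M s))

instance : Module ℂ (HsC n M s) := inferInstanceAs (Module ℂ ↥(sobolevSubmodule n M s))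

/-- The underlying continuous function. -/
def HsC.toC : HsC n M s →ₗ[ℂ] C(M, ℂ) := (sobolevSubmodule n M s).subtype

instance : CoeFun (HsC n M s) (fun _ => M → ℂ) := ⟨fun f => f.toC⟩

/-- `(1 - (2π)⁻² Δ)^{r/2} ((χ f) ∘ e⁻¹)`, an element of `L²(ℝⁿ)`. -/
def HsC.bessel (c : LocalCutoff n M) (r : ℝ) (hr : (r : WithTop ℝ) ≤ s) (f : HsC n M s) :
    Lp ℂ 2 (volume : Measure (EuclideanSpace ℝ (Fin n))) :=
  (f.2 c r hr).choose

theorem HsC.bessel_spec (c : LocalCutoff n M) (r : ℝ) (hr : (r : WithTop ℝ) ≤ s)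
    (f : HsC n M s) :
    TemperedDistribution.besselPotential _ ℂ r
      (c.toLp f.toC : 𝓢'(EuclideanSpace ℝ (Fin n), ℂ)) = (HsC.bessel c r hr f : 𝓢'(_, ℂ)) :=
  (f.2 c r hr).choose_spec

/-- The `H^s` topology: the coarsest one for which the maps
`f ↦ (χ f) ∘ e⁻¹ ∈ H^r(ℝⁿ)`, `r ≤ s`, are continuous. It is the Hilbert space topology of `H^s(M)`
if `s` is finite, and the Fréchet topology of `C^∞(M)` if `s = ∞`. -/
instance : TopologicalSpace (HsC n M s) :=
  ⨅ (c : LocalCutoff n M) (r : ℝ) (hr : (r : WithTop ℝ) ≤ s),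
    TopologicalSpace.induced (HsC.bessel c r hr) inferInstance

/-- A real-valued continuous function, viewed as a complex-valued one. -/
def complexify : C(M, ℝ) →ₗ[ℝ] C(M, ℂ) where
  toFun f := ⟨fun x => (f x : ℂ), by fun_prop⟩
  map_add' f g := by ext x; simp
  map_smul' a f := by ext x; simp

variable (n M) in
/-- The real-valued functions of class `H^s`. -/
def realSobolevSubmodule (s : WithTop ℝ) : Submodule ℝ C(M, ℝ) :=
  ((sobolevSubmodule n M s).restrictScalars ℝ).comap complexify

variable (n M) in
/-- The space `H^s(M)` of real-valued functions. -/
def HsR (s : WithTop ℝ) : Type u := ↥(realSobolevSubmodule n M s)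

instance : AddCommGroup (HsR n M s) := inferInstanceAs (AddCommGroup ↥(realSobolevSubmodule n M s))

instance : Module ℝ (HsR n M s) := inferInstanceAs (Module ℝ ↥(realSobolevSubmodule n M s))

/-- The underlying continuous function. -/
def HsR.toC : HsR n M s →ₗ[ℝ] C(M, ℝ) := (realSobolevSubmodule n M s).subtype

instance : CoeFun (HsR n M s) (fun _ => M → ℝ) := ⟨fun f => f.toC⟩

/-- The inclusion `H^s(M) ⊆ H^s(M, ℂ)`. -/
def HsR.toHsC (f : HsR n M s) : HsC n M s := ⟨complexify f.toC, f.2⟩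

instance : TopologicalSpace (HsR n M s) := TopologicalSpace.induced HsR.toHsC inferInstance

variable (n M s) in
/-- The constants in `H^s(M)`. -/
def constants : Submodule ℝ (HsR n M s) where
  carrier := {f | ∃ a : ℝ, ∀ x, f x = a}
  add_mem' := by
    rintro f g ⟨a, ha⟩ ⟨b, hb⟩
    exact ⟨a + b, fun x => by simp [ha, hb]⟩
  zero_mem' := ⟨0, fun x => by simp⟩
  smul_mem' := by
    rintro t f ⟨a, ha⟩
    exact ⟨t * a, fun x => by simp [ha]⟩

end Sobolev

/-! ### Volume forms -/

/-- `μ` is the measure given by a volume form: in every chart it has a smooth, strictly positive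
density with respect to Lebesgue measure. -/
def IsSmoothVolume (n : ℕ) {M : Type u} [TopologicalSpace M]
    [ChartedSpace (EuclideanSpace ℝ (Fin n)) M] [MeasurableSpace M] (μ : Measure M) : Prop :=
  ∀ e ∈ IsManifold.maximalAtlas (𝓡 n) ∞ M, ∃ g : EuclideanSpace ℝ (Fin n) → ℝ,
    ContDiffOn ℝ ∞ g e.target ∧ (∀ x ∈ e.target, 0 < g x) ∧
    (μ.restrict e.source).map e =
      (volume.restrict e.target).withDensity (fun x => ENNReal.ofReal (g x))

/-! ### The cotangent bundle of the space of densities -/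

section Densities

variable {n : ℕ} {M : Type u} [TopologicalSpace M] [ChartedSpace (EuclideanSpace ℝ (Fin n)) M]
  [CompactSpace M] [MeasurableSpace M] [BorelSpace M]

theorem integrable_continuousMap {𝕜 : Type*} [RCLike 𝕜] (μ : Measure M) [IsProbabilityMeasure μ]
    (f : C(M, 𝕜)) : Integrable f μ :=
  f.continuous.integrable_of_hasCompactSupport (HasCompactSupport.of_compactSpace f)

variable (n) in
/-- `Dens^s(M)`. -/
abbrev Dens (s : WithTop ℝ) (μ : Measure M) : Type u :=
  {ρ : HsR n M s // (∀ x, 0 < ρ x) ∧ ∫ x, ρ x ∂μ = 1}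

variable (n) in
/-- `H^s_0(M)`, the functions of class `H^s` with vanishing integral. -/
def HsZero (s : WithTop ℝ) (μ : Measure M) [IsProbabilityMeasure μ] :
    Submodule ℝ (HsR n M s) where
  carrier := {f | ∫ x, f x ∂μ = 0}
  add_mem' {f g} hf hg := by
    have := integral_add (integrable_continuousMap μ f.toC) (integrable_continuousMap μ g.toC)
    simp only [mem_ofPred_eq] at hf hg ⊢
    simp only [map_add, ContinuousMap.add_apply]
    rw [this, hf, hg, add_zero]
  zero_mem' := by simp
  smul_mem' a f hf := by
    simp only [mem_ofPred_eq] at hf ⊢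
    simp only [map_smul, ContinuousMap.smul_apply]
    rw [integral_smul, hf, smul_zero]

variable (n) in
/-- `T*Dens^s(M) = Dens^s(M) × H^s(M)/ℝ`. -/
abbrev CotDens (s : WithTop ℝ) (μ : Measure M) : Type u :=
  Dens n s μ × (HsR n M s ⧸ constants n M s)

variable (n) in
/-- The model space `H^s_0(M) × H^s(M)/ℝ` of `T*Dens^s(M)`. -/
abbrev CotModel (s : WithTop ℝ) (μ : Measure M) [IsProbabilityMeasure μ] : Type u :=
  HsZero n s μ × (HsR n M s ⧸ constants n M s)

variable {s : WithTop ℝ}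

open Classical in
/-- The global chart `(ρ, [θ]) ↦ (ρ - ρ₀, [θ])` of `T*Dens^s(M)` with origin `ρ₀`. -/
def cotChart {μ : Measure M} [IsProbabilityMeasure μ] (ρ₀ : Dens n s μ) :
    PartialEquiv (CotDens n s μ) (CotModel n s μ) where
  toFun p := (⟨p.1.1 - ρ₀.1, by
    have := integral_sub (integrable_continuousMap μ p.1.1.toC)
      (integrable_continuousMap μ ρ₀.1.toC)
    change ∫ x, (p.1.1 - ρ₀.1).toC x ∂μ = 0
    simp only [map_sub, ContinuousMap.sub_apply]
    rw [this, p.1.2.2, ρ₀.2.2, sub_self]⟩, p.2)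
  invFun q := (if h : ∀ x, 0 < (ρ₀.1 + q.1.1).toC x then ⟨ρ₀.1 + q.1.1, h, by
    have := integral_add (integrable_continuousMap μ ρ₀.1.toC)
      (integrable_continuousMap μ q.1.1.toC)
    have hq : ∫ x, q.1.1.toC x ∂μ = 0 := q.1.2
    simp only [map_add, ContinuousMap.add_apply]
    rw [this, ρ₀.2.2, hq, add_zero]⟩ else ρ₀, q.2)
  source := univ
  target := {q | ∀ x, 0 < (ρ₀.1 + q.1.1).toC x}
  map_source' p _ := by
    change ∀ x, 0 < (ρ₀.1 + (p.1.1 - ρ₀.1)).toC x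
    rw [add_sub_cancel]
    exact p.1.2.1
  map_target' _ _ := mem_univ _
  left_inv' p _ := by
    have h : ∀ x, 0 < (ρ₀.1 + (p.1.1 - ρ₀.1)).toC x := by
      rw [add_sub_cancel]
      exact p.1.2.1
    refine Prod.ext ?_ rfl
    apply Subtype.ext
    simp only [dif_pos h]
    exact add_sub_cancel _ _
  right_inv' q hq := by
    have h : ∀ x, 0 < (ρ₀.1 + q.1.1).toC x := hq
    refine Prod.ext ?_ rfl
    apply Subtype.ext
    simp only [dif_pos h]
    exact add_sub_cancel_left _ _

/-- The Sasaki–Fisher–Rao metric at `(ρ, [θ])` on tangent vectors `(ρ̇ᵢ, θ̇ᵢ)`, where the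
representatives `θ̇ᵢ` of the cosets are normalized by `∫ θ̇ᵢ ρ μ = 0`. -/
def sasakiFisherRao (μ : Measure M) (ρ : Dens n s μ) (ρ₁ θ₁ ρ₂ θ₂ : HsR n M s) : ℝ :=
  (1 / 4) * ∫ x, (ρ₁ x * ρ₂ x / ρ.1 x + θ₁ x * θ₂ x * ρ.1 x) ∂μ

end Densities

/-! ### The projective space of wave functions -/

section Projective

/-- The quotient topology on a projective space. -/
instance projTopology {K V : Type*} [DivisionRing K] [AddCommGroup V] [Module K V]
    [TopologicalSpace V] : TopologicalSpace (ℙ K V) :=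
  inferInstanceAs (TopologicalSpace (Quotient (projectivizationSetoid K V)))

variable {n : ℕ} {M : Type u} [TopologicalSpace M] [ChartedSpace (EuclideanSpace ℝ (Fin n)) M]
  [CompactSpace M] [MeasurableSpace M] [BorelSpace M] {s : WithTop ℝ}

/-- The `L²` Hermitian product `∫ φ ψ̄ μ`. -/
def l2 (μ : Measure M) (φ ψ : HsC n M s) : ℂ := ∫ x, φ x * (starRingEnd ℂ) (ψ x) ∂μ

theorem l2_add_left (μ : Measure M) [IsProbabilityMeasure μ] (φ φ' ψ : HsC n M s) :
    l2 μ (φ + φ') ψ = l2 μ φ ψ + l2 μ φ' ψ := by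
  have := integral_add (integrable_continuousMap μ (φ.toC * star ψ.toC))
      (integrable_continuousMap μ (φ'.toC * star ψ.toC))
  simp only [l2, map_add, ContinuousMap.add_apply, add_mul]
  simpa using this

theorem l2_smul_left (μ : Measure M) (a : ℂ) (φ ψ : HsC n M s) :
    l2 μ (a • φ) ψ = a * l2 μ φ ψ := by
  simp only [l2, map_smul, ContinuousMap.smul_apply, smul_eq_mul, mul_assoc]
  exact integral_const_mul a _

theorem l2_zero_left (μ : Measure M) (ψ : HsC n M s) : l2 μ 0 ψ = 0 := by simp [l2]

theorem l2_sub_left (μ : Measure M) [IsProbabilityMeasure μ] (φ φ' ψ : HsC n M s) :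
    l2 μ (φ - φ') ψ = l2 μ φ ψ - l2 μ φ' ψ := by
  have := l2_add_left μ (φ - φ') φ' ψ
  rw [sub_add_cancel] at this
  rw [this, add_sub_cancel_right]

/-- The orthogonal complement of `φ` in `H^s(M, ℂ)`. -/
def orth (μ : Measure M) [IsProbabilityMeasure μ] (φ : HsC n M s) : Submodule ℂ (HsC n M s) where
  carrier := {v | l2 μ v φ = 0}
  add_mem' {v w} hv hw := by
    simp only [mem_ofPred_eq] at hv hw ⊢
    rw [l2_add_left, hv, hw, add_zero]
  zero_mem' := l2_zero_left μ φ
  smul_mem' a v hv := by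
    simp only [mem_ofPred_eq] at hv ⊢
    rw [l2_smul_left, hv, mul_zero]

/-- The orthogonal projection along a unit vector `φ`. -/
def orthProj (μ : Measure M) [IsProbabilityMeasure μ] (φ : HsC n M s) (hφ : l2 μ φ φ = 1)
    (v : HsC n M s) : orth μ φ :=
  ⟨v - l2 μ v φ • φ, by
    change l2 μ (v - l2 μ v φ • φ) φ = 0
    rw [l2_sub_left, l2_smul_left, hφ, mul_one, sub_self]⟩

/-- The affine chart `[ψ] ↦ ψ / ⟨ψ, φ⟩ - φ` (with values in the orthogonal complement of `φ`,
centered at `[φ]`) of the projective space, for `φ` in the unit sphere. -/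
def projChart (μ : Measure M) [IsProbabilityMeasure μ] (φ : HsC n M s) (hφ : l2 μ φ φ = 1) :
    PartialEquiv (ℙ ℂ (HsC n M s)) (orth μ φ) where
  toFun L := orthProj μ φ hφ ((l2 μ L.rep φ)⁻¹ • L.rep)
  invFun w := Projectivization.mk ℂ (φ + w.1) (by
    intro h
    have h1 : l2 μ (φ + w.1) φ = 1 := by
      rw [l2_add_left, hφ, show l2 μ w.1 φ = 0 from w.2, add_zero]
    rw [h, l2_zero_left] at h1
    exact zero_ne_one h1)
  source := {L | l2 μ L.rep φ ≠ 0}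
  target := univ
  map_source' _ _ := mem_univ _
  map_target' w _ := by
    have h1 : l2 μ (φ + w.1) φ = 1 := by
      rw [l2_add_left, hφ, show l2 μ w.1 φ = 0 from w.2, add_zero]
    have hne : φ + w.1 ≠ 0 := by
      intro h
      rw [h, l2_zero_left] at h1
      exact zero_ne_one h1
    obtain ⟨a, ha⟩ := Projectivization.exists_smul_eq_mk_rep ℂ (φ + w.1) hne
    change l2 μ (Projectivization.mk ℂ (φ + w.1) hne).rep φ ≠ 0
    rw [← ha, Units.smul_def, l2_smul_left, h1, mul_one]
    exact a.ne_zero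
  left_inv' L hL := by
    have hL' : l2 μ L.rep φ ≠ 0 := hL
    conv_rhs => rw [← L.mk_rep]
    rw [Projectivization.mk_eq_mk_iff']
    refine ⟨(l2 μ L.rep φ)⁻¹, ?_⟩
    simp only [orthProj]
    rw [l2_smul_left, inv_mul_cancel₀ hL', one_smul, add_sub_cancel]
  right_inv' w _ := by
    have h1 : l2 μ (φ + w.1) φ = 1 := by
      rw [l2_add_left, hφ, show l2 μ w.1 φ = 0 from w.2, add_zero]
    have hne : φ + w.1 ≠ 0 := by
      intro h
      rw [h, l2_zero_left] at h1
      exact zero_ne_one h1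
    obtain ⟨a, ha⟩ := Projectivization.exists_smul_eq_mk_rep ℂ (φ + w.1) hne
    apply Subtype.ext
    simp only [orthProj]
    rw [← ha, Units.smul_def, l2_smul_left, h1, mul_one, smul_smul,
      inv_mul_cancel₀ a.ne_zero, one_smul, h1, one_smul, add_sub_cancel_left]

/-- The Fubini–Study Hermitian form at `[ψ]`, on tangent vectors represented by `ψ₁` and `ψ₂`.
The Fubini–Study Riemannian metric is its real part. -/
def fubiniStudy (μ : Measure M) (ψ ψ₁ ψ₂ : HsC n M s) : ℂ :=
  l2 μ ψ₁ ψ₂ / l2 μ ψ ψ - l2 μ ψ₁ ψ * l2 μ ψ ψ₂ / l2 μ ψ ψ ^ 2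

variable (n M s) in
/-- `ℙH^s(M, ℂ ∖ {0})`, the classes of nowhere vanishing wave functions. -/
def nonvanishing : Set (ℙ ℂ (HsC n M s)) :=
  {L | ∀ x, L.rep x ≠ 0}

variable (n M s) in
/-- The classes of nowhere vanishing wave functions that possess a continuous real phase. -/
def withPhase : Set (ℙ ℂ (HsC n M s)) :=
  {L | L ∈ nonvanishing n M s ∧ ∃ α : C(M, ℝ), ∀ x,
    L.rep x = (‖L.rep x‖ : ℂ) * Complex.exp (Complex.I * (α x : ℂ))}

end Projective

/-- `√ρ e^{iθ/2}`. -/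
def madelung (ρ θ : ℝ) : ℂ := (Real.sqrt ρ : ℂ) * Complex.exp (Complex.I * (θ : ℂ) / 2)

end Madelung

end

/-! Writing wave functions as `exp u` turns the Madelung transform into `(ρ, [θ]) ↦ [exp ((log ρ +
iθ) / 2)]`, with inverse `[exp u] ↦ (|exp u|² / ∫ |exp u|², [2 Im u])`. Changing `θ` by a constant
changes `ψ` by a phase, so the class is well defined. On a connected `M` two continuous logarithms
of proportional functions differ by a constant, because `exp : ℂ → ℂ ∖ {0}` is a covering; this
gives injectivity (`polar_eq_of_ray_eq`). The image consists of the classes that have a continuous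
logarithm. It is open, because the series of `log (1 + h)` supplies logarithms near `exp u`, and for
simply connected `M` lifting through the covering yields all nowhere vanishing classes.

The analytic content is that `exp` and `log` operate smoothly on `H^s`. For `r > n/2`, `H^r(ℝⁿ)` is
a Banach algebra up to a constant: the Peetre inequality moves the Fourier weight onto one factor,
Young's inequality bounds the convolution, and the Sobolev embedding bounds the `L¹` norm of a
Fourier transform (`exists_synth_mul`, `exists_wienerNorm_le`). Hence entire series operate. For the
logarithm only the supremum norm of `h` is below `1`, so the spectral radius in `H^r` has to be
bounded by the supremum norm; an interpolation inequality does this (`exists_synth_pow_small`).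
Cutoff functions carry these facts to `M`. Consequently every continuous logarithm of an `H^s`
function is itself of class `H^s` (`mem_of_exp_mem`).

For smoothness, `exp h - 1` and `log (1 + h)` both have the form `h + h² · (power series)`
(`TangentToId`), and the functional equations transport the resulting derivative at `0` to every
other point. Derivatives are taken in a strict sense, with moving base point and direction, so that
the chain rule holds without any norm.

For the metric, the derivative of `ψ` is `ψ (ρ₁/ρ + iθ₁) / 2`. As `|ψ|² = ρ`, its product with `ψ`
is `(∫ ρ₁ + i ∫ θ₁ρ) / 2 = 0`: the normalization of `θ₁` says exactly that the vector is horizontal.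
The correction term of Fubini–Study then vanishes, and the real part of the remaining `L²` product
is the Sasaki–Fisher–Rao form. -/

set_option linter.unusedSectionVars false

noncomputable section

namespace Madelung

/-! ### Bessel potential spaces on `ℝⁿ` through weighted Fourier transforms. -/

section FourierSide

open FourierTransform TemperedDistribution

variable {V : Type*} [NormedAddCommGroup V] [InnerProductSpace ℝ V]

/-- The weight `(1 + ‖ξ‖²)^{r/2}`. -/
def weight (r : ℝ) (ξ : V) : ℝ := (1 + ‖ξ‖ ^ 2) ^ (r / 2)

theorem weight_pos (r : ℝ) (ξ : V) : 0 < weight r ξ := by unfold weight; positivity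

theorem weight_add (r t : ℝ) (ξ : V) : weight (r + t) ξ = weight r ξ * weight t ξ := by
  unfold weight
  rw [add_div, Real.rpow_add (by positivity)]

theorem weight_zero (ξ : V) : weight 0 ξ = 1 := by simp [weight]

theorem weight_neg_mul (r : ℝ) (ξ : V) : weight (-r) ξ * weight r ξ = 1 := by
  rw [← weight_add, neg_add_cancel, weight_zero]

theorem continuous_weight (r : ℝ) : Continuous (weight r : V → ℝ) := by
  unfold weight
  exact Continuous.rpow_const (by fun_prop) fun x => Or.inl (by positivity)

theorem weight_neg_apply (r : ℝ) (ξ : V) : weight r (-ξ) = weight r ξ := by simp [weight]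

theorem weight_rpow (r t : ℝ) (ξ : V) : weight r ξ ^ t = weight (r * t) ξ := by
  unfold weight
  rw [← Real.rpow_mul (by positivity)]
  congr 1
  ring

theorem weight_le_one {r : ℝ} (hr : r ≤ 0) (ξ : V) : weight r ξ ≤ 1 :=
  Real.rpow_le_one_of_one_le_of_nonpos (by simp) (by linarith)

/-- Peetre-type inequality. -/
theorem weight_le_add {r : ℝ} (hr : 0 ≤ r) (ξ η : V) :
    weight r ξ ≤ 2 ^ r * (weight r η + weight r (ξ - η)) := by
  -- The longer of `η` and `ξ - η` has at least half the length of `ξ`. The factor `4 = 2²` in `1 +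
  -- ‖a + b‖² ≤ 4 (1 + ‖a‖²)` becomes `2^r` after raising to the power `r / 2`.
  have key : ∀ a b : V, ‖b‖ ≤ ‖a‖ → weight r (a + b) ≤ 2 ^ r * weight r a := by
    intro a b h
    have h1 : 1 + ‖a + b‖ ^ 2 ≤ 2 ^ (2 : ℝ) * (1 + ‖a‖ ^ 2) := by
      have h2 : ‖a + b‖ ≤ 2 * ‖a‖ := (norm_add_le a b).trans (by linarith)
      have h3 : ‖a + b‖ ^ 2 ≤ (2 * ‖a‖) ^ 2 := by gcongr
      norm_num
      nlinarith
    unfold weight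
    calc _ ≤ (2 ^ (2 : ℝ) * (1 + ‖a‖ ^ 2)) ^ (r / 2) :=
          Real.rpow_le_rpow (by positivity) h1 (by positivity)
      _ = _ := by
        rw [Real.mul_rpow (by positivity) (by positivity), ← Real.rpow_mul (by positivity)]
        congr 2
        ring
  have h1 := (weight_pos r η).le
  have h2 := (weight_pos r (ξ - η)).le
  have h3 : (0 : ℝ) ≤ 2 ^ r := by positivity
  rcases le_total ‖η‖ ‖ξ - η‖ with h | h
  · have := key _ _ h
    rw [sub_add_cancel] at this
    exact this.trans (by gcongr; linarith)
  · have := key _ _ h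
    rw [add_sub_cancel] at this
    exact this.trans (by gcongr; linarith)

variable [FiniteDimensional ℝ V] [MeasurableSpace V] [BorelSpace V]

theorem memLp_weight {r : ℝ} (hr : Module.finrank ℝ V < 2 * r) :
    MemLp (fun ξ : V => (weight (-r) ξ : ℂ)) 2 volume := by
  refine MemLp.ofReal (K := ℂ) ⟨(continuous_weight (V := V) (-r)).aestronglyMeasurable, ?_⟩
  rw [eLpNorm_lt_top_iff_lintegral_rpow_enorm_lt_top (by norm_num) (by norm_num)]
  refine lt_of_le_of_lt (le_of_eq ?_) 
    (integrable_rpow_neg_one_add_norm_sq (μ := (volume : Measure V)) hr).lintegral_lt_top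
  congr 1
  funext a
  change ‖weight (-r) a‖ₑ ^ _ = _
  rw [← ofReal_norm, Real.norm_of_nonneg (weight_pos _ _).le,
    ENNReal.ofReal_rpow_of_nonneg (weight_pos _ _).le (by norm_num)]
  simp only [weight]
  rw [← Real.rpow_mul (by positivity)]
  congr 2
  norm_num
  ring

/-- The Fourier transform of the function with weighted Fourier transform `b`. -/
def symbolOf (r : ℝ) (b : Lp ℂ 2 (volume : Measure V)) (ξ : V) : ℂ := (weight (-r) ξ : ℂ) * b ξ

/-- The function in `H^r` whose weighted Fourier transform is `b`. -/
def synth (r : ℝ) (b : Lp ℂ 2 (volume : Measure V)) : V → ℂ := 𝓕⁻ (symbolOf r b)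

theorem stronglyMeasurable_symbolOf (r : ℝ) (b : Lp ℂ 2 (volume : Measure V)) :
    StronglyMeasurable (symbolOf r b) :=
  (Complex.continuous_ofReal.comp (continuous_weight _)).stronglyMeasurable.mul
    (Lp.stronglyMeasurable b)

theorem memLp_symbolOf {r : ℝ} (hr : 0 ≤ r) (b : Lp ℂ 2 (volume : Measure V)) :
    MemLp (symbolOf r b) 2 volume := by
  refine (Lp.memLp b).mono (stronglyMeasurable_symbolOf r b).aestronglyMeasurable ?_
  filter_upwards with ξ
  simp only [symbolOf, norm_mul, Complex.norm_real, Real.norm_of_nonneg (weight_pos _ _).le]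
  exact mul_le_of_le_one_left (norm_nonneg _) (weight_le_one (by linarith) ξ)

/-- Cauchy–Schwarz, the weight being square integrable precisely for `r > dim / 2`. This makes
`synth r b` an honest continuous function, given by an integral at every point. -/
theorem integrable_symbolOf {r : ℝ} (hr : Module.finrank ℝ V < 2 * r)
    (b : Lp ℂ 2 (volume : Measure V)) : Integrable (symbolOf r b) volume :=
  (memLp_weight hr).integrable_mul (Lp.memLp b)

/-- The Wiener norm `∫ |f̂|`. -/
def wienerNorm (r : ℝ) (b : Lp ℂ 2 (volume : Measure V)) : ℝ := ∫ ξ, ‖symbolOf r b ξ‖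

theorem wienerNorm_nonneg (r : ℝ) (b : Lp ℂ 2 (volume : Measure V)) : 0 ≤ wienerNorm r b :=
  integral_nonneg fun _ => norm_nonneg _

theorem norm_synth_le (r : ℝ) (b : Lp ℂ 2 (volume : Measure V)) (x : V) :
    ‖synth r b x‖ ≤ wienerNorm r b := by
  rw [synth, Real.fourierInv_eq]
  refine (norm_integral_le_integral_norm _).trans (le_of_eq ?_)
  simp [wienerNorm]

theorem continuous_synth {r : ℝ} (hr : Module.finrank ℝ V < 2 * r)
    (b : Lp ℂ 2 (volume : Measure V)) : Continuous (synth r b) := by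
  have h : Continuous (𝓕 (symbolOf r b)) :=
    VectorFourier.fourierIntegral_continuous Real.continuous_fourierChar
      (by exact continuous_inner) (integrable_symbolOf hr b)
  have e : synth r b = fun x => 𝓕 (symbolOf r b) (-x) := by
    funext x
    rw [synth, Real.fourierInv_eq_fourier_neg]
  rw [e]
  fun_prop

theorem synth_add {r : ℝ} (hr : Module.finrank ℝ V < 2 * r) (a b : Lp ℂ 2 (volume : Measure V)) :
    synth r (a + b) = synth r a + synth r b := by
  funext x
  have e : symbolOf r (a + b) =ᵐ[volume] symbolOf r a + symbolOf r b := by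
    filter_upwards [Lp.coeFn_add a b] with ξ h
    simp only [symbolOf, Pi.add_apply]
    rw [h, Pi.add_apply, mul_add]
  rw [synth, Real.fourierInv_congr_ae e, Pi.add_apply, synth, synth,
    Real.fourierInv_eq_fourier_neg, Real.fourierInv_eq_fourier_neg, Real.fourierInv_eq_fourier_neg]
  have := VectorFourier.fourierIntegral_add (L := innerₗ V) Real.continuous_fourierChar
    (by exact continuous_inner) (integrable_symbolOf hr a) (integrable_symbolOf hr b)
  exact congrFun this (-x)

theorem synth_smul (r : ℝ) (c : ℂ) (b : Lp ℂ 2 (volume : Measure V)) :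
    synth r (c • b) = c • synth r b := by
  funext x
  have e : symbolOf r (c • b) =ᵐ[volume] c • symbolOf r b := by
    filter_upwards [Lp.coeFn_smul c b] with ξ h
    simp only [symbolOf, Pi.smul_apply]
    rw [h, Pi.smul_apply, smul_eq_mul, smul_eq_mul, mul_left_comm]
  rw [synth, Real.fourierInv_congr_ae e, Pi.smul_apply, synth,
    Real.fourierInv_eq_fourier_neg, Real.fourierInv_eq_fourier_neg]
  have := VectorFourier.fourierIntegral_const_smul Real.fourierChar volume (innerₗ V)
    (symbolOf r b) c
  exact (congrFun this (-x))

/-- The inverse Fourier transforms on `L¹` and on `L²` agree. -/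
theorem fourierInv_toLp_ae_eq {g : V → ℂ} (h1 : Integrable g volume) (h2 : MemLp g 2 volume) :
    (𝓕⁻ (h2.toLp g) : Lp ℂ 2 (volume : Measure V)) =ᵐ[volume] 𝓕⁻ g := by
  have hc : Continuous (𝓕⁻ g : V → ℂ) := by
    have h : Continuous (𝓕 g : V → ℂ) := VectorFourier.fourierIntegral_continuous
      Real.continuous_fourierChar (by exact continuous_inner) h1
    have e : (𝓕⁻ g : V → ℂ) = fun x => 𝓕 g (-x) := by
      funext x
      rw [Real.fourierInv_eq_fourier_neg]
    rw [e]
    fun_prop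
  -- Both sides are tested against a smooth compactly supported `u`. On the `L²` side the transform
  -- is moved to `u` through tempered distributions, on the `L¹` side by Fubini.
  refine ae_eq_of_integral_contDiff_smul_eq ((Lp.memLp _).locallyIntegrable (by norm_num))
    hc.locallyIntegrable ?_
  intro u hu hsu
  have hg₁ : HasCompactSupport (Complex.ofRealCLM ∘ u) := hsu.comp_left rfl
  have hg₂ : ContDiff ℝ ∞ (Complex.ofRealCLM ∘ u) := by fun_prop
  let U : 𝓢(V, ℂ) := hg₁.toSchwartzMap hg₂
  have hU : ∀ x, U x = (u x : ℂ) := fun x => rfl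
  have e1 : ∫ x, u x • (𝓕⁻ (h2.toLp g) : Lp ℂ 2 (volume : Measure V)) x
      = ((𝓕⁻ (h2.toLp g) : Lp ℂ 2 (volume : Measure V)) : 𝓢'(V, ℂ)) U := by
    rw [Lp.toTemperedDistribution_apply]
    simp [hU]
  rw [e1, ← Lp.fourierInv_toTemperedDistribution_eq, TemperedDistribution.fourierInv_apply,
    Lp.toTemperedDistribution_apply]
  have e2 : ∫ x, (𝓕⁻ U) x • (h2.toLp g) x = ∫ x, (𝓕⁻ U) x • g x := by
    refine integral_congr_ae ?_
    filter_upwards [h2.coeFn_toLp] with x hx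
    rw [hx]
  rw [e2]
  -- Taking minus the inner product as pairing turns the general Fourier integral into the inverse
  -- transform.
  have e3 := VectorFourier.integral_fourierIntegral_smul_eq_flip (μ := (volume : Measure V))
    (ν := (volume : Measure V)) (e := Real.fourierChar) (L := -innerₗ V) (f := U) (g := g)
    Real.continuous_fourierChar (by exact (continuous_inner (𝕜 := ℝ) (E := V)).neg)
    U.integrable h1
  have e4 : ∀ x, VectorFourier.fourierIntegral Real.fourierChar volume (-innerₗ V) U x
      = (𝓕⁻ U) x := by
    intro x
    rw [SchwartzMap.fourierInv_coe, Real.fourierInv_eq, VectorFourier.fourierIntegral]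
    simp
  have e5 : ∀ x, VectorFourier.fourierIntegral Real.fourierChar volume (-innerₗ V).flip g x
      = (𝓕⁻ g) x := by
    intro x
    rw [Real.fourierInv_eq, VectorFourier.fourierIntegral]
    simp [real_inner_comm]
  simp only [e4, e5] at e3
  rw [e3]
  simp [hU]

theorem toTemperedDistribution_injective {a b : Lp ℂ 2 (volume : Measure V)}
    (h : (a : 𝓢'(V, ℂ)) = (b : 𝓢'(V, ℂ))) : a = b := by
  have := LinearMap.ker_eq_bot.mp (Lp.ker_toTemperedDistributionCLM_eq_bot (E := V) (F := ℂ)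
    (μ := volume) (p := 2))
  exact this h

theorem hasTemperateGrowth_weight (r : ℝ) :
    (fun ξ : V => (weight r ξ : ℂ)).HasTemperateGrowth := by
  unfold weight
  fun_prop

/-- For nonpositive order the multiplier is bounded by `1`, so it acts on `L²` and the
distributional product is a pointwise one. Positive orders are reached by inverting this case. -/
theorem besselPotential_toTemperedDistribution {t : ℝ} (ht : t ≤ 0)
    (β : Lp ℂ 2 (volume : Measure V)) :
    besselPotential V ℂ t (β : 𝓢'(V, ℂ)) =
      ((𝓕⁻ ((memLp_symbolOf (r := -t) (by linarith) (𝓕 β)).toLp) :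
        Lp ℂ 2 (volume : Measure V)) : 𝓢'(V, ℂ)) := by
  rw [← Lp.fourierInv_toTemperedDistribution_eq]
  have hb : ∀ ξ : V, ‖(weight t ξ : ℂ)‖ ≤ 1 := fun ξ => by
    rw [Complex.norm_real, Real.norm_of_nonneg (weight_pos _ _).le]
    exact weight_le_one ht ξ
  have hm : MemLp (fun ξ : V => (weight t ξ : ℂ)) ∞ volume :=
    memLp_top_of_bound
      (Complex.continuous_ofReal.comp (continuous_weight t)).aestronglyMeasurable 1
      (Eventually.of_forall hb)
  have := Lp.toTemperedDistribution_smul_eq (p := ∞) (q := 2) (r := 2) (μ := (volume : Measure V))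
    (hasTemperateGrowth_weight t) hm (𝓕 β)
  rw [besselPotential, TemperedDistribution.fourierMultiplierCLM_apply,
    Lp.fourier_toTemperedDistribution_eq]
  change 𝓕⁻ (smulLeftCLM ℂ (fun ξ : V => (weight t ξ : ℂ)) _) = _
  rw [← this]
  congr 2
  apply Lp.ext
  filter_upwards [Lp.coeFn_lpSMul (r := 2) (hm.toLp _) (𝓕 β), hm.coeFn_toLp,
    (memLp_symbolOf (r := -t) (by linarith) (𝓕 β)).coeFn_toLp] with x h1 h2 h3
  rw [h1, h3]
  simp [h2, symbolOf]

/-- Membership in `H^r`, `r > dim / 2`, for continuous square integrable functions. -/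
theorem besselPotential_eq_iff {r : ℝ} (hr : Module.finrank ℝ V < 2 * r) {f : V → ℂ}
    (hf : Continuous f) (hf2 : MemLp f 2 volume) (β : Lp ℂ 2 (volume : Measure V)) :
    besselPotential V ℂ r ((hf2.toLp f : Lp ℂ 2 (volume : Measure V)) : 𝓢'(V, ℂ)) = β ↔
      f = synth r (𝓕 β) := by
  have hr0 : 0 ≤ r := by
    have : (0 : ℝ) ≤ Module.finrank ℝ V := by positivity
    linarith
  have hae := fourierInv_toLp_ae_eq (integrable_symbolOf hr (𝓕 β)) (memLp_symbolOf hr0 (𝓕 β))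
  -- The equation is inverted to `f = J^{-r} β`, whose right side is the `L²` class of `synth r (𝓕
  -- β)`. Two continuous functions that agree almost everywhere are equal.
  rw [← besselPotential_neg_apply_eq_iff, besselPotential_toTemperedDistribution (by linarith)]
  simp only [neg_neg]
  constructor
  · intro h
    have h1 := toTemperedDistribution_injective h
    rw [h1] at hae
    have h2 : f =ᵐ[volume] synth r (𝓕 β) := hf2.coeFn_toLp.symm.trans hae
    exact hf.ae_eq_iff_eq volume (continuous_synth hr _) |>.mp h2
  · intro h
    congr 1
    apply Lp.ext
    refine hae.trans ?_
    have : synth r (𝓕 β) =ᵐ[volume] f := by rw [h]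
    exact this.trans hf2.coeFn_toLp.symm

/-- Plancherel. -/
theorem eLpNorm_symbolOf {r : ℝ} (hr : Module.finrank ℝ V < 2 * r)
    (b : Lp ℂ 2 (volume : Measure V)) :
    eLpNorm (symbolOf r b) 2 volume = eLpNorm (synth r b) 2 volume := by
  have hr0 : 0 ≤ r := by
    have : (0 : ℝ) ≤ Module.finrank ℝ V := by positivity
    linarith
  have hae := fourierInv_toLp_ae_eq (integrable_symbolOf hr b) (memLp_symbolOf hr0 b)
  have h1 : ‖(𝓕⁻ ((memLp_symbolOf hr0 b).toLp) : Lp ℂ 2 (volume : Measure V))‖ =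
      ‖(memLp_symbolOf hr0 b).toLp‖ := (Lp.fourierTransformₗᵢ V ℂ).symm.norm_map _
  have h2 := congrArg ENNReal.ofReal h1
  rw [ofReal_norm, ofReal_norm, Lp.enorm_def, Lp.enorm_def, eLpNorm_congr_ae hae,
    eLpNorm_congr_ae (memLp_symbolOf hr0 b).coeFn_toLp] at h2
  exact h2.symm

theorem memLp_synth {r : ℝ} (hr : Module.finrank ℝ V < 2 * r)
    (b : Lp ℂ 2 (volume : Measure V)) : MemLp (synth r b) 2 volume := by
  have hr0 : 0 ≤ r := by
    have : (0 : ℝ) ≤ Module.finrank ℝ V := by positivity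
    linarith
  refine ⟨(continuous_synth hr b).aestronglyMeasurable, ?_⟩
  rw [← eLpNorm_symbolOf hr]
  exact (memLp_symbolOf hr0 b).2

end FourierSide

/-! ### Products and interpolation in `H^r(ℝⁿ)`, `r > n/2`. -/

section Product

open FourierTransform TemperedDistribution

variable {V : Type*} [NormedAddCommGroup V] [InnerProductSpace ℝ V] [FiniteDimensional ℝ V]
  [MeasurableSpace V] [BorelSpace V]

/-- Young's inequality `‖F * G‖₂ ≤ ‖F‖₂ ‖G‖₁`, squared. -/
theorem lintegral_convolution_sq_le {F G : V → ℝ≥0∞} (hF : Measurable F) (hG : Measurable G) :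
    ∫⁻ x, (∫⁻ y, F (x - y) * G y) ^ (2 : ℝ) ≤
      (∫⁻ x, F x ^ (2 : ℝ)) * (∫⁻ y, G y) ^ (2 : ℝ) := by
  -- Cauchy–Schwarz applied to the splitting `F G = (F² G)^{1/2} G^{1/2}`.
  have h1 : ∀ x, (∫⁻ y, F (x - y) * G y) ^ (2 : ℝ) ≤
      (∫⁻ y, F (x - y) ^ (2 : ℝ) * G y) * (∫⁻ y, G y) := by
    intro x
    have hm : Measurable fun y => F (x - y) ^ (2 : ℝ) * G y := by fun_prop
    have h := ENNReal.lintegral_mul_norm_pow_le (μ := (volume : Measure V)) hm.aemeasurable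
      hG.aemeasurable (p := 1 / 2) (q := 1 / 2) (by norm_num) (by norm_num) (by norm_num)
    have e : ∀ y, (F (x - y) ^ (2 : ℝ) * G y) ^ (1 / 2 : ℝ) * G y ^ (1 / 2 : ℝ)
        = F (x - y) * G y := by
      intro y
      rw [ENNReal.mul_rpow_of_nonneg _ _ (by norm_num), mul_assoc,
        ← ENNReal.rpow_add_of_nonneg _ _ (by norm_num) (by norm_num), ← ENNReal.rpow_mul]
      norm_num
    simp only [e] at h
    calc _ ≤ _ := ENNReal.rpow_le_rpow h (by norm_num)
      _ = _ := by
        rw [ENNReal.mul_rpow_of_nonneg _ _ (by norm_num), ← ENNReal.rpow_mul, ← ENNReal.rpow_mul]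
        norm_num
  calc _ ≤ ∫⁻ x, (∫⁻ y, F (x - y) ^ (2 : ℝ) * G y) * (∫⁻ y, G y) := lintegral_mono h1
    _ = (∫⁻ x, ∫⁻ y, F (x - y) ^ (2 : ℝ) * G y) * (∫⁻ y, G y) := by
      rw [lintegral_mul_const]
      exact Measurable.lintegral_prod_right' (f := fun p : V × V => F (p.1 - p.2) ^ (2 : ℝ) * G p.2)
        (by fun_prop)
    _ = (∫⁻ y, ∫⁻ x, F (x - y) ^ (2 : ℝ) * G y) * (∫⁻ y, G y) := by
      rw [lintegral_lintegral_swap]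
      exact Measurable.aemeasurable (by fun_prop)
    _ = _ := by
      have : ∀ y, ∫⁻ x, F (x - y) ^ (2 : ℝ) * G y = (∫⁻ x, F x ^ (2 : ℝ)) * G y := by
        intro y
        rw [lintegral_mul_const _ (by fun_prop),
          lintegral_sub_right_eq_self (fun x => F x ^ (2 : ℝ)) y]
      simp only [this]
      rw [lintegral_const_mul _ hG, mul_assoc]
      congr 1
      rw [show (2 : ℝ) = ((2 : ℕ) : ℝ) by norm_num, ENNReal.rpow_natCast, sq]

theorem eLpNorm_convolution_le {F G : V → ℝ≥0∞} (hF : Measurable F) (hG : Measurable G) :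
    eLpNorm (fun x => ∫⁻ y, F (x - y) * G y) 2 volume ≤
      eLpNorm F 2 volume * ∫⁻ y, G y := by
  rw [eLpNorm_eq_lintegral_rpow_enorm_toReal (by norm_num) (by norm_num),
    eLpNorm_eq_lintegral_rpow_enorm_toReal (by norm_num) (by norm_num)]
  simp only [ENNReal.toReal_ofNat, enorm_eq_self]
  calc _ ≤ _ := ENNReal.rpow_le_rpow (lintegral_convolution_sq_le hF hG) (by norm_num)
    _ = _ := by
      rw [ENNReal.mul_rpow_of_nonneg _ _ (by norm_num), ← ENNReal.rpow_mul]
      norm_num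

theorem ofReal_wienerNorm {r : ℝ} (hr : Module.finrank ℝ V < 2 * r)
    (b : Lp ℂ 2 (volume : Measure V)) :
    ENNReal.ofReal (wienerNorm r b) = ∫⁻ ξ, ‖symbolOf r b ξ‖ₑ := by
  rw [wienerNorm, ofReal_integral_norm_eq_lintegral_enorm (integrable_symbolOf hr b)]

/-- `H^r` is closed under products if `r > dim / 2`. -/
theorem exists_synth_mul {r : ℝ} (hr : Module.finrank ℝ V < 2 * r)
    (b₁ b₂ : Lp ℂ 2 (volume : Measure V)) :
    ∃ b : Lp ℂ 2 (volume : Measure V), (∀ x, synth r b x = synth r b₁ x * synth r b₂ x) ∧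
      ‖b‖ ≤ 2 ^ r * (‖b₁‖ * wienerNorm r b₂ + wienerNorm r b₁ * ‖b₂‖) := by
  have hr0 : 0 ≤ r := by
    have : (0 : ℝ) ≤ Module.finrank ℝ V := by positivity
    linarith
  set g₁ := symbolOf r b₁ with hg₁
  set g₂ := symbolOf r b₂ with hg₂
  have hi₁ : Integrable g₁ volume := integrable_symbolOf hr b₁
  have hi₂ : Integrable g₂ volume := integrable_symbolOf hr b₂
  have mg₁ : Measurable g₁ := (stronglyMeasurable_symbolOf r b₁).measurable
  have mg₂ : Measurable g₂ := (stronglyMeasurable_symbolOf r b₂).measurable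
  have mb₁ : Measurable b₁ := (Lp.stronglyMeasurable b₁).measurable
  have mb₂ : Measurable b₂ := (Lp.stronglyMeasurable b₂).measurable
  have hm₁ : Measurable fun ξ => ‖g₁ ξ‖ₑ := (stronglyMeasurable_symbolOf r b₁).enorm
  have hm₂ : Measurable fun ξ => ‖g₂ ξ‖ₑ := (stronglyMeasurable_symbolOf r b₂).enorm
  have hb₁ : Measurable fun ξ => ‖b₁ ξ‖ₑ := (Lp.stronglyMeasurable b₁).enorm
  have hb₂ : Measurable fun ξ => ‖b₂ ξ‖ₑ := (Lp.stronglyMeasurable b₂).enorm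
  have ew : ∀ (b : Lp ℂ 2 (volume : Measure V)) ξ,
      ENNReal.ofReal (weight r ξ) * ‖symbolOf r b ξ‖ₑ = ‖b ξ‖ₑ := by
    intro b ξ
    have h1 := weight_neg_mul r ξ
    have h2 := weight_pos r ξ
    rw [← ofReal_norm, ← ofReal_norm, ← ENNReal.ofReal_mul h2.le]
    congr 1
    simp only [symbolOf, norm_mul, Complex.norm_real, Real.norm_of_nonneg (weight_pos _ _).le]
    rw [← mul_assoc, mul_comm (weight r ξ), h1, one_mul]
  set g : V → ℂ := convolution g₁ g₂ (ContinuousLinearMap.mul ℂ ℂ) volume with hg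
  have hgi : Integrable g volume := hi₁.integrable_convolution _ hi₂
  set C : ℝ≥0∞ := ENNReal.ofReal (2 ^ r) with hC
  -- The Peetre inequality puts the weight on one factor of the convolution at a time. That factor
  -- becomes `b₁` or `b₂`, which is in `L²`, while the other stays in `L¹`, so Young's inequality
  -- applies to each term.
  have hbound : ∀ ξ, ‖(weight r ξ : ℂ) * g ξ‖ₑ ≤
      C * ((∫⁻ y, ‖b₁ (ξ - y)‖ₑ * ‖g₂ y‖ₑ) + ∫⁻ y, ‖b₂ (ξ - y)‖ₑ * ‖g₁ y‖ₑ) := by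
    intro ξ
    have h1 : ‖g ξ‖ₑ ≤ ∫⁻ y, ‖g₁ y‖ₑ * ‖g₂ (ξ - y)‖ₑ := by
      refine (enorm_integral_le_lintegral_enorm _).trans (le_of_eq ?_)
      simp
    have e1 : ‖(weight r ξ : ℂ)‖ₑ = ENNReal.ofReal (weight r ξ) := by
      rw [← ofReal_norm, Complex.norm_real, Real.norm_of_nonneg (weight_pos _ _).le]
    rw [enorm_mul, e1]
    calc _ ≤ ENNReal.ofReal (weight r ξ) * ∫⁻ y, ‖g₁ y‖ₑ * ‖g₂ (ξ - y)‖ₑ := by gcongr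
      _ = ∫⁻ y, ENNReal.ofReal (weight r ξ) * (‖g₁ y‖ₑ * ‖g₂ (ξ - y)‖ₑ) := by
        rw [lintegral_const_mul _ (by fun_prop)]
      _ ≤ ∫⁻ y, C * (‖b₁ y‖ₑ * ‖g₂ (ξ - y)‖ₑ + ‖b₂ (ξ - y)‖ₑ * ‖g₁ y‖ₑ) := by
        refine lintegral_mono fun y => ?_
        have h2 : ENNReal.ofReal (weight r ξ) ≤
            C * (ENNReal.ofReal (weight r y) + ENNReal.ofReal (weight r (ξ - y))) := by
          rw [hC, ← ENNReal.ofReal_add (weight_pos _ _).le (weight_pos _ _).le,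
            ← ENNReal.ofReal_mul (by positivity)]
          exact ENNReal.ofReal_le_ofReal (weight_le_add hr0 ξ y)
        calc _ ≤ C * (ENNReal.ofReal (weight r y) + ENNReal.ofReal (weight r (ξ - y))) *
              (‖g₁ y‖ₑ * ‖g₂ (ξ - y)‖ₑ) := by gcongr
          _ = _ := by
            rw [← ew b₁ y, ← ew b₂ (ξ - y)]
            ring
      _ = _ := by
        rw [lintegral_const_mul _ (by fun_prop), lintegral_add_left (by fun_prop)]
        congr 2
        rw [← lintegral_sub_left_eq_self _ ξ]
        simp
  have hmeas : AEStronglyMeasurable (fun ξ => (weight r ξ : ℂ) * g ξ) volume :=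
    (Complex.continuous_ofReal.comp (continuous_weight r)).aestronglyMeasurable.mul
      hgi.aestronglyMeasurable
  have hnorm : eLpNorm (fun ξ => (weight r ξ : ℂ) * g ξ) 2 volume ≤
      ENNReal.ofReal (2 ^ r * (‖b₁‖ * wienerNorm r b₂ + wienerNorm r b₁ * ‖b₂‖)) := by
    have hA := eLpNorm_convolution_le hb₁ hm₂
    have hB := eLpNorm_convolution_le hb₂ hm₁
    have mA : Measurable fun ξ => ∫⁻ y, ‖b₁ (ξ - y)‖ₑ * ‖g₂ y‖ₑ :=
      Measurable.lintegral_prod_right' (f := fun p : V × V => ‖b₁ (p.1 - p.2)‖ₑ * ‖g₂ p.2‖ₑ)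
        (by fun_prop)
    have mB : Measurable fun ξ => ∫⁻ y, ‖b₂ (ξ - y)‖ₑ * ‖g₁ y‖ₑ :=
      Measurable.lintegral_prod_right' (f := fun p : V × V => ‖b₂ (p.1 - p.2)‖ₑ * ‖g₁ p.2‖ₑ)
        (by fun_prop)
    have en : ∀ b : Lp ℂ 2 (volume : Measure V),
        eLpNorm (fun ξ => ‖b ξ‖ₑ) 2 volume = ENNReal.ofReal ‖b‖ := by
      intro b
      rw [eLpNorm_enorm, ofReal_norm, Lp.enorm_def]
    calc eLpNorm (fun ξ => (weight r ξ : ℂ) * g ξ) 2 volume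
        ≤ eLpNorm (fun ξ => C * ((∫⁻ y, ‖b₁ (ξ - y)‖ₑ * ‖g₂ y‖ₑ) +
            ∫⁻ y, ‖b₂ (ξ - y)‖ₑ * ‖g₁ y‖ₑ)) 2 volume :=
          eLpNorm_mono_enorm fun ξ => by simpa using hbound ξ
      _ ≤ C * (eLpNorm (fun ξ => (∫⁻ y, ‖b₁ (ξ - y)‖ₑ * ‖g₂ y‖ₑ) +
            ∫⁻ y, ‖b₂ (ξ - y)‖ₑ * ‖g₁ y‖ₑ) 2 volume) := by
          rw [eLpNorm_eq_lintegral_rpow_enorm_toReal (by norm_num) (by norm_num),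
            eLpNorm_eq_lintegral_rpow_enorm_toReal (by norm_num) (by norm_num)]
          simp only [ENNReal.toReal_ofNat, enorm_eq_self]
          simp only [ENNReal.mul_rpow_of_nonneg _ _ (by norm_num : (0:ℝ) ≤ 2)]
          rw [lintegral_const_mul _ (by fun_prop),
            ENNReal.mul_rpow_of_nonneg _ _ (by norm_num), ← ENNReal.rpow_mul]
          norm_num
      _ ≤ C * (ENNReal.ofReal ‖b₁‖ * ENNReal.ofReal (wienerNorm r b₂) +
            ENNReal.ofReal ‖b₂‖ * ENNReal.ofReal (wienerNorm r b₁)) := by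
          gcongr
          refine (eLpNorm_add_le mA.aestronglyMeasurable mB.aestronglyMeasurable
            (by norm_num)).trans ?_
          rw [en] at hA hB
          rw [ofReal_wienerNorm hr, ofReal_wienerNorm hr]
          exact add_le_add hA hB
      _ = _ := by
          have := wienerNorm_nonneg r b₁
          have := wienerNorm_nonneg r b₂
          rw [hC, ← ENNReal.ofReal_mul (by positivity), ← ENNReal.ofReal_mul (by positivity),
            ← ENNReal.ofReal_add (by positivity) (by positivity),
            ← ENNReal.ofReal_mul (by positivity), mul_comm ‖b₂‖]
  have hmem : MemLp (fun ξ => (weight r ξ : ℂ) * g ξ) 2 volume :=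
    ⟨hmeas, hnorm.trans_lt ENNReal.ofReal_lt_top⟩
  refine ⟨hmem.toLp, fun x => ?_, ?_⟩
  · have e : symbolOf r hmem.toLp =ᵐ[volume] g := by
      filter_upwards [hmem.coeFn_toLp] with ξ h
      rw [symbolOf, h, ← mul_assoc, ← Complex.ofReal_mul, weight_neg_mul]
      simp
    simp only [synth]
    rw [Real.fourierInv_congr_ae e, Real.fourierInv_eq_fourier_neg,
      Real.fourierInv_eq_fourier_neg, Real.fourierInv_eq_fourier_neg]
    exact Real.fourier_mul_convolution_eq hi₁ hi₂ (-x)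
  · rw [Lp.norm_toLp]
    refine ENNReal.toReal_le_of_le_ofReal ?_ hnorm
    have := wienerNorm_nonneg r b₁
    have := wienerNorm_nonneg r b₂
    positivity

/-- The exponent of the interpolation inequality. -/
theorem exists_wienerNorm_le_interpolation {r : ℝ} (hr : Module.finrank ℝ V < 2 * r) :
    ∃ (C : ℝ) (l : ℝ), 0 < C ∧ 0 < l ∧ l < 1 ∧ ∀ b : Lp ℂ 2 (volume : Measure V),
      wienerNorm r b ≤ C * ((eLpNorm (synth r b) 2 volume).toReal ^ (1 - l) * ‖b‖ ^ l) := by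
  have hn : (0 : ℝ) ≤ Module.finrank ℝ V := by positivity
  -- The midpoint of `n/2` and `r`: the weight of order `-t` is still square integrable, while `l =
  -- t / r` is strictly less than `1`.
  set t : ℝ := (Module.finrank ℝ V / 2 + r) / 2 with ht
  have ht1 : Module.finrank ℝ V < 2 * t := by rw [ht]; linarith
  have ht2 : t < r := by rw [ht]; linarith
  have ht0 : 0 < t := by linarith
  have hr0 : 0 < r := by linarith
  set l : ℝ := t / r with hl
  have hl0 : 0 < l := by positivity
  have hl1 : l < 1 := (div_lt_one hr0).mpr ht2
  set C : ℝ := (eLpNorm (fun ξ : V => (weight (-t) ξ : ℂ)) 2 volume).toReal with hC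
  refine ⟨C + 1, l, by positivity, hl0, hl1, fun b => ?_⟩
  have hCt : eLpNorm (fun ξ : V => (weight (-t) ξ : ℂ)) 2 volume = ENNReal.ofReal C :=
    (ENNReal.ofReal_toReal (memLp_weight ht1).2.ne).symm
  have hfin : eLpNorm (synth r b) 2 volume ≠ ⊤ := (memLp_synth hr b).2.ne
  have hm : Measurable fun ξ => ‖symbolOf r b ξ‖ₑ := (stronglyMeasurable_symbolOf r b).enorm
  have hb : Measurable fun ξ => ‖b ξ‖ₑ := (Lp.stronglyMeasurable b).enorm
  have hwm : Measurable fun ξ : V => ENNReal.ofReal (weight (-t) ξ) :=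
    (continuous_weight (-t)).measurable.ennreal_ofReal
  have en2 : ∀ f : V → ℂ, (eLpNorm f 2 volume) ^ (2 : ℝ) = ∫⁻ ξ, ‖f ξ‖ₑ ^ (2 : ℝ) := by
    intro f
    rw [eLpNorm_eq_lintegral_rpow_enorm_toReal (by norm_num) (by norm_num), ← ENNReal.rpow_mul]
    norm_num
  -- The exponents balance because `t + r (1 - l) = r`. Cauchy–Schwarz then splits off the weight,
  -- and Hölder with exponents `1 - l` and `l` separates the rest.
  have e1 : ∀ ξ, ‖symbolOf r b ξ‖ₑ =
      ENNReal.ofReal (weight (-t) ξ) * (‖symbolOf r b ξ‖ₑ ^ (1 - l) * ‖b ξ‖ₑ ^ l) := by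
    intro ξ
    have hs : ‖symbolOf r b ξ‖ₑ = ENNReal.ofReal (weight (-r) ξ) * ‖b ξ‖ₑ := by
      rw [symbolOf, enorm_mul, ← ofReal_norm (weight (-r) ξ : ℂ), Complex.norm_real,
        Real.norm_of_nonneg (weight_pos _ _).le]
    rw [hs, ENNReal.mul_rpow_of_nonneg _ _ (by linarith), mul_assoc,
      ← ENNReal.rpow_add_of_nonneg _ _ (by linarith) (by linarith), ← mul_assoc,
      ENNReal.ofReal_rpow_of_pos (weight_pos _ _), ← ENNReal.ofReal_mul (weight_pos _ _).le,
      weight_rpow, ← weight_add]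
    have : -t + -r * (1 - l) = -r := by rw [hl]; field_simp; ring
    rw [this]
    simp
  have h1 : ∫⁻ ξ, ‖symbolOf r b ξ‖ₑ ≤ (∫⁻ ξ : V, ENNReal.ofReal (weight (-t) ξ) ^ (2 : ℝ)) ^ (1 / 2 : ℝ) *
      (∫⁻ ξ, (‖symbolOf r b ξ‖ₑ ^ (1 - l) * ‖b ξ‖ₑ ^ l) ^ (2 : ℝ)) ^ (1 / 2 : ℝ) := by
    calc _ = ∫⁻ ξ, ENNReal.ofReal (weight (-t) ξ) * (‖symbolOf r b ξ‖ₑ ^ (1 - l) * ‖b ξ‖ₑ ^ l) :=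
          lintegral_congr e1
      _ ≤ _ := ENNReal.lintegral_mul_le_Lp_mul_Lq volume Real.HolderConjugate.two_two
          hwm.aemeasurable (by fun_prop)
  have h2 : ∫⁻ ξ, (‖symbolOf r b ξ‖ₑ ^ (1 - l) * ‖b ξ‖ₑ ^ l) ^ (2 : ℝ) ≤
      (eLpNorm (symbolOf r b) 2 volume ^ (2 : ℝ)) ^ (1 - l) *
        (eLpNorm b 2 volume ^ (2 : ℝ)) ^ l := by
    rw [en2, en2]
    refine le_trans (le_of_eq ?_) (ENNReal.lintegral_mul_norm_pow_le (p := 1 - l) (q := l)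
      (hm.pow_const 2).aemeasurable (hb.pow_const 2).aemeasurable (by linarith) hl0.le (by ring))
    refine lintegral_congr fun ξ => ?_
    rw [ENNReal.mul_rpow_of_nonneg _ _ (by norm_num), ← ENNReal.rpow_mul, ← ENNReal.rpow_mul,
      ← ENNReal.rpow_mul, ← ENNReal.rpow_mul, mul_comm 2, mul_comm 2]
  have h3 : (∫⁻ ξ : V, ENNReal.ofReal (weight (-t) ξ) ^ (2 : ℝ)) ^ (1 / 2 : ℝ) = ENNReal.ofReal C := by
    rw [← hCt, eLpNorm_eq_lintegral_rpow_enorm_toReal (by norm_num) (by norm_num)]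
    congr 1
    refine lintegral_congr fun ξ => ?_
    rw [← ofReal_norm (weight (-t) ξ : ℂ), Complex.norm_real,
        Real.norm_of_nonneg (weight_pos _ _).le]
    norm_num
  have h4 : (∫⁻ ξ, (‖symbolOf r b ξ‖ₑ ^ (1 - l) * ‖b ξ‖ₑ ^ l) ^ (2 : ℝ)) ^ (1 / 2 : ℝ) ≤
      ENNReal.ofReal ((eLpNorm (synth r b) 2 volume).toReal ^ (1 - l) * ‖b‖ ^ l) := by
    calc _ ≤ _ := ENNReal.rpow_le_rpow h2 (by norm_num)
      _ = eLpNorm (synth r b) 2 volume ^ (1 - l) * eLpNorm b 2 volume ^ l := by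
        rw [eLpNorm_symbolOf hr, ENNReal.mul_rpow_of_nonneg _ _ (by norm_num), ← ENNReal.rpow_mul,
          ← ENNReal.rpow_mul, ← ENNReal.rpow_mul, ← ENNReal.rpow_mul]
        congr 2 <;> ring
      _ = _ := by
        rw [ENNReal.ofReal_mul (by positivity), ← ENNReal.ofReal_rpow_of_nonneg (by positivity)
          (by linarith), ENNReal.ofReal_toReal hfin, ← ENNReal.ofReal_rpow_of_nonneg (by positivity)
          (by linarith), ofReal_norm, Lp.enorm_def]
  have h5 : ENNReal.ofReal (wienerNorm r b) ≤ ENNReal.ofReal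
      (C * ((eLpNorm (synth r b) 2 volume).toReal ^ (1 - l) * ‖b‖ ^ l)) := by
    rw [ofReal_wienerNorm hr, ENNReal.ofReal_mul ENNReal.toReal_nonneg]
    refine h1.trans ?_
    rw [h3]
    gcongr
  have h6 := (ENNReal.ofReal_le_ofReal_iff (by positivity)).mp h5
  refine h6.trans ?_
  gcongr
  linarith

/-- The Sobolev embedding. -/
theorem exists_wienerNorm_le {r : ℝ} (hr : Module.finrank ℝ V < 2 * r) :
    ∃ C : ℝ, 0 < C ∧ ∀ b : Lp ℂ 2 (volume : Measure V), wienerNorm r b ≤ C * ‖b‖ := by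
  have hn : (0 : ℝ) ≤ Module.finrank ℝ V := by positivity
  obtain ⟨C, l, hC, hl0, hl1, h⟩ := exists_wienerNorm_le_interpolation hr
  refine ⟨C, hC, fun b => (h b).trans ?_⟩
  gcongr
  have h1 : (eLpNorm (synth r b) 2 volume).toReal ≤ ‖b‖ := by
    rw [← eLpNorm_symbolOf hr, Lp.norm_def]
    refine ENNReal.toReal_mono (Lp.memLp b).2.ne (eLpNorm_mono fun ξ => ?_)
    simp only [symbolOf, norm_mul, Complex.norm_real, Real.norm_of_nonneg (weight_pos _ _).le]
    exact mul_le_of_le_one_left (norm_nonneg _) (weight_le_one (by linarith) ξ)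
  calc _ ≤ ‖b‖ ^ (1 - l) * ‖b‖ ^ l := by
        gcongr
    _ = ‖b‖ := by
        rw [← Real.rpow_add_of_nonneg (norm_nonneg _) (by linarith) hl0.le]
        simp

end Product

/-! ### Power series in the algebra `H^r(ℝⁿ)` and the spectral radius. -/

section PowerSeries

variable {V : Type*} [NormedAddCommGroup V] [InnerProductSpace ℝ V] [FiniteDimensional ℝ V]
  [MeasurableSpace V] [BorelSpace V]

/-- The Sobolev embedding replaces the Wiener norms in `exists_synth_mul` by `H^r` norms. Adding the
constants yields one that serves the embedding and the product. -/
theorem exists_mulConst {r : ℝ} (hr : Module.finrank ℝ V < 2 * r) :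
    ∃ K : ℝ, 1 ≤ K ∧ (∀ b : Lp ℂ 2 (volume : Measure V), wienerNorm r b ≤ K * ‖b‖) ∧
      ∀ b₁ b₂ : Lp ℂ 2 (volume : Measure V), ∃ b : Lp ℂ 2 (volume : Measure V),
      (∀ x, synth r b x = synth r b₁ x * synth r b₂ x) ∧ ‖b‖ ≤ K * ‖b₁‖ * ‖b₂‖ := by
  obtain ⟨C, hC, h⟩ := exists_wienerNorm_le hr
  have h2 : (0 : ℝ) ≤ 2 ^ r * 2 * C := by positivity
  refine ⟨2 ^ r * 2 * C + C + 1, by linarith, fun b => (h b).trans ?_, fun b₁ b₂ => ?_⟩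
  · gcongr
    linarith
  · obtain ⟨b, hb, hn⟩ := exists_synth_mul hr b₁ b₂
    refine ⟨b, hb, hn.trans ?_⟩
    calc _ ≤ 2 ^ r * (‖b₁‖ * (C * ‖b₂‖) + (C * ‖b₁‖) * ‖b₂‖) := by
          gcongr
          · exact h b₂
          · exact h b₁
      _ = (2 ^ r * 2 * C) * ‖b₁‖ * ‖b₂‖ := by ring
      _ ≤ _ := by
          gcongr
          linarith

variable (V) in
/-- A constant for the Sobolev embedding and the algebra property of `H^r`. -/
def mulConst (r : ℝ) (hr : Module.finrank ℝ V < 2 * r) : ℝ := (exists_mulConst hr).choose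

theorem one_le_mulConst {r : ℝ} (hr : Module.finrank ℝ V < 2 * r) : 1 ≤ mulConst V r hr :=
  (exists_mulConst hr).choose_spec.1

theorem mulConst_pos {r : ℝ} (hr : Module.finrank ℝ V < 2 * r) : 0 < mulConst V r hr :=
  one_pos.trans_le (one_le_mulConst hr)

theorem norm_synth_le_mulConst {r : ℝ} (hr : Module.finrank ℝ V < 2 * r)
    (b : Lp ℂ 2 (volume : Measure V)) (x : V) : ‖synth r b x‖ ≤ mulConst V r hr * ‖b‖ :=
  (norm_synth_le r b x).trans ((exists_mulConst hr).choose_spec.2.1 b)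

theorem exists_synth_mul_le {r : ℝ} (hr : Module.finrank ℝ V < 2 * r)
    (b₁ b₂ : Lp ℂ 2 (volume : Measure V)) : ∃ b : Lp ℂ 2 (volume : Measure V),
      (∀ x, synth r b x = synth r b₁ x * synth r b₂ x) ∧
      ‖b‖ ≤ mulConst V r hr * ‖b₁‖ * ‖b₂‖ :=
  (exists_mulConst hr).choose_spec.2.2 b₁ b₂

/-- The constant `1` does not lie in `H^r(ℝⁿ)`, so every power carries a fixed factor `b₀`. In the
applications `b₀` is localized with the given cutoff and `b` with a wider one. -/
theorem exists_synth_mul_pow {r : ℝ} (hr : Module.finrank ℝ V < 2 * r)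
    (b₀ b : Lp ℂ 2 (volume : Measure V)) (k : ℕ) : ∃ b' : Lp ℂ 2 (volume : Measure V),
      (∀ x, synth r b' x = synth r b₀ x * synth r b x ^ k) ∧
      ‖b'‖ ≤ ‖b₀‖ * (mulConst V r hr * ‖b‖) ^ k := by
  have hK := mulConst_pos (V := V) hr
  induction k with
  | zero => exact ⟨b₀, by simp, by simp⟩
  | succ k ih =>
    obtain ⟨b', h, hn⟩ := ih
    obtain ⟨b'', h', hn'⟩ := exists_synth_mul_le hr b' b
    refine ⟨b'', fun x => by rw [h', h, pow_succ, mul_assoc], hn'.trans ?_⟩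
    calc _ ≤ mulConst V r hr * (‖b₀‖ * (mulConst V r hr * ‖b‖) ^ k) * ‖b‖ := by gcongr
      _ = _ := by ring

/-- Evaluation at a point is a continuous linear form by the Sobolev embedding, so absolutely
convergent series may be evaluated termwise. -/
theorem hasSum_synth {r : ℝ} (hr : Module.finrank ℝ V < 2 * r)
    {e : ℕ → Lp ℂ 2 (volume : Measure V)} (he : Summable fun k => ‖e k‖) (x : V) :
    HasSum (fun k => synth r (e k) x) (synth r (∑' k, e k) x) := by
  let T : Lp ℂ 2 (volume : Measure V) →ₗ[ℂ] ℂ :=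
    { toFun := fun b => synth r b x
      map_add' := fun a b => by rw [synth_add hr, Pi.add_apply]
      map_smul' := fun c b => by rw [synth_smul, Pi.smul_apply, RingHom.id_apply] }
  let L : Lp ℂ 2 (volume : Measure V) →L[ℂ] ℂ :=
    T.mkContinuous (mulConst V r hr) fun b => norm_synth_le_mulConst hr b x
  exact he.of_norm.hasSum.mapL L

/-- Power series with small argument operate on `H^r`. -/
theorem exists_synth_powerSeries {r : ℝ} (hr : Module.finrank ℝ V < 2 * r)
    (b₀ b : Lp ℂ 2 (volume : Measure V)) (c : ℕ → ℂ)
    (hc : Summable fun k => ‖c k‖ * (mulConst V r hr * ‖b‖) ^ k) :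
    ∃ B : Lp ℂ 2 (volume : Measure V),
      (∀ x, HasSum (fun k => c k * (synth r b₀ x * synth r b x ^ k)) (synth r B x)) ∧
      ‖B‖ ≤ ‖b₀‖ * ∑' k, ‖c k‖ * (mulConst V r hr * ‖b‖) ^ k := by
  choose e he hn using exists_synth_mul_pow hr b₀ b
  have hle : ∀ k, ‖c k • e k‖ ≤ ‖b₀‖ * (‖c k‖ * (mulConst V r hr * ‖b‖) ^ k) := by
    intro k
    rw [norm_smul]
    calc _ ≤ ‖c k‖ * (‖b₀‖ * (mulConst V r hr * ‖b‖) ^ k) := by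
          gcongr
          exact hn k
      _ = _ := by ring
  have hs : Summable fun k => ‖c k • e k‖ :=
    Summable.of_nonneg_of_le (fun _ => norm_nonneg _) hle (hc.mul_left _)
  refine ⟨∑' k, c k • e k, fun x => ?_, ?_⟩
  · convert hasSum_synth hr hs x using 2 with k
    rw [synth_smul, Pi.smul_apply, smul_eq_mul, he]
  · rw [← tsum_mul_left]
    exact (norm_tsum_le_tsum_norm hs).trans (hs.tsum_le_tsum hle (hc.mul_left _))

/-- One factor stays in `L²` and the other `m - 1` are bounded by `q`; the factor `1 / q` restores
the full power `q ^ m`. -/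
theorem eLpNorm_pow_le {f : V → ℂ} {q : ℝ} (hq : 0 < q)
    (hfq : ∀ x, ‖f x‖ ≤ q) (h2 : eLpNorm f 2 volume ≠ ⊤) {m : ℕ} (hm : 1 ≤ m) :
    (eLpNorm (fun x => f x ^ m) 2 volume).toReal ≤
      (eLpNorm f 2 volume).toReal / q * q ^ m := by
  obtain ⟨k, rfl⟩ := Nat.exists_eq_add_of_le' hm
  have h1 : eLpNorm (fun x => f x ^ (k + 1)) 2 volume ≤
      ENNReal.ofReal (q ^ k) * eLpNorm f 2 volume := by
    refine eLpNorm_le_mul_eLpNorm_of_ae_le_mul (Eventually.of_forall fun x => ?_) 2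
    rw [pow_succ, norm_mul, norm_pow]
    gcongr
    exact hfq x
  have h3 := ENNReal.toReal_mono (by finiteness) h1
  rw [ENNReal.toReal_mul, ENNReal.toReal_ofReal (by positivity)] at h3
  refine h3.trans (le_of_eq ?_)
  rw [pow_succ]
  field_simp

/-- The spectral radius in `H^r` is at most the supremum norm. -/
theorem exists_synth_pow_small {r : ℝ} (hr : Module.finrank ℝ V < 2 * r)
    (b : Lp ℂ 2 (volume : Measure V)) {q : ℝ} (hq1 : q < 1) (hq : ∀ x, ‖synth r b x‖ ≤ q)
    {ε : ℝ} (hε : 0 < ε) :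
    ∃ N : ℕ, 1 ≤ N ∧ ∃ s : Lp ℂ 2 (volume : Measure V),
      (∀ x, synth r s x = synth r b x ^ N) ∧ ‖s‖ ≤ ε := by
  -- A nonpositive bound may be replaced by `1/2`, after which `log q` is meaningful and negative.
  wlog hq0 : 0 < q generalizing q
  · refine this (q := 1 / 2) (by norm_num) (fun x => (hq x).trans ?_) (by norm_num)
    push Not at hq0
    linarith
  obtain ⟨C, l, hC, hl0, hl1, hint⟩ := exists_wienerNorm_le_interpolation hr
  set L : ℝ := (eLpNorm (synth r b) 2 volume).toReal / q with hL
  have hL0 : 0 ≤ L := by positivity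
  set D : ℝ := 2 ^ r * 2 * C * L ^ (1 - l) + 1 with hD
  have hD0 : 0 < D := by positivity
  set A : ℝ := ‖b‖ + Real.log D / l - Real.log q with hA
  -- With `f` the function of `b`, squaring `f^(2^k)` and interpolating its Wiener norm gives the
  -- recursion `Z (k+1) = log D + (1 + l) Z k + (1 - l) 2^k log q` for a bound on the logarithm of
  -- the norm. This is its solution with `Z 0 = ‖b‖`. As `1 + l < 2` and `log q < 0`, the term `2^k
  -- log q` wins.
  let Z : ℕ → ℝ := fun k => A * (1 + l) ^ k - Real.log D / l + 2 ^ k * Real.log q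
  have key : ∀ k : ℕ, ∃ s : Lp ℂ 2 (volume : Measure V),
      (∀ x, synth r s x = synth r b x ^ (2 ^ k)) ∧ ‖s‖ ≤ Real.exp (Z k) := by
    intro k
    induction k with
    | zero =>
      refine ⟨b, by simp, ?_⟩
      have : Z 0 = ‖b‖ := by
        simp only [Z, hA]
        ring
      rw [this]
      linarith [Real.add_one_le_exp ‖b‖]
    | succ k ih =>
      obtain ⟨s, hs, hsn⟩ := ih
      obtain ⟨s', hs', hsn'⟩ := exists_synth_mul hr s s
      refine ⟨s', fun x => by rw [hs', hs, ← pow_add, pow_succ, mul_two], ?_⟩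
      have h1 : (eLpNorm (synth r s) 2 volume).toReal ≤ L * q ^ (2 ^ k) := by
        have : synth r s = fun x => synth r b x ^ (2 ^ k) := funext hs
        rw [this]
        exact eLpNorm_pow_le hq0 hq (memLp_synth hr b).2.ne Nat.one_le_two_pow
      have h2 : wienerNorm r s ≤ C * ((L * q ^ (2 ^ k)) ^ (1 - l) * ‖s‖ ^ l) := by
        refine (hint s).trans ?_
        gcongr
      calc ‖s'‖ ≤ 2 ^ r * (‖s‖ * wienerNorm r s + wienerNorm r s * ‖s‖) := hsn'
        _ = 2 ^ r * 2 * (‖s‖ * wienerNorm r s) := by ring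
        _ ≤ 2 ^ r * 2 * (Real.exp (Z k) *
              (C * ((L * q ^ (2 ^ k)) ^ (1 - l) * Real.exp (Z k) ^ l))) := by
            have := wienerNorm_nonneg r s
            have h3 : wienerNorm r s ≤
                C * ((L * q ^ (2 ^ k)) ^ (1 - l) * Real.exp (Z k) ^ l) := by
              refine h2.trans ?_
              gcongr
            gcongr
        _ = (2 ^ r * 2 * C * L ^ (1 - l)) *
              (Real.exp (Z k) * ((q ^ (2 ^ k)) ^ (1 - l) * Real.exp (Z k) ^ l)) := by
            rw [Real.mul_rpow hL0 (by positivity)]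
            ring
        _ ≤ D * (Real.exp (Z k) * ((q ^ (2 ^ k)) ^ (1 - l) * Real.exp (Z k) ^ l)) := by
            gcongr
            linarith
        _ = Real.exp (Z (k + 1)) := by
            have e1 : q ^ (2 ^ k) = Real.exp (2 ^ k * Real.log q) := by
              rw [mul_comm, Real.exp_mul, Real.exp_log hq0, ← Real.rpow_natCast]
              norm_num
            rw [e1, ← Real.exp_mul, ← Real.exp_mul]
            nth_rewrite 1 [← Real.exp_log hD0]
            rw [← Real.exp_add, ← Real.exp_add, ← Real.exp_add]
            congr 1
            simp only [Z]
            field_simp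
            ring
  have hlim : Tendsto Z atTop atBot := by
    have h1 : Tendsto (fun k : ℕ => A * ((1 + l) / 2) ^ k + Real.log q) atTop
        (𝓝 (A * 0 + Real.log q)) :=
      ((tendsto_pow_atTop_nhds_zero_of_lt_one (by linarith) (by linarith)).const_mul A).add_const _
    have h2 : Tendsto (fun k : ℕ => (2 : ℝ) ^ k) atTop atTop :=
      tendsto_pow_atTop_atTop_of_one_lt (by norm_num)
    have h3 := h2.atTop_mul_neg (by simpa using Real.log_neg hq0 hq1) h1
    have h4 := tendsto_atBot_add_const_right _ (-(Real.log D / l)) h3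
    refine h4.congr fun k => ?_
    simp only [Z, div_pow]
    field_simp
    ring
  have hlim2 := (Real.tendsto_exp_atBot.comp hlim).eventually (gt_mem_nhds hε)
  obtain ⟨k, hk⟩ := hlim2.exists
  obtain ⟨s, hs, hn⟩ := key k
  exact ⟨2 ^ k, Nat.one_le_two_pow, s, hs, hn.trans hk.le⟩

/-- Division with remainder identifies `ℕ` with `ℕ × Fin N`, on which the family is a geometric
series times a finite one. -/
theorem summable_mod_mul_geometric {N : ℕ} (hN : N ≠ 0) {a : ℕ → ℝ} (ha : ∀ i, 0 ≤ a i) :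
    Summable fun m : ℕ => a (m % N) * (1 / 2 : ℝ) ^ (m / N) := by
  have : NeZero N := ⟨hN⟩
  have h1 : Summable fun x : ℕ × Fin N => (1 / 2 : ℝ) ^ x.1 * a x.2 :=
    Summable.mul_of_nonneg summable_geometric_two
      (Summable.of_finite (f := fun i : Fin N => a i)) (fun _ => by positivity) (fun _ => ha _)
  refine ((Nat.divModEquiv N).summable_iff.mpr h1).congr fun m => ?_
  simp [Nat.divModEquiv, mul_comm]

/-- The norms of the powers of a function in `H^r` with supremum norm less than `1` are
summable. -/
theorem exists_synth_mul_pow_summable {r : ℝ} (hr : Module.finrank ℝ V < 2 * r)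
    (b₀ b : Lp ℂ 2 (volume : Measure V)) {q : ℝ} (hq1 : q < 1) (hq : ∀ x, ‖synth r b x‖ ≤ q) :
    ∃ e : ℕ → Lp ℂ 2 (volume : Measure V),
      (∀ m x, synth r (e m) x = synth r b₀ x * synth r b x ^ m) ∧ Summable fun m => ‖e m‖ := by
  have hK := mulConst_pos (V := V) hr
  obtain ⟨N, hN, s, hs, hsn⟩ := exists_synth_pow_small hr b hq1 hq
    (ε := 1 / 2 / mulConst V r hr) (by positivity)
  have hsn' : mulConst V r hr * ‖s‖ ≤ 1 / 2 := by
    rw [mul_comm]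
    exact (le_div_iff₀ hK).mp hsn
  choose p hp _ using exists_synth_mul_pow hr b₀ b
  -- With `f` the function of `b`, write `f^m = f^(m % N) · (f^N)^(m / N)`. The power `N` is chosen
  -- so that multiplication by `f^N` at least halves the norm bound.
  have h : ∀ m : ℕ, ∃ e : Lp ℂ 2 (volume : Measure V),
      (∀ x, synth r e x = synth r b₀ x * synth r b x ^ m) ∧
      ‖e‖ ≤ ‖p (m % N)‖ * (1 / 2) ^ (m / N) := by
    intro m
    obtain ⟨e, he, hen⟩ := exists_synth_mul_pow hr (p (m % N)) s (m / N)
    have hle : (mulConst V r hr * ‖s‖) ^ (m / N) ≤ (1 / 2) ^ (m / N) :=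
      pow_le_pow_left₀ (by positivity) hsn' _
    refine ⟨e, fun x => ?_, hen.trans (mul_le_mul_of_nonneg_left hle (norm_nonneg _))⟩
    rw [he, hp, hs, ← pow_mul, mul_assoc, ← pow_add, Nat.mod_add_div]
  choose e he hen using h
  have hsum := summable_mod_mul_geometric (N := N) (by omega) (a := fun i => ‖p i‖)
    fun i => norm_nonneg (p i)
  exact ⟨e, he, Summable.of_nonneg_of_le (fun m => norm_nonneg (e m)) hen hsum⟩

/-- Power series of radius of convergence at least `1` operate on the functions in `H^r` with
supremum norm less than `1`. -/
theorem exists_synth_powerSeries_of_sup_lt_one {r : ℝ} (hr : Module.finrank ℝ V < 2 * r)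
    (b₀ b : Lp ℂ 2 (volume : Measure V)) {q : ℝ} (hq1 : q < 1) (hq : ∀ x, ‖synth r b x‖ ≤ q)
    (c : ℕ → ℂ) (hc : ∀ k, ‖c k‖ ≤ 1) :
    ∃ B : Lp ℂ 2 (volume : Measure V),
      ∀ x, HasSum (fun k => c k * (synth r b₀ x * synth r b x ^ k)) (synth r B x) := by
  obtain ⟨e, he, hs⟩ := exists_synth_mul_pow_summable hr b₀ b hq1 hq
  have hle : ∀ m, ‖c m • e m‖ ≤ ‖e m‖ := by
    intro m
    rw [norm_smul]
    exact mul_le_of_le_one_left (norm_nonneg _) (hc m)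
  have hs' : Summable fun k => ‖c k • e k‖ :=
    Summable.of_nonneg_of_le (fun _ => norm_nonneg _) hle hs
  refine ⟨∑' k, c k • e k, fun x => ?_⟩
  have h := hasSum_synth hr hs' x
  have e1 : (fun k => synth r (c k • e k) x) =
      fun k => c k * (synth r b₀ x * synth r b x ^ k) := by
    funext k
    rw [synth_smul, Pi.smul_apply, smul_eq_mul, he]
  rwa [e1] at h

end PowerSeries

/-! ### The topology of `H^s(M, ℂ)` in terms of localized Fourier coefficients. -/

section SobolevSpace

open FourierTransform TemperedDistribution

/-- The exponents `r > n / 2`. -/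
abbrev Supercritical (n : ℕ) (r : ℝ) : Prop :=
  (Module.finrank ℝ (EuclideanSpace ℝ (Fin n)) : ℝ) < 2 * r

theorem supercritical_iff {n : ℕ} {r : ℝ} : Supercritical n r ↔ (n : ℝ) / 2 < r := by
  rw [Supercritical, finrank_euclideanSpace_fin, div_lt_iff₀ (by norm_num), mul_comm]

/-- The definition of `H^s` involves all orders `r ≤ s`, but the algebra property needs `r > n/2`.
Each order is dominated by an admissible supercritical one: `s` itself when finite, otherwise any
large number. -/
theorem exists_supercritical_ge {n : ℕ} {s : WithTop ℝ}
    (hs : (((n : ℝ) / 2 : ℝ) : WithTop ℝ) < s) (r : ℝ) (hr : (r : WithTop ℝ) ≤ s) :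
    ∃ r' : ℝ, Supercritical n r' ∧ r ≤ r' ∧ (r' : WithTop ℝ) ≤ s := by
  induction s using WithTop.recTopCoe with
  | top =>
    refine ⟨max r ((n : ℝ) / 2 + 1), supercritical_iff.mpr ?_, le_max_left _ _, le_top⟩
    exact lt_max_of_lt_right (by linarith)
  | coe s => exact ⟨s, supercritical_iff.mpr (WithTop.coe_lt_coe.mp hs),
      WithTop.coe_le_coe.mp hr, le_rfl⟩

variable {n : ℕ} {M : Type*} [TopologicalSpace M] [ChartedSpace (EuclideanSpace ℝ (Fin n)) M]
  [CompactSpace M] {s : WithTop ℝ}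

theorem LocalCutoff.memH_iff (c : LocalCutoff n M) {r : ℝ} (hr : Supercritical n r)
    (f : C(M, ℂ)) : c.MemH r f ↔ ∃ b, c.localize f = synth r b := by
  constructor
  · rintro ⟨β, hβ⟩
    exact ⟨𝓕 β, (besselPotential_eq_iff hr (c.continuous_localize f) (c.memLp_localize f) β).mp hβ⟩
  · rintro ⟨b, hb⟩
    refine ⟨𝓕⁻ b, (besselPotential_eq_iff hr (c.continuous_localize f)
      (c.memLp_localize f) _).mpr ?_⟩
    rw [hb, FourierTransform.fourier_fourierInv_eq]

theorem mem_sobolevSubmodule_iff (hs : (((n : ℝ) / 2 : ℝ) : WithTop ℝ) < s) (f : C(M, ℂ)) :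
    f ∈ sobolevSubmodule n M s ↔ ∀ (c : LocalCutoff n M) (r : ℝ), Supercritical n r →
      (r : WithTop ℝ) ≤ s → ∃ b, c.localize f = synth r b := by
  constructor
  · intro h c r hr hrs
    exact (c.memH_iff hr f).mp (h c r hrs)
  · intro h c r hrs
    obtain ⟨r', hr', hle, hrs'⟩ := exists_supercritical_ge hs r hrs
    exact TemperedDistribution.MemSobolev.mono hle ((c.memH_iff hr' f).mpr (h c r' hr' hrs'))

namespace HsC

theorem ext_apply {f g : HsC n M s} (h : ∀ x, f x = g x) : f = g :=
  Subtype.ext (ContinuousMap.ext h)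

@[simp] theorem add_apply (f g : HsC n M s) (x : M) : (f + g) x = f x + g x := by simp
@[simp] theorem sub_apply (f g : HsC n M s) (x : M) : (f - g) x = f x - g x := by simp
@[simp] theorem neg_apply (f : HsC n M s) (x : M) : (-f) x = -f x := by simp
@[simp] theorem zero_apply (x : M) : (0 : HsC n M s) x = 0 := by simp
@[simp] theorem smul_apply (a : ℂ) (f : HsC n M s) (x : M) : (a • f) x = a * f x := by simp
@[simp] theorem real_smul_apply (a : ℝ) (f : HsC n M s) (x : M) : (a • f) x = a * f x := by
  rw [show a • f = (a : ℂ) • f from rfl, smul_apply]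

/-- `bessel` is a chosen preimage; since `L²` embeds into tempered distributions the choice is
unique, and linearity follows from it. -/
theorem bessel_eq_iff (c : LocalCutoff n M) (r : ℝ) (hr : (r : WithTop ℝ) ≤ s) (f : HsC n M s)
    (β : Lp ℂ 2 (volume : Measure (EuclideanSpace ℝ (Fin n)))) : bessel c r hr f = β ↔
      besselPotential _ ℂ r (c.toLp f.toC : 𝓢'(EuclideanSpace ℝ (Fin n), ℂ)) = (β : 𝓢'(_, ℂ)) := by
  rw [bessel_spec c r hr f]
  exact ⟨fun h => by rw [h], toTemperedDistribution_injective⟩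

theorem bessel_add (c : LocalCutoff n M) (r : ℝ) (hr : (r : WithTop ℝ) ≤ s) (f g : HsC n M s) :
    bessel c r hr (f + g) = bessel c r hr f + bessel c r hr g := by
  rw [bessel_eq_iff]
  simp only [map_add, ← Lp.toTemperedDistributionCLM_apply]
  simp only [Lp.toTemperedDistributionCLM_apply, bessel_spec c r hr]

theorem bessel_smul (c : LocalCutoff n M) (r : ℝ) (hr : (r : WithTop ℝ) ≤ s) (a : ℂ)
    (f : HsC n M s) : bessel c r hr (a • f) = a • bessel c r hr f := by
  rw [bessel_eq_iff]
  simp only [map_smul, ← Lp.toTemperedDistributionCLM_apply]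
  simp only [Lp.toTemperedDistributionCLM_apply, bessel_spec c r hr]

/-- `HsC.bessel` as a linear map. -/
def besselₗ (c : LocalCutoff n M) (r : ℝ) (hr : (r : WithTop ℝ) ≤ s) :
    HsC n M s →ₗ[ℂ] Lp ℂ 2 (volume : Measure (EuclideanSpace ℝ (Fin n))) where
  toFun := bessel c r hr
  map_add' := bessel_add c r hr
  map_smul' := bessel_smul c r hr

theorem bessel_sub (c : LocalCutoff n M) (r : ℝ) (hr : (r : WithTop ℝ) ≤ s) (f g : HsC n M s) :
    bessel c r hr (f - g) = bessel c r hr f - bessel c r hr g :=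
  map_sub (besselₗ c r hr) f g

theorem bessel_neg (c : LocalCutoff n M) (r : ℝ) (hr : (r : WithTop ℝ) ≤ s) (f : HsC n M s) :
    bessel c r hr (-f) = -bessel c r hr f :=
  map_neg (besselₗ c r hr) f

theorem continuous_bessel (c : LocalCutoff n M) (r : ℝ) (hr : (r : WithTop ℝ) ≤ s) :
    Continuous (bessel c r hr : HsC n M s → _) :=
  continuous_iInf_dom <| continuous_iInf_dom <| continuous_iInf_dom continuous_induced_dom

theorem continuous_iff_bessel {X : Type*} [TopologicalSpace X] {F : X → HsC n M s} :
    Continuous F ↔ ∀ c r hr, Continuous fun x => bessel c r hr (F x) := by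
  refine ⟨fun h c r hr => (continuous_bessel c r hr).comp h, fun h => ?_⟩
  exact continuous_iInf_rng.mpr fun c => continuous_iInf_rng.mpr fun r =>
    continuous_iInf_rng.mpr fun hr => continuous_induced_rng.mpr (h c r hr)

instance : IsTopologicalAddGroup (HsC n M s) where
  continuous_add := continuous_iff_bessel.mpr fun c r hr => by
    simp only [bessel_add]
    exact ((continuous_bessel c r hr).comp continuous_fst).add
      ((continuous_bessel c r hr).comp continuous_snd)
  continuous_neg := continuous_iff_bessel.mpr fun c r hr => by
    simp only [bessel_neg]
    exact (continuous_bessel c r hr).neg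

instance : ContinuousSMul ℂ (HsC n M s) where
  continuous_smul := continuous_iff_bessel.mpr fun c r hr => by
    simp only [bessel_smul]
    exact continuous_fst.smul ((continuous_bessel c r hr).comp continuous_snd)

instance : ContinuousSMul ℝ (HsC n M s) where
  continuous_smul := by
    have : Continuous fun p : ℝ × HsC n M s => (p.1 : ℂ) • p.2 :=
      (Complex.continuous_ofReal.comp continuous_fst).smul continuous_snd
    exact this

/-- `J^r = J^{r - r'} J^{r'}`, and the multiplier of nonpositive order `r - r'` is bounded by `1`.
-/
theorem norm_bessel_mono (c : LocalCutoff n M) {r r' : ℝ} (h : r ≤ r')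
    (hr' : (r' : WithTop ℝ) ≤ s) (hr : (r : WithTop ℝ) ≤ s) (f : HsC n M s) :
    ‖bessel c r hr f‖ ≤ ‖bessel c r' hr' f‖ := by
  have e : bessel c r hr f = 𝓕⁻ ((memLp_symbolOf (r := -(r - r')) (by linarith)
      (𝓕 (bessel c r' hr' f))).toLp) := by
    rw [bessel_eq_iff, ← besselPotential_toTemperedDistribution (by linarith), ← bessel_spec,
      besselPotential_besselPotential_apply]
    rw [add_sub_cancel]
  have h1 : ‖bessel c r hr f‖ = _ := (congrArg norm e).trans
    ((Lp.fourierTransformₗᵢ _ ℂ).symm.norm_map _)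
  rw [h1, ← Lp.norm_fourier_eq (bessel c r' hr' f)]
  refine Lp.norm_le_norm_of_ae_le ?_
  filter_upwards [(memLp_symbolOf (r := -(r - r')) (by linarith)
      (𝓕 (bessel c r' hr' f))).coeFn_toLp] with ξ hξ
  rw [hξ]
  simp only [symbolOf, norm_mul, Complex.norm_real, Real.norm_of_nonneg (weight_pos _ _).le]
  exact mul_le_of_le_one_left (norm_nonneg _) (weight_le_one (by linarith) ξ)

/-- The weighted Fourier transform of `(χ f) ∘ e⁻¹`. -/
def coeff (c : LocalCutoff n M) (r : ℝ) (hr : (r : WithTop ℝ) ≤ s) (f : HsC n M s) :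
    Lp ℂ 2 (volume : Measure (EuclideanSpace ℝ (Fin n))) := 𝓕 (bessel c r hr f)

theorem norm_coeff (c : LocalCutoff n M) (r : ℝ) (hr : (r : WithTop ℝ) ≤ s) (f : HsC n M s) :
    ‖coeff c r hr f‖ = ‖bessel c r hr f‖ := Lp.norm_fourier_eq _

theorem localize_eq (c : LocalCutoff n M) {r : ℝ} (hn : Supercritical n r)
    (hr : (r : WithTop ℝ) ≤ s) (f : HsC n M s) : c.localize f.toC = synth r (coeff c r hr f) :=
  (besselPotential_eq_iff hn (c.continuous_localize f.toC) (c.memLp_localize f.toC) _).mp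
    (bessel_spec c r hr f)

/-- Uniqueness of the coefficient: a norm bound for any `b` that represents the localized function
is a bound for the seminorm defining the topology. -/
theorem coeff_eq_of_localize_eq (c : LocalCutoff n M) {r : ℝ} (hn : Supercritical n r)
    (hr : (r : WithTop ℝ) ≤ s) (f : HsC n M s)
    {b : Lp ℂ 2 (volume : Measure (EuclideanSpace ℝ (Fin n)))}
    (h : c.localize f.toC = synth r b) : coeff c r hr f = b := by
  have h1 := (besselPotential_eq_iff hn (c.continuous_localize f.toC) (c.memLp_localize f.toC)
    (𝓕⁻ b)).mpr (by rw [h, FourierTransform.fourier_fourierInv_eq])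
  have h2 := (bessel_eq_iff c r hr f (𝓕⁻ b)).mpr h1
  rw [coeff, h2, FourierTransform.fourier_fourierInv_eq]

theorem coeff_sub (c : LocalCutoff n M) (r : ℝ) (hr : (r : WithTop ℝ) ≤ s) (f g : HsC n M s) :
    coeff c r hr (f - g) = coeff c r hr f - coeff c r hr g := by
  rw [coeff, bessel_sub]
  exact map_sub (Lp.fourierTransformₗᵢ _ ℂ) _ _

theorem coeff_real_smul (c : LocalCutoff n M) (r : ℝ) (hr : (r : WithTop ℝ) ≤ s) (t : ℝ)
    (f : HsC n M s) : ‖coeff c r hr (t • f)‖ = |t| * ‖coeff c r hr f‖ := by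
  rw [norm_coeff, norm_coeff, show t • f = (t : ℂ) • f from rfl, bessel_smul, norm_smul,
    Complex.norm_real, Real.norm_eq_abs]

/-- The topology is initial for the Bessel maps, and the subcritical seminorms are dominated by
supercritical ones, so convergence need only be tested where the algebra estimates apply. -/
theorem tendsto_iff_coeff (hs : (((n : ℝ) / 2 : ℝ) : WithTop ℝ) < s) {X : Type*} {l : Filter X}
    {F : X → HsC n M s} {f : HsC n M s} : Tendsto F l (𝓝 f) ↔
      ∀ (c : LocalCutoff n M) (r : ℝ), Supercritical n r → ∀ hr : (r : WithTop ℝ) ≤ s,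
        Tendsto (fun x => ‖coeff c r hr (F x - f)‖) l (𝓝 0) := by
  have key : Tendsto F l (𝓝 f) ↔ ∀ (c : LocalCutoff n M) (r : ℝ) (hr : (r : WithTop ℝ) ≤ s),
      Tendsto (fun x => ‖bessel c r hr (F x - f)‖) l (𝓝 0) := by
    simp only [bessel_sub, ← tendsto_iff_norm_sub_tendsto_zero]
    simp only [nhds_iInf, nhds_induced, tendsto_iInf, tendsto_comap_iff, Function.comp_def]
  rw [key]
  simp only [norm_coeff]
  refine ⟨fun h c r _ hr => h c r hr, fun h c r hr => ?_⟩
  obtain ⟨r', hn, hle, hr'⟩ := exists_supercritical_ge hs r hr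
  exact squeeze_zero (fun _ => norm_nonneg _)
    (fun x => norm_bessel_mono c hle hr' hr (F x - f)) (h c r' hn hr')

theorem continuous_norm_coeff (c : LocalCutoff n M) (r : ℝ) (hr : (r : WithTop ℝ) ≤ s) :
    Continuous fun f : HsC n M s => ‖coeff c r hr f‖ := by
  simp only [norm_coeff]
  exact (continuous_bessel c r hr).norm

end HsC

end SobolevSpace

/-! ### Cutoffs, the algebra structure of `H^s(M, ℂ)` and the Sobolev embedding. -/

section SobolevAlgebra

variable {n : ℕ} {M : Type*} [TopologicalSpace M] [ChartedSpace (EuclideanSpace ℝ (Fin n)) M]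

theorem LocalCutoff.localize_of_mem (c : LocalCutoff n M) (f : C(M, ℂ))
    {y : EuclideanSpace ℝ (Fin n)} (hy : y ∈ c.e.target) :
    c.localize f y = (c.χ (c.e.symm y) : ℂ) * f (c.e.symm y) := by
  simp [LocalCutoff.localize, hy]

theorem LocalCutoff.localize_of_notMem (c : LocalCutoff n M) (f : C(M, ℂ))
    {y : EuclideanSpace ℝ (Fin n)} (hy : y ∉ c.e.target) : c.localize f y = 0 := by
  simp [LocalCutoff.localize, hy]

variable [T2Space M] [CompactSpace M] [IsManifold (𝓡 n) ∞ M]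

/-- A smooth cutoff function that is `1` on a closed set `t` and is supported in a given open
neighbourhood of `t`. -/
theorem exists_smooth_cutoff {U t : Set M} (hU : IsOpen U) (ht : IsClosed t) (htU : t ⊆ U) :
    ∃ χ : M → ℝ, ContMDiff (𝓡 n) 𝓘(ℝ, ℝ) ∞ χ ∧ tsupport χ ⊆ U ∧ (∀ x ∈ t, χ x = 1) ∧
      ∀ x, χ x ∈ Icc (0 : ℝ) 1 := by
  obtain ⟨f, h0, h1, h2⟩ := exists_contMDiffMap_zero_one_nhds_of_isClosed (𝓡 n) (n := ⊤)
    hU.isClosed_compl ht (disjoint_compl_left_iff_subset.mpr htU)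
  refine ⟨f, f.contMDiff, fun x hx => ?_, fun x hx => h1.self_of_nhdsSet x hx, h2⟩
  by_contra hxU
  have h3 : ∀ᶠ y in 𝓝 x, f y = 0 := h0.filter_mono (nhds_le_nhdsSet hxU)
  exact notMem_tsupport_iff_eventuallyEq.mpr h3 hx

namespace LocalCutoff

/-- A larger cutoff function in the same chart, equal to `1` on the support of the given one. -/
def outer (c : LocalCutoff n M) : LocalCutoff n M where
  e := c.e
  mem_atlas := c.mem_atlas
  χ := (exists_smooth_cutoff (n := n) c.e.open_source (isClosed_tsupport c.χ)
    c.support_subset).choose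
  smooth := (exists_smooth_cutoff (n := n) c.e.open_source (isClosed_tsupport c.χ)
    c.support_subset).choose_spec.1
  support_subset := (exists_smooth_cutoff (n := n) c.e.open_source (isClosed_tsupport c.χ)
    c.support_subset).choose_spec.2.1

theorem outer_eq_one (c : LocalCutoff n M) {x : M} (hx : c.χ x ≠ 0) : c.outer.χ x = 1 :=
  (exists_smooth_cutoff (n := n) c.e.open_source (isClosed_tsupport c.χ)
    c.support_subset).choose_spec.2.2.1 x (subset_tsupport _ hx)

theorem outer_mem_Icc (c : LocalCutoff n M) (x : M) : c.outer.χ x ∈ Icc (0 : ℝ) 1 :=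
  (exists_smooth_cutoff (n := n) c.e.open_source (isClosed_tsupport c.χ)
    c.support_subset).choose_spec.2.2.2 x

/-- The wider cutoff takes values in `[0, 1]`, so localizing does not spoil the bound `sup |h| < 1`
on which the series calculus depends. -/
theorem norm_localize_outer_le (c : LocalCutoff n M) (f : C(M, ℂ)) {q : ℝ}
    (hq : ∀ x, ‖f x‖ ≤ q) (hq0 : 0 ≤ q) (y : EuclideanSpace ℝ (Fin n)) :
    ‖c.outer.localize f y‖ ≤ q := by
  by_cases hy : y ∈ c.outer.e.target
  · rw [localize_of_mem _ _ hy, norm_mul, Complex.norm_real]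
    have h := c.outer_mem_Icc (c.outer.e.symm y)
    rw [Real.norm_of_nonneg h.1]
    exact (mul_le_of_le_one_left (norm_nonneg _) h.2).trans (hq _)
  · rw [localize_of_notMem _ _ hy, norm_zero]
    exact hq0

/-- `χ g h = (χ g)(χ' h)` because `χ' = 1` wherever `χ ≠ 0`. Thus a localized product is a product
of localized functions in the same chart. -/
theorem localize_mul (c : LocalCutoff n M) {f g h : C(M, ℂ)} (hf : ∀ x, f x = g x * h x)
    (y : EuclideanSpace ℝ (Fin n)) :
    c.localize f y = c.localize g y * c.outer.localize h y := by
  by_cases hy : y ∈ c.e.target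
  · rw [localize_of_mem _ _ hy, localize_of_mem _ _ hy,
      localize_of_mem _ _ (show y ∈ c.outer.e.target from hy)]
    change _ = _ * ((c.outer.χ (c.e.symm y) : ℂ) * h (c.e.symm y))
    by_cases h0 : c.χ (c.e.symm y) = 0
    · simp [h0]
    · rw [outer_eq_one c h0, hf]
      simp [mul_assoc]
  · rw [localize_of_notMem _ _ hy, localize_of_notMem _ _ hy, zero_mul]

/-- Likewise `χ g h^k = (χ g)(χ' h)^k`: the powers of the wider cutoff are invisible on the support
of `χ`. -/
theorem hasSum_localize (c : LocalCutoff n M) {f g h : C(M, ℂ)} {a : ℕ → ℂ}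
    (hf : ∀ x, HasSum (fun k => a k * (g x * h x ^ k)) (f x)) (y : EuclideanSpace ℝ (Fin n)) :
    HasSum (fun k => a k * (c.localize g y * c.outer.localize h y ^ k)) (c.localize f y) := by
  by_cases hy : y ∈ c.e.target
  · rw [c.localize_of_mem f hy, c.localize_of_mem g hy, c.outer.localize_of_mem h hy]
    change HasSum (fun k => a k * (_ *
      ((c.outer.χ (c.e.symm y) : ℂ) * h (c.e.symm y)) ^ k)) _
    by_cases h0 : c.χ (c.e.symm y) = 0
    · simp [h0, hasSum_zero]
    · rw [outer_eq_one c h0]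
      refine ((hf (c.e.symm y)).mul_left (c.χ (c.e.symm y) : ℂ)).congr_fun fun k => ?_
      rw [Complex.ofReal_one, one_mul]
      ring
  · rw [c.localize_of_notMem f hy, c.localize_of_notMem g hy]
    simp [hasSum_zero]

/-- A cutoff function equal to `1` near a given point. -/
theorem exists_eventually_eq_one (n : ℕ) {M : Type*} [TopologicalSpace M]
    [ChartedSpace (EuclideanSpace ℝ (Fin n)) M] [T2Space M] [CompactSpace M]
    [IsManifold (𝓡 n) ∞ M] (x : M) :
    ∃ c : LocalCutoff n M, ∃ U ∈ 𝓝 x, ∀ y ∈ U, y ∈ c.e.source ∧ c.χ y = 1 := by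
  let e := chartAt (EuclideanSpace ℝ (Fin n)) x
  have he : e.source ∈ 𝓝 x := e.open_source.mem_nhds (mem_chart_source _ x)
  obtain ⟨t, ht, htc, hte⟩ := exists_mem_nhds_isClosed_subset he
  obtain ⟨χ, h1, h2, h3, _⟩ := exists_smooth_cutoff (n := n) e.open_source htc hte
  exact ⟨⟨e, IsManifold.chart_mem_maximalAtlas x, χ, h1, h2⟩, t, ht, fun y hy => ⟨hte hy, h3 y hy⟩⟩

theorem contDiff_localize (c : LocalCutoff n M) {f : C(M, ℂ)}
    (hf : ContMDiff (𝓡 n) 𝓘(ℝ, ℂ) ∞ f) : ContDiff ℝ ∞ (c.localize f) := by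
  rw [contDiff_iff_contDiffAt]
  intro y
  by_cases hy : y ∈ c.e '' tsupport c.χ
  · have hyt : y ∈ c.e.target := by
      obtain ⟨x, hx, rfl⟩ := hy
      exact c.e.map_source (c.support_subset hx)
    have hsymm : ContMDiffAt (𝓡 n) (𝓡 n) ∞ c.e.symm y :=
      (contMDiffOn_symm_of_mem_maximalAtlas c.mem_atlas).contMDiffAt
        (c.e.open_target.mem_nhds hyt)
    have h1 : ContDiffAt ℝ ∞ (fun y => c.χ (c.e.symm y)) y :=
      (c.smooth.contMDiffAt.comp y hsymm).contDiffAt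
    have h2 : ContDiffAt ℝ ∞ (fun y => f (c.e.symm y)) y :=
      (hf.contMDiffAt.comp y hsymm).contDiffAt
    have h3 : ContDiffAt ℝ ∞ (fun y => (c.χ (c.e.symm y) : ℂ)) y :=
      Complex.ofRealCLM.contDiff.contDiffAt.comp y h1
    refine (h3.mul h2).congr_of_eventuallyEq ?_
    filter_upwards [c.e.open_target.mem_nhds hyt] with z hz
    exact c.localize_of_mem f hz
  · refine (contDiffAt_const (c := (0 : ℂ))).congr_of_eventuallyEq ?_
    filter_upwards [c.isCompact_image.isClosed.isOpen_compl.mem_nhds hy] with z hz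
    exact c.localize_eq_zero f hz

end LocalCutoff

variable {s : WithTop ℝ}

/-- Smooth functions are of class `H^s` for every `s`. -/
theorem ContMDiff.mem_sobolevSubmodule {f : C(M, ℂ)} (hf : ContMDiff (𝓡 n) 𝓘(ℝ, ℂ) ∞ f) :
    f ∈ sobolevSubmodule n M s := by
  intro c r _
  have hs : HasCompactSupport (c.localize f) :=
    HasCompactSupport.intro c.isCompact_image fun _ hx => c.localize_eq_zero f hx
  have h := (hs.toSchwartzMap (c.contDiff_localize hf)).memSobolev (s := r) (p := 2)
  rw [← Lp.toTemperedDistribution_toLp_eq (μ := volume) (p := 2)] at h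
  exact h

namespace HsC

variable [hs : Fact ((((n : ℝ) / 2 : ℝ) : WithTop ℝ) < s)]

theorem mul_mem {f g : C(M, ℂ)} (hf : f ∈ sobolevSubmodule n M s)
    (hg : g ∈ sobolevSubmodule n M s) : f * g ∈ sobolevSubmodule n M s := by
  rw [mem_sobolevSubmodule_iff hs.out] at hf hg ⊢
  intro c r hr hrs
  obtain ⟨b₁, h₁⟩ := hf c r hr hrs
  obtain ⟨b₂, h₂⟩ := hg c.outer r hr hrs
  obtain ⟨b, hb, _⟩ := exists_synth_mul_le hr b₁ b₂
  refine ⟨b, funext fun y => ?_⟩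
  rw [hb, ← h₁, ← h₂]
  exact c.localize_mul (fun x => rfl) y

instance : Mul (HsC n M s) := ⟨fun f g => ⟨f.toC * g.toC, mul_mem f.2 g.2⟩⟩

instance : One (HsC n M s) := ⟨⟨1, ContMDiff.mem_sobolevSubmodule contMDiff_const⟩⟩

@[simp] theorem mul_apply (f g : HsC n M s) (x : M) : (f * g) x = f x * g x := rfl

@[simp] theorem one_apply (x : M) : (1 : HsC n M s) x = 1 := rfl

theorem norm_coeff_mul_le (c : LocalCutoff n M) {r : ℝ} (hn : Supercritical n r)
    (hr : (r : WithTop ℝ) ≤ s) (f g : HsC n M s) :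
    ‖coeff c r hr (f * g)‖ ≤ mulConst (EuclideanSpace ℝ (Fin n)) r hn *
      ‖coeff c r hr f‖ * ‖coeff c.outer r hr g‖ := by
  obtain ⟨b, hb, hle⟩ := exists_synth_mul_le hn (coeff c r hr f) (coeff c.outer r hr g)
  rwa [coeff_eq_of_localize_eq c hn hr (f * g) (b := b)]
  funext y
  rw [hb, ← localize_eq c hn, ← localize_eq c.outer hn]
  exact c.localize_mul (fun x => rfl) y

instance : ContinuousMul (HsC n M s) where
  continuous_mul := by
    rw [continuous_iff_continuousAt]
    rintro ⟨f, g⟩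
    refine (tendsto_iff_coeff hs.out).mpr fun c r hn hr => ?_
    set K := mulConst (EuclideanSpace ℝ (Fin n)) r hn with hK
    have hle : ∀ p : HsC n M s × HsC n M s, ‖coeff c r hr (p.1 * p.2 - f * g)‖ ≤
        K * ‖coeff c r hr (p.1 - f)‖ * ‖coeff c.outer r hr p.2‖ +
        K * ‖coeff c r hr f‖ * ‖coeff c.outer r hr (p.2 - g)‖ := by
      intro p
      have e : p.1 * p.2 - f * g = (p.1 - f) * p.2 - f * (g - p.2) := by
        apply ext_apply
        intro x
        simp only [sub_apply, mul_apply]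
        ring
      rw [e, coeff_sub]
      refine (norm_sub_le _ _).trans (add_le_add (norm_coeff_mul_le c hn hr _ _) ?_)
      refine (norm_coeff_mul_le c hn hr _ _).trans (le_of_eq ?_)
      rw [coeff_sub, norm_sub_rev, ← coeff_sub]
    refine squeeze_zero (fun _ => norm_nonneg _) hle ?_
    have hc1 : Continuous fun p : HsC n M s × HsC n M s => ‖coeff c r hr (p.1 - f)‖ :=
      (continuous_norm_coeff c r hr).comp (continuous_fst.sub continuous_const)
    have hc2 : Continuous fun p : HsC n M s × HsC n M s => ‖coeff c.outer r hr p.2‖ :=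
      (continuous_norm_coeff c.outer r hr).comp continuous_snd
    have hc3 : Continuous fun p : HsC n M s × HsC n M s => ‖coeff c.outer r hr (p.2 - g)‖ :=
      (continuous_norm_coeff c.outer r hr).comp (continuous_snd.sub continuous_const)
    have h0 : ∀ c : LocalCutoff n M, ‖coeff c r hr (0 : HsC n M s)‖ = 0 := fun c => by
      have := coeff_sub c r hr (0 : HsC n M s) 0
      rw [sub_self, sub_self] at this
      rw [this, norm_zero]
    have := (((continuous_const (y := K)).mul hc1).mul hc2).add
      ((continuous_const (y := K * ‖coeff c r hr f‖)).mul hc3)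
    have h1 := this.tendsto (f, g)
    simp only [Pi.add_apply, Pi.mul_apply, sub_self, h0, mul_zero, zero_mul, add_zero] at h1
    exact h1

/-- The Sobolev embedding `H^s(M, ℂ) ⊆ C(M, ℂ)` is continuous. -/
theorem continuous_toC : Continuous (toC : HsC n M s → C(M, ℂ)) := by
  rw [continuous_iff_continuousAt]
  intro f
  obtain ⟨r, hn, -, hr⟩ := exists_supercritical_ge hs.out (n / 2 : ℝ) hs.out.le
  -- Finitely many of the sets where a cutoff equals `1` cover the compact `M`. There the localized
  -- function is the function itself, so the supremum norm is bounded by a finite sum of seminorms.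
  choose c U hU hcU using LocalCutoff.exists_eventually_eq_one n (M := M)
  obtain ⟨t, ht⟩ := finite_cover_nhds hU
  have hK := mulConst_pos (V := EuclideanSpace ℝ (Fin n)) hn
  have h1 : Tendsto (fun g => ∑ i ∈ t, mulConst (EuclideanSpace ℝ (Fin n)) r hn *
      ‖coeff (c i) r hr (g - f)‖) (𝓝 f) (𝓝 (∑ i ∈ t, _ * 0)) :=
    tendsto_finsetSum _ fun i _ =>
      ((tendsto_iff_coeff hs.out (F := fun g => g)).mp tendsto_id (c i) r hn hr).const_mul _
  simp only [mul_zero, Finset.sum_const_zero] at h1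
  refine tendsto_iff_norm_sub_tendsto_zero.mpr
    (squeeze_zero (fun _ => norm_nonneg _) (fun g => ?_) h1)
  rw [ContinuousMap.norm_le _ (Finset.sum_nonneg fun i _ => by positivity)]
  intro x
  have hx : x ∈ ⋃ i ∈ t, U i := by rw [ht]; exact mem_univ x
  simp only [mem_iUnion] at hx
  obtain ⟨i, hi, hxi⟩ := hx
  obtain ⟨hs1, hχ⟩ := hcU i x hxi
  have h2 := norm_synth_le_mulConst hn (coeff (c i) r hr (g - f)) ((c i).e x)
  rw [← localize_eq (c i) hn, LocalCutoff.localize_of_mem _ _ ((c i).e.map_source hs1),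
    (c i).e.left_inv hs1, hχ, Complex.ofReal_one, one_mul, map_sub] at h2
  exact h2.trans (Finset.single_le_sum (f := fun i => mulConst (EuclideanSpace ℝ (Fin n)) r hn *
    ‖coeff (c i) r hr (g - f)‖) (fun i _ => by positivity) hi)

instance : T2Space (HsC n M s) :=
  T2Space.of_injective_continuous (f := (toC : HsC n M s → C(M, ℂ)))
    Subtype.val_injective continuous_toC

end HsC

end SobolevAlgebra

/-! ### Conjugation, exponential and logarithm on `H^s(M, ℂ)`. -/

section FunctionalCalculus

open FourierTransform

section Conj

variable {V : Type*} [NormedAddCommGroup V] [InnerProductSpace ℝ V] [FiniteDimensional ℝ V]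
  [MeasurableSpace V] [BorelSpace V]

/-- Conjugation corresponds to `b ↦ conj (b (-ξ))` on the Fourier side, and the weight is even. -/
theorem exists_synth_conj (r : ℝ) (b : Lp ℂ 2 (volume : Measure V)) :
    ∃ b' : Lp ℂ 2 (volume : Measure V),
      (∀ x, synth r b' x = (starRingEnd ℂ) (synth r b x)) ∧ ‖b'‖ = ‖b‖ := by
  have hmp : MeasurePreserving (Neg.neg : V → V) volume volume :=
    Measure.measurePreserving_neg volume
  have h1 : MemLp (fun ξ => b (-ξ)) 2 volume := (Lp.memLp b).comp_measurePreserving hmp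
  have h2 : MemLp (fun ξ => (starRingEnd ℂ) (b (-ξ))) 2 volume := h1.star
  refine ⟨h2.toLp, fun x => ?_, ?_⟩
  · have e : symbolOf r h2.toLp =ᵐ[volume] fun ξ => (starRingEnd ℂ) (symbolOf r b (-ξ)) := by
      filter_upwards [h2.coeFn_toLp] with ξ h
      simp [symbolOf, h, weight_neg_apply]
    rw [synth, Real.fourierInv_congr_ae e, Real.fourierInv_eq', synth, Real.fourierInv_eq',
      ← integral_conj, ← integral_neg_eq_self]
    refine integral_congr_ae (Eventually.of_forall fun ξ => ?_)
    simp only [smul_eq_mul, map_mul, neg_neg, inner_neg_left, ← Complex.exp_conj]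
    congr 2
    simp [Complex.conj_ofNat]
  · rw [Lp.norm_toLp, Lp.norm_def]
    congr 1
    calc _ = eLpNorm (fun ξ => b (-ξ)) 2 volume :=
          eLpNorm_congr_norm_ae (Eventually.of_forall fun ξ => by simp)
      _ = _ := eLpNorm_comp_measurePreserving (Lp.memLp b).1 hmp

end Conj

variable {n : ℕ} {M : Type*} [TopologicalSpace M] [ChartedSpace (EuclideanSpace ℝ (Fin n)) M]
  [T2Space M] [CompactSpace M] [IsManifold (𝓡 n) ∞ M] {s : WithTop ℝ}
  [hs : Fact ((((n : ℝ) / 2 : ℝ) : WithTop ℝ) < s)]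

theorem LocalCutoff.localize_conj (c : LocalCutoff n M) (f : C(M, ℂ))
    (y : EuclideanSpace ℝ (Fin n)) :
    c.localize (star f) y = (starRingEnd ℂ) (c.localize f y) := by
  by_cases hy : y ∈ c.e.target
  · rw [c.localize_of_mem _ hy, c.localize_of_mem _ hy]
    simp
  · rw [c.localize_of_notMem _ hy, c.localize_of_notMem _ hy, map_zero]

namespace HsC

theorem star_mem {f : C(M, ℂ)} (hf : f ∈ sobolevSubmodule n M s) :
    star f ∈ sobolevSubmodule n M s := by
  rw [mem_sobolevSubmodule_iff hs.out] at hf ⊢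
  intro c r hr hrs
  obtain ⟨b, h⟩ := hf c r hr hrs
  obtain ⟨b', hb, -⟩ := exists_synth_conj r b
  refine ⟨b', funext fun y => ?_⟩
  rw [c.localize_conj, hb, h]

/-- Complex conjugation. -/
def conj (f : HsC n M s) : HsC n M s := ⟨star f.toC, star_mem f.2⟩

@[simp] theorem conj_apply (f : HsC n M s) (x : M) : conj f x = (starRingEnd ℂ) (f x) := rfl

theorem continuous_conj : Continuous (conj : HsC n M s → HsC n M s) := by
  rw [continuous_iff_continuousAt]
  intro f
  refine (tendsto_iff_coeff hs.out).mpr fun c r hn hr => ?_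
  refine ((tendsto_iff_coeff hs.out).mp (tendsto_id (x := 𝓝 f)) c r hn hr).congr fun g => ?_
  have e : conj g - conj f = conj (g - f) := ext_apply fun x => by simp
  obtain ⟨b', hb, hn'⟩ := exists_synth_conj r (coeff c r hr (g - f))
  rw [e, coeff_eq_of_localize_eq c hn hr (conj (g - f)) (b := b'), hn', id]
  funext y
  rw [hb, ← localize_eq c hn]
  exact c.localize_conj _ y

/-- Compactness turns the pointwise strict bound into a uniform bound by some `q < 1`, as the
spectral radius estimate demands. -/
theorem norm_lt_one {h : HsC n M s} (hh : ∀ x, ‖h x‖ < 1) : ‖h.toC‖ < 1 :=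
  (ContinuousMap.norm_lt_iff _ one_pos).mpr hh

theorem isOpen_norm_lt {ε : ℝ} (hε : 0 < ε) : IsOpen {h : HsC n M s | ∀ x, ‖h x‖ < ε} := by
  have : {h : HsC n M s | ∀ x, ‖h x‖ < ε} = toC ⁻¹' {f | ‖f‖ < ε} := by
    ext h
    exact (ContinuousMap.norm_lt_iff _ hε).symm
  rw [this]
  exact (isOpen_lt continuous_norm continuous_const).preimage continuous_toC

/-- Power series with coefficients bounded by `1` operate on functions of supremum norm less
than `1`. -/
theorem mem_of_hasSum_of_norm_lt_one {f : C(M, ℂ)} (g h : HsC n M s) {a : ℕ → ℂ}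
    (ha : ∀ k, ‖a k‖ ≤ 1) (hh : ∀ x, ‖h x‖ < 1)
    (hf : ∀ x, HasSum (fun k => a k * (g x * h x ^ k)) (f x)) : f ∈ sobolevSubmodule n M s := by
  rw [mem_sobolevSubmodule_iff hs.out]
  intro c r hn hr
  obtain ⟨B, hB⟩ := exists_synth_powerSeries_of_sup_lt_one hn (coeff c r hr g)
    (coeff c.outer r hr h) (norm_lt_one hh) (fun y => by
      rw [← localize_eq c.outer hn]
      exact c.norm_localize_outer_le h.toC (ContinuousMap.norm_coe_le_norm _) (norm_nonneg _) y)
    a ha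
  refine ⟨B, funext fun y => ?_⟩
  have h1 := hB y
  rw [← localize_eq c hn, ← localize_eq c.outer hn] at h1
  exact (c.hasSum_localize hf y).unique h1

/-- Entire functions operate. -/
theorem mem_of_hasSum_entire {f : C(M, ℂ)} (g h : HsC n M s) {a : ℕ → ℂ}
    (ha : ∀ R : ℝ, Summable fun k => ‖a k‖ * R ^ k)
    (hf : ∀ x, HasSum (fun k => a k * (g x * h x ^ k)) (f x)) : f ∈ sobolevSubmodule n M s := by
  rw [mem_sobolevSubmodule_iff hs.out]
  intro c r hn hr
  obtain ⟨B, hB, -⟩ := exists_synth_powerSeries hn (coeff c r hr g)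
    (coeff c.outer r hr h) a (ha _)
  refine ⟨B, funext fun y => ?_⟩
  have h1 := hB y
  rw [← localize_eq c hn, ← localize_eq c.outer hn] at h1
  exact (c.hasSum_localize hf y).unique h1

/-- For arguments small in the `H^r` seminorm the series is dominated by the geometric series of
ratio `1/2`, whose sum is the constant `2`. -/
theorem norm_coeff_le_of_hasSum (c : LocalCutoff n M) {r : ℝ} (hn : Supercritical n r)
    (hr : (r : WithTop ℝ) ≤ s) (f g h : HsC n M s) {a : ℕ → ℂ} (ha : ∀ k, ‖a k‖ ≤ 1)
    (hh : mulConst (EuclideanSpace ℝ (Fin n)) r hn * ‖coeff c.outer r hr h‖ ≤ 1 / 2)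
    (hf : ∀ x, HasSum (fun k => a k * (g x * h x ^ k)) (f x)) :
    ‖coeff c r hr f‖ ≤ 2 * ‖coeff c r hr g‖ := by
  have hK := mulConst_pos hn
  have hle : ∀ k, ‖a k‖ * (mulConst (EuclideanSpace ℝ (Fin n)) r hn *
      ‖coeff c.outer r hr h‖) ^ k ≤ (1 / 2) ^ k := fun k => by
    calc _ ≤ 1 * (1 / 2 : ℝ) ^ k := by
          gcongr
          exact ha k
      _ = _ := one_mul _
  have hsum := Summable.of_nonneg_of_le (fun k => by positivity) hle summable_geometric_two
  obtain ⟨B, hB, hBn⟩ := exists_synth_powerSeries hn (coeff c r hr g)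
    (coeff c.outer r hr h) a hsum
  rw [coeff_eq_of_localize_eq c hn hr f (b := B)]
  · refine hBn.trans ?_
    rw [mul_comm 2]
    gcongr
    exact (hsum.tsum_le_tsum hle summable_geometric_two).trans (le_of_eq tsum_geometric_two)
  · funext y
    have h1 := hB y
    rw [← localize_eq c hn, ← localize_eq c.outer hn] at h1
    exact (c.hasSum_localize hf y).unique h1

/-- `G(h) = h + O(h²)` with a convergent power series as remainder. -/
def TangentToId (G : HsC n M s → HsC n M s) : Prop :=
  ∀ h : HsC n M s, (∀ x, ‖h x‖ < 1) → ∃ a : ℕ → ℂ, (∀ k, ‖a k‖ ≤ 1) ∧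
    ∀ x, HasSum (fun k => a k * ((h * h) x * h x ^ k)) ((G h - h) x)

/-- The remainder is `h²` times a power series, so near `0` it is quadratic in the seminorms. Two
different cutoffs appear because the product estimate widens one of them. -/
theorem TangentToId.norm_coeff_le {G : HsC n M s → HsC n M s} (hG : TangentToId G)
    (c : LocalCutoff n M) {r : ℝ} (hn : Supercritical n r) (hr : (r : WithTop ℝ) ≤ s) :
    ∀ᶠ h in 𝓝 (0 : HsC n M s), ‖coeff c r hr (G h - h)‖ ≤
      2 * (mulConst (EuclideanSpace ℝ (Fin n)) r hn * ‖coeff c r hr h‖ *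
        ‖coeff c.outer r hr h‖) := by
  have h0 : ‖coeff c.outer r hr (0 : HsC n M s)‖ = 0 := by
    have := coeff_sub c.outer r hr (0 : HsC n M s) 0
    rw [sub_self, sub_self] at this
    rw [this, norm_zero]
  have h1 : ∀ᶠ h in 𝓝 (0 : HsC n M s), mulConst (EuclideanSpace ℝ (Fin n)) r hn *
      ‖coeff c.outer r hr h‖ < 1 / 2 := by
    have hc : Continuous fun h : HsC n M s => mulConst (EuclideanSpace ℝ (Fin n)) r hn *
      ‖coeff c.outer r hr h‖ := continuous_const.mul (continuous_norm_coeff c.outer r hr)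
    exact hc.continuousAt.eventually_lt continuousAt_const (by rw [h0]; norm_num)
  have h2 : ∀ᶠ h in 𝓝 (0 : HsC n M s), ∀ x, ‖h x‖ < 1 :=
    (isOpen_norm_lt one_pos).mem_nhds (by simp)
  filter_upwards [h1, h2] with h h1 h2
  obtain ⟨a, ha, hf⟩ := hG h h2
  refine (norm_coeff_le_of_hasSum c hn hr _ _ _ ha h1.le hf).trans ?_
  gcongr
  exact norm_coeff_mul_le c hn hr h h

theorem TangentToId.tendsto_zero {G : HsC n M s → HsC n M s} (hG : TangentToId G) :
    Tendsto G (𝓝 0) (𝓝 0) := by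
  have h1 : Tendsto (fun h => G h - h) (𝓝 0) (𝓝 0) := by
    refine (tendsto_iff_coeff hs.out).mpr fun c r hn hr => ?_
    simp only [sub_zero]
    have h0 : ∀ c : LocalCutoff n M, Tendsto (fun h => ‖coeff c r hr (h : HsC n M s)‖) (𝓝 0) (𝓝 0) :=
      fun c => by simpa using (tendsto_iff_coeff hs.out).mp (tendsto_id (x := 𝓝 (0 : HsC n M s))) c r hn hr
    have := (((h0 c).const_mul (mulConst (EuclideanSpace ℝ (Fin n)) r hn)).mul
      (h0 c.outer)).const_mul 2
    simp only [mul_zero] at this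
    exact squeeze_zero' (Eventually.of_forall fun _ => norm_nonneg _) (hG.norm_coeff_le c hn hr) this
  simpa using h1.add tendsto_id

/-- The remainder at `t v` is of order `t²`, locally uniformly in `v`. The limit is taken jointly in
`v` and `t`, which is what strict differentiability requires. -/
theorem TangentToId.tendsto_div {G : HsC n M s → HsC n M s} (hG : TangentToId G) (v : HsC n M s) :
    Tendsto (fun p : HsC n M s × ℝ => p.2⁻¹ • G (p.2 • p.1)) (𝓝 v ×ˢ 𝓝[≠] 0) (𝓝 v) := by
  have hlim : Tendsto (fun p : HsC n M s × ℝ => p.2 • p.1) (𝓝 v ×ˢ 𝓝[≠] 0) (𝓝 0) := by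
    have h : Continuous fun p : HsC n M s × ℝ => p.2 • p.1 := continuous_snd.smul continuous_fst
    have h' := h.tendsto (v, 0)
    rw [nhds_prod_eq, zero_smul] at h'
    exact h'.mono_left (Filter.prod_mono le_rfl nhdsWithin_le_nhds)
  have h1 : Tendsto (fun p : HsC n M s × ℝ => p.2⁻¹ • (G (p.2 • p.1) - p.2 • p.1))
      (𝓝 v ×ˢ 𝓝[≠] 0) (𝓝 0) := by
    refine (tendsto_iff_coeff hs.out).mpr fun c r hn hr => ?_
    simp only [sub_zero]
    set K := mulConst (EuclideanSpace ℝ (Fin n)) r hn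
    have hc : ∀ c : LocalCutoff n M, Tendsto (fun p : HsC n M s × ℝ => ‖coeff c r hr p.1‖)
        (𝓝 v ×ˢ 𝓝[≠] 0) (𝓝 ‖coeff c r hr v‖) := fun c =>
      ((continuous_norm_coeff c r hr).tendsto v).comp tendsto_fst
    have ht : Tendsto (fun p : HsC n M s × ℝ => |p.2|) (𝓝 v ×ˢ 𝓝[≠] 0) (𝓝 0) := by
      have : Tendsto (fun t : ℝ => |t|) (𝓝[≠] 0) (𝓝 |0|) :=
        (continuous_abs.tendsto 0).mono_left nhdsWithin_le_nhds
      rw [abs_zero] at this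
      exact this.comp tendsto_snd
    have hlim2 := ((((hc c).const_mul K).mul (hc c.outer)).const_mul 2).mul ht
    rw [mul_zero] at hlim2
    refine squeeze_zero' (Eventually.of_forall fun _ => norm_nonneg _) ?_ hlim2
    have hne : ∀ᶠ p : HsC n M s × ℝ in 𝓝 v ×ˢ 𝓝[≠] 0, p.2 ≠ 0 :=
      tendsto_snd.eventually (eventually_mem_nhdsWithin (a := (0 : ℝ)) (s := {0}ᶜ))
    filter_upwards [hlim.eventually (hG.norm_coeff_le c hn hr), hne] with p hp hne
    rw [coeff_real_smul, coeff_real_smul] at hp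
    rw [coeff_real_smul]
    have hpos : 0 < |p.2| := abs_pos.mpr hne
    calc |p.2⁻¹| * _ ≤ |p.2⁻¹| * _ := mul_le_mul_of_nonneg_left hp (abs_nonneg _)
      _ = _ := by
        rw [abs_inv]
        simp only [K]
        field_simp
  have h2 := h1.add (tendsto_fst (f := 𝓝 v) (g := 𝓝[≠] (0 : ℝ)))
  rw [zero_add] at h2
  refine h2.congr' ?_
  have hne : ∀ᶠ p : HsC n M s × ℝ in 𝓝 v ×ˢ 𝓝[≠] 0, p.2 ≠ 0 :=
    tendsto_snd.eventually (eventually_mem_nhdsWithin (a := (0 : ℝ)) (s := {0}ᶜ))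
  filter_upwards [hne] with p hp
  rw [smul_sub, smul_smul, inv_mul_cancel₀ hp, one_smul, sub_add_cancel]

/-- A continuous function of class `H^s`, as an element of `H^s(M, ℂ)`. -/
def ofMem (f : C(M, ℂ)) (hf : f ∈ sobolevSubmodule n M s) : HsC n M s := ⟨f, hf⟩

@[simp] theorem ofMem_apply (f : C(M, ℂ)) (hf : f ∈ sobolevSubmodule n M s) (x : M) :
    ofMem f hf x = f x := rfl

/-- The exponential function on `H^s(M, ℂ)`. -/
def exp (f : HsC n M s) : HsC n M s :=
  ⟨⟨fun x => Complex.exp (f x), by fun_prop⟩, by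
    refine mem_of_hasSum_entire (a := fun k => ((k.factorial : ℂ))⁻¹) 1 f (fun R => ?_) fun x => ?_
    · refine (Real.summable_pow_div_factorial R).congr fun k => ?_
      simp
      ring
    · simp only [one_apply, one_mul]
      have h := NormedSpace.expSeries_div_hasSum_exp (𝔸 := ℂ) (f x)
      rw [← Complex.exp_eq_exp_ℂ] at h
      refine h.congr_fun fun k => ?_
      ring⟩

@[simp] theorem exp_apply (f : HsC n M s) (x : M) : exp f x = Complex.exp (f x) := rfl

/-- The function `log (1 + h)` is of class `H^s` for `|h| < 1`. -/
theorem log1p_mem (h : HsC n M s) (hh : ∀ x, ‖h x‖ < 1) (f : C(M, ℂ))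
    (hf : ∀ x, f x = Complex.log (1 + h x)) : f ∈ sobolevSubmodule n M s := by
  -- The coefficient with `k = 0` is a division by zero, hence `0`, so the logarithmic series starts
  -- at `k = 1` and its coefficients are bounded by `1`.
  refine mem_of_hasSum_of_norm_lt_one (a := fun k => (-1) ^ (k + 1) / k) 1 h (fun k => ?_) hh
    fun x => ?_
  · simp only [norm_div, norm_pow, norm_neg, norm_one, one_pow, Complex.norm_natCast]
    rcases Nat.eq_zero_or_pos k with rfl | hk
    · simp
    · rw [div_le_one (by positivity)]
      exact_mod_cast hk
  · rw [hf]
    refine (Complex.hasSum_taylorSeries_log (hh x)).congr_fun fun k => ?_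
    simp only [one_apply, one_mul]
    ring

theorem one_add_mem_slitPlane {z : ℂ} (hz : ‖z‖ < 1) : 1 + z ∈ Complex.slitPlane :=
  Complex.mem_slitPlane_of_norm_lt_one hz

open Classical in
/-- The function `log (1 + h)` for `|h| < 1`, with junk value `0` otherwise. -/
def log1p (h : HsC n M s) : HsC n M s :=
  if hh : ∀ x, ‖h x‖ < 1 then
    ofMem ⟨fun x => Complex.log (1 + h x), by
      rw [continuous_iff_continuousAt]
      intro x
      exact ContinuousAt.clog (by fun_prop) (one_add_mem_slitPlane (hh x))⟩
      (log1p_mem h hh _ fun _ => rfl)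
  else 0

theorem log1p_apply {h : HsC n M s} (hh : ∀ x, ‖h x‖ < 1) (x : M) :
    log1p h x = Complex.log (1 + h x) := by
  rw [log1p, dif_pos hh]
  rfl

theorem tangentToId_exp : TangentToId fun h : HsC n M s => exp h - 1 := by
  intro h _
  refine ⟨fun k => (((k + 2).factorial : ℂ))⁻¹, fun k => ?_, fun x => ?_⟩
  · rw [norm_inv, Complex.norm_natCast]
    exact inv_le_one_of_one_le₀ (by exact_mod_cast Nat.one_le_iff_ne_zero.mpr (Nat.factorial_ne_zero _))
  · have h1 := NormedSpace.expSeries_div_hasSum_exp (𝔸 := ℂ) (h x)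
    rw [← Complex.exp_eq_exp_ℂ, ← hasSum_nat_add_iff' 2] at h1
    have e : (exp h - 1 - h) x = Complex.exp (h x) -
        ∑ i ∈ Finset.range 2, h x ^ i / (i.factorial : ℂ) := by
      simp only [sub_apply, exp_apply, one_apply]
      simp [Finset.sum_range_succ]
      ring
    rw [← e] at h1
    refine h1.congr_fun fun k => ?_
    simp only [mul_apply]
    ring

theorem tangentToId_log1p : TangentToId (log1p : HsC n M s → HsC n M s) := by
  intro h hh
  refine ⟨fun k => (-1) ^ (k + 3) / ((k + 2 : ℕ) : ℂ), fun k => ?_, fun x => ?_⟩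
  · simp only [norm_div, norm_pow, norm_neg, norm_one, one_pow, Complex.norm_natCast]
    rw [div_le_one (by positivity)]
    exact_mod_cast (by omega : 1 ≤ k + 2)
  · have h1 := Complex.hasSum_taylorSeries_log (hh x)
    -- The terms `k = 0` (zero by the division convention) and `k = 1` (equal to `h`) are removed,
    -- leaving a factor `h²` in all others.
    rw [← hasSum_nat_add_iff' 2] at h1
    have e : (log1p h - h) x = Complex.log (1 + h x) -
        ∑ i ∈ Finset.range 2, (-1) ^ (i + 1) * h x ^ i / (i : ℂ) := by
      rw [sub_apply, log1p_apply hh]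
      simp [Finset.sum_range_succ]
    rw [← e] at h1
    refine h1.congr_fun fun k => ?_
    simp only [mul_apply]
    ring

theorem exp_add (f g : HsC n M s) : exp (f + g) = exp f * exp g :=
  ext_apply fun x => by simp [Complex.exp_add]

theorem exp_mul_exp_neg (f : HsC n M s) : exp f * exp (-f) = 1 :=
  ext_apply fun x => by simp [← Complex.exp_add]

/-- `exp u' = exp u · exp (u' - u)` reduces continuity at `u` to continuity at `0`. -/
theorem continuous_exp : Continuous (exp : HsC n M s → HsC n M s) := by
  rw [continuous_iff_continuousAt]
  intro u
  have h1 : Tendsto (fun u' => u' - u) (𝓝 u) (𝓝 0) := by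
    have : Continuous fun u' => u' - u := by fun_prop
    simpa using this.tendsto u
  have h2 := (tangentToId_exp (s := s)).tendsto_zero.comp h1
  have h3 := ((h2.add_const 1).const_mul (exp u))
  have e : exp u * (0 + 1) = exp u := ext_apply fun x => by simp
  rw [e] at h3
  refine h3.congr fun u' => ext_apply fun x => ?_
  simp [← Complex.exp_add]

theorem exp_log1p {h : HsC n M s} (hh : ∀ x, ‖h x‖ < 1) : exp (log1p h) = 1 + h :=
  ext_apply fun x => by
    rw [exp_apply, log1p_apply hh, Complex.exp_log (Complex.slitPlane_ne_zero
      (one_add_mem_slitPlane (hh x)))]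
    rfl

theorem abs_arg_one_add_lt {z : ℂ} (hz : ‖z‖ < 1) : |(Complex.log (1 + z)).im| < Real.pi / 2 := by
  rw [Complex.log_im, Complex.abs_arg_lt_pi_div_two_iff]
  left
  have := (Complex.abs_re_le_norm z).trans_lt hz
  rw [abs_lt] at this
  simp
  linarith

theorem log_exp_of_abs_lt {z : ℂ} (hz : |z.im| < Real.pi) : Complex.log (Complex.exp z) = z := by
  rw [abs_lt] at hz
  exact Complex.log_exp hz.1 hz.2.le

/-- The logarithm near a given function. -/
theorem log1p_eq_add {h h' : HsC n M s} (hh : ∀ x, ‖h x‖ < 1) (hh' : ∀ x, ‖h' x‖ < 1)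
    (hd : ∀ x, ‖((h' - h) * exp (-log1p h)) x‖ < 1) :
    log1p h' = log1p h + log1p ((h' - h) * exp (-log1p h)) := by
  refine ext_apply fun x => ?_
  have e1 : Complex.exp (log1p h x) = 1 + h x := by
    have := congrArg (fun f : HsC n M s => f x) (exp_log1p hh)
    exact this
  rw [add_apply, log1p_apply hd]
  have h1 := abs_arg_one_add_lt (hh x)
  have h2 := abs_arg_one_add_lt (hd x)
  -- Each logarithm has imaginary part below `π/2` in absolute value, so their sum stays in the
  -- principal strip and no multiple of `2πi` intervenes.
  have h3 : |(log1p h x + Complex.log (1 + ((h' - h) * exp (-log1p h)) x)).im| < Real.pi := by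
    rw [Complex.add_im, log1p_apply hh]
    exact (abs_add_le _ _).trans_lt (by linarith)
  rw [← log_exp_of_abs_lt h3, Complex.exp_add, e1,
    Complex.exp_log (Complex.slitPlane_ne_zero (one_add_mem_slitPlane (hd x))), log1p_apply hh']
  congr 1
  have e2 : (1 + h x) * Complex.exp (-(log1p h x)) = 1 := by
    rw [← e1, ← Complex.exp_add]
    simp
  simp only [mul_apply, sub_apply, exp_apply, neg_apply]
  linear_combination -(h' x - h x) * e2

theorem continuousOn_log1p : ContinuousOn (log1p : HsC n M s → HsC n M s) {h | ∀ x, ‖h x‖ < 1} := by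
  intro h hh
  apply ContinuousAt.continuousWithinAt
  have h1 : Tendsto (fun h' => (h' - h) * exp (-log1p h)) (𝓝 h) (𝓝 0) := by
    have : Continuous fun h' => (h' - h) * exp (-log1p h) := by fun_prop
    have h2 := this.tendsto h
    rw [sub_self] at h2
    convert h2 using 2
    exact ext_apply fun x => by simp
  have h2 := ((tangentToId_log1p (s := s)).tendsto_zero.comp h1).const_add (log1p h)
  rw [add_zero] at h2
  refine h2.congr' ?_
  filter_upwards [(isOpen_norm_lt one_pos).mem_nhds hh,
    h1.eventually ((isOpen_norm_lt one_pos).mem_nhds (by simp))] with h' hh' hd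
  exact (log1p_eq_add hh hh' hd).symm

/-- A continuous logarithm of a function of class `H^s` is of class `H^s`. -/
theorem mem_of_exp_mem {w : C(M, ℂ)} {ψ : HsC n M s} (h : ∀ x, ψ x = Complex.exp (w x)) :
    w ∈ sobolevSubmodule n M s := by
  -- The logarithm `w` is only continuous, so it is compared with a smooth `β` at distance below
  -- `1/4`. Then `ψ exp (-β) = exp (w - β)` differs from `1` by less than `1`, and its principal
  -- logarithm, of class `H^s`, is `w - β`.
  obtain ⟨β, hβ, -⟩ := w.continuous.exists_contMDiff_approx (𝓡 n) ⊤
    (continuous_const (y := (1 / 4 : ℝ))) fun _ => by norm_num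
  let b : HsC n M s := ofMem ⟨β, β.contMDiff.continuous⟩
    (ContMDiff.mem_sobolevSubmodule β.contMDiff)
  have hbx : ∀ x, b x = β x := fun _ => rfl
  have hd : ∀ x, ‖w x - b x‖ < 1 / 4 := fun x => by
    rw [← dist_eq_norm, dist_comm]
    exact hβ x
  let k : HsC n M s := ψ * exp (-b) - 1
  have hk : ∀ x, k x = Complex.exp (w x - b x) - 1 := fun x => by
    simp [k, h, Complex.exp_sub, Complex.exp_neg, div_eq_mul_inv]
  have hk1 : ∀ x, ‖k x‖ < 1 := fun x => by
    rw [hk]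
    have := hd x
    exact (Complex.norm_exp_sub_one_le (by linarith)).trans_lt (by linarith)
  have e : w = (log1p k + b).toC := by
    ext x
    rw [add_apply, log1p_apply hk1, hk, add_sub_cancel, log_exp_of_abs_lt, sub_add_cancel]
    refine (Complex.abs_im_le_norm _).trans_lt ((hd x).trans ?_)
    linarith [Real.pi_gt_three]
  rw [e]
  exact (log1p k + b).2

end HsC

end FunctionalCalculus

/-! ### Strict differential calculus in topological vector spaces. -/

section StrictCalculus

universe u v w

/-- The difference quotients `(f (x' + t v') - f x') / t` converge to `y` for `(x', v') → (x, v)`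
and `t → 0`. -/
def HasStrictDirDeriv {E : Type u} {F : Type v} [AddCommGroup E] [Module ℝ E] [TopologicalSpace E]
    [AddCommGroup F] [Module ℝ F] [TopologicalSpace F] (f : E → F) (x v : E) (y : F) : Prop :=
  Tendsto (fun p : (E × E) × ℝ => p.2⁻¹ • (f (p.1.1 + p.2 • p.1.2) - f p.1.1))
    ((𝓝 x ×ˢ 𝓝 v) ×ˢ 𝓝[≠] 0) (𝓝 y)

/-- Continuous differentiability of order `k`, with strict directional derivatives. -/
def StrictContDiffOn : (k : ℕ) → {E : Type u} → {F : Type v} →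
    [AddCommGroup E] → [Module ℝ E] → [TopologicalSpace E] →
    [AddCommGroup F] → [Module ℝ F] → [TopologicalSpace F] →
    (f : E → F) → (U : Set E) → Prop
  | 0, _, _, _, _, _, _, _, _, f, U => ContinuousOn f U
  | k + 1, E, F, _, _, _, _, _, _, f, U =>
      ContinuousOn f U ∧ ∃ df : E × E → F,
        (∀ x ∈ U, ∀ v : E, HasStrictDirDeriv f x v (df (x, v))) ∧
        StrictContDiffOn k df (U ×ˢ (univ : Set E))

section Basic

variable {E : Type u} {F : Type v} [AddCommGroup E] [Module ℝ E] [TopologicalSpace E]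
  [AddCommGroup F] [Module ℝ F] [TopologicalSpace F]

theorem HasStrictDirDeriv.hasDirDeriv {f : E → F} {x v : E} {y : F}
    (h : HasStrictDirDeriv f x v y) : HasDirDeriv f x v y := by
  have h1 : Tendsto (fun t : ℝ => ((x, v), t)) (𝓝[≠] 0) ((𝓝 x ×ˢ 𝓝 v) ×ˢ 𝓝[≠] 0) :=
    (tendsto_const_nhds.prodMk tendsto_const_nhds).prodMk tendsto_id
  exact Tendsto.comp h h1

theorem StrictContDiffOn.continuousOn {k : ℕ} {f : E → F} {U : Set E}
    (h : StrictContDiffOn k f U) : ContinuousOn f U := by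
  cases k with
  | zero => exact h
  | succ k => exact h.1

theorem StrictContDiffOn.contDiffOnTVS {k : ℕ} {f : E → F} {U : Set E}
    (h : StrictContDiffOn k f U) : ContDiffOnTVS k f U := by
  induction k generalizing E with
  | zero => exact h
  | succ k ih =>
    obtain ⟨hc, df, hd, hdf⟩ := h
    exact ⟨hc, df, fun x hx v => (hd x hx v).hasDirDeriv, ih hdf⟩

theorem StrictContDiffOn.mono {k : ℕ} {f : E → F} {U W : Set E}
    (h : StrictContDiffOn k f U) (hW : W ⊆ U) : StrictContDiffOn k f W := by
  induction k generalizing E with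
  | zero => exact ContinuousOn.mono h hW
  | succ k ih =>
    obtain ⟨hc, df, hd, hdf⟩ := h
    exact ⟨hc.mono hW, df, fun x hx v => hd x (hW hx) v, ih hdf (prod_mono hW subset_rfl)⟩

theorem StrictContDiffOn.of_succ {k : ℕ} {f : E → F} {U : Set E}
    (h : StrictContDiffOn (k + 1) f U) : StrictContDiffOn k f U := by
  induction k generalizing E with
  | zero => exact h.1
  | succ k ih =>
    obtain ⟨hc, df, hd, hdf⟩ := h
    exact ⟨hc, df, hd, ih hdf⟩

variable [IsTopologicalAddGroup E] [ContinuousSMul ℝ E]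

theorem tendsto_add_smul (x v : E) : Tendsto (fun p : (E × E) × ℝ => p.1.1 + p.2 • p.1.2)
    ((𝓝 x ×ˢ 𝓝 v) ×ˢ 𝓝[≠] 0) (𝓝 x) := by
  have h : Continuous fun p : (E × E) × ℝ => p.1.1 + p.2 • p.1.2 := by fun_prop
  have h' := h.tendsto ((x, v), 0)
  simp only [zero_smul, add_zero] at h'
  rw [nhds_prod_eq, nhds_prod_eq] at h'
  exact h'.mono_left (Filter.prod_mono le_rfl nhdsWithin_le_nhds)

theorem HasStrictDirDeriv.congr {f g : E → F} {x v : E} {y : F} (h : HasStrictDirDeriv f x v y)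
    {U : Set E} (hU : IsOpen U) (hx : x ∈ U) (hfg : EqOn f g U) : HasStrictDirDeriv g x v y := by
  refine Tendsto.congr' ?_ h
  have h1 := (tendsto_add_smul x v).eventually (hU.mem_nhds hx)
  have h2 : ∀ᶠ p : (E × E) × ℝ in (𝓝 x ×ˢ 𝓝 v) ×ˢ 𝓝[≠] 0, p.1.1 ∈ U :=
    (tendsto_fst.comp tendsto_fst).eventually (hU.mem_nhds hx)
  filter_upwards [h1, h2] with p hp hp'
  rw [hfg hp, hfg hp']

theorem StrictContDiffOn.congr {k : ℕ} {f g : E → F} {U : Set E} (h : StrictContDiffOn k f U)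
    (hU : IsOpen U) (hfg : EqOn f g U) : StrictContDiffOn k g U := by
  cases k with
  | zero => exact ContinuousOn.congr h hfg.symm
  | succ k =>
    obtain ⟨hc, df, hd, hdf⟩ := h
    exact ⟨hc.congr hfg.symm, df, fun x hx v => (hd x hx v).congr hU hx hfg, hdf⟩

theorem HasStrictDirDeriv.unique [T2Space F] {f : E → F} {x v : E} {y z : F}
    (h : HasStrictDirDeriv f x v y) (h' : HasStrictDirDeriv f x v z) : y = z := by
  have h1 : Tendsto (fun t : ℝ => ((x, v), t)) (𝓝[≠] 0) ((𝓝 x ×ˢ 𝓝 v) ×ˢ 𝓝[≠] 0) :=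
    (tendsto_const_nhds.prodMk tendsto_const_nhds).prodMk tendsto_id
  exact tendsto_nhds_unique (Tendsto.comp h h1) (Tendsto.comp h' h1)

/-- Being of class `C^k` is a local property. -/
theorem StrictContDiffOn.of_local [T2Space F] {k : ℕ} {f : E → F} {U : Set E}
    (h : ∀ x ∈ U, ∃ W, IsOpen W ∧ x ∈ W ∧ StrictContDiffOn k f W) : StrictContDiffOn k f U := by
  induction k generalizing E with
  | zero =>
    intro x hx
    obtain ⟨W, hW, hxW, hf⟩ := h x hx
    exact (ContinuousOn.continuousAt hf (hW.mem_nhds hxW)).continuousWithinAt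
  | succ k ih =>
    classical
    have hex : ∀ x ∈ U, ∀ v, ∃ y, HasStrictDirDeriv f x v y := by
      intro x hx v
      obtain ⟨W, hW, hxW, -, df, hd, -⟩ := h x hx
      exact ⟨_, hd x hxW v⟩
    -- The derivative is defined by choice wherever a limit exists; uniqueness of limits identifies
    -- it with each local derivative, so these glue.
    refine ⟨fun x hx => ?_, fun p => if hp : ∃ y, HasStrictDirDeriv f p.1 p.2 y then hp.choose
      else 0, fun x hx v => ?_, ih ?_⟩
    · obtain ⟨W, hW, hxW, hf, -⟩ := h x hx
      exact (hf.continuousAt (hW.mem_nhds hxW)).continuousWithinAt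
    · have := hex x hx v
      simp only [dif_pos this]
      exact this.choose_spec
    · rintro ⟨x, v⟩ ⟨hx, -⟩
      obtain ⟨W, hW, hxW, -, df, hd, hdf⟩ := h x hx
      refine ⟨W ×ˢ univ, hW.prod isOpen_univ, ⟨hxW, mem_univ _⟩,
        hdf.congr (hW.prod isOpen_univ) ?_⟩
      rintro ⟨x', v'⟩ ⟨hx', -⟩
      have : ∃ y, HasStrictDirDeriv f x' v' y := ⟨_, hd x' hx' v'⟩
      simp only [dif_pos this]
      exact (hd x' hx' v').unique this.choose_spec

end Basic

section Operations

variable {E F G : Type*} [AddCommGroup E] [Module ℝ E] [TopologicalSpace E]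
  [IsTopologicalAddGroup E] [ContinuousSMul ℝ E]
  [AddCommGroup F] [Module ℝ F] [TopologicalSpace F] [IsTopologicalAddGroup F] [ContinuousSMul ℝ F]
  [AddCommGroup G] [Module ℝ G] [TopologicalSpace G] [IsTopologicalAddGroup G] [ContinuousSMul ℝ G]

theorem eventually_ne_zero_snd {X : Type*} (l : Filter X) :
    ∀ᶠ p : X × ℝ in l ×ˢ 𝓝[≠] 0, p.2 ≠ 0 :=
  tendsto_snd.eventually (eventually_mem_nhdsWithin (a := (0 : ℝ)) (s := {0}ᶜ))

theorem hasStrictDirDeriv_linear (L : E →L[ℝ] F) (x v : E) : HasStrictDirDeriv L x v (L v) := by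
  have h : Tendsto (fun p : (E × E) × ℝ => L p.1.2) ((𝓝 x ×ˢ 𝓝 v) ×ˢ 𝓝[≠] 0) (𝓝 (L v)) :=
    (L.continuous.tendsto v).comp (tendsto_snd.comp tendsto_fst)
  refine h.congr' ?_
  filter_upwards [eventually_ne_zero_snd (𝓝 x ×ˢ 𝓝 v)] with p hp
  rw [map_add, map_smul, add_sub_cancel_left, smul_smul, inv_mul_cancel₀ hp, one_smul]

theorem strictContDiffOn_linear (k : ℕ) (L : E →L[ℝ] F) (U : Set E) : StrictContDiffOn k L U := by
  induction k generalizing E with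
  | zero => exact L.continuous.continuousOn
  | succ k ih =>
    exact ⟨L.continuous.continuousOn, L ∘L ContinuousLinearMap.snd ℝ E E,
      fun x _ v => hasStrictDirDeriv_linear L x v, ih _ _⟩

theorem strictContDiffOn_const (k : ℕ) (a : F) (U : Set E) :
    StrictContDiffOn k (fun _ : E => a) U := by
  cases k with
  | zero => exact continuousOn_const
  | succ k =>
    refine ⟨continuousOn_const, (0 : E × E →L[ℝ] F), fun x _ v => ?_, strictContDiffOn_linear k _ _⟩
    simp [HasStrictDirDeriv, tendsto_const_nhds]

theorem HasStrictDirDeriv.prodMk {f : E → F} {g : E → G} {x v : E} {y : F} {z : G}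
    (hf : HasStrictDirDeriv f x v y) (hg : HasStrictDirDeriv g x v z) :
    HasStrictDirDeriv (fun x => (f x, g x)) x v (y, z) := by
  unfold HasStrictDirDeriv at *
  rw [nhds_prod_eq]
  exact Tendsto.prodMk hf hg

theorem StrictContDiffOn.prodMk {k : ℕ} {f : E → F} {g : E → G} {U : Set E}
    (hf : StrictContDiffOn k f U) (hg : StrictContDiffOn k g U) :
    StrictContDiffOn k (fun x => (f x, g x)) U := by
  induction k generalizing E with
  | zero => exact ContinuousOn.prodMk hf hg
  | succ k ih =>
    obtain ⟨hc, df, hd, hdf⟩ := hf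
    obtain ⟨hc', dg, hd', hdg⟩ := hg
    exact ⟨hc.prodMk hc', fun p => (df p, dg p), fun x hx v => (hd x hx v).prodMk (hd' x hx v),
      ih hdf hdg⟩

/-- The quotient of `f ∘ g` at `(x', v', t)` is the quotient of `f` at base point `g x'` in the
direction of the difference quotient of `g`. Base point and direction both move, which the strict
notion allows. -/
theorem HasStrictDirDeriv.comp {f : F → G} {g : E → F} {x v : E} {y : F} {z : G}
    (hf : HasStrictDirDeriv f (g x) y z) (hg : HasStrictDirDeriv g x v y) (hc : ContinuousAt g x) :
    HasStrictDirDeriv (fun x => f (g x)) x v z := by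
  have h1 : Tendsto (fun p : (E × E) × ℝ =>
      ((g p.1.1, p.2⁻¹ • (g (p.1.1 + p.2 • p.1.2) - g p.1.1)), p.2))
      ((𝓝 x ×ˢ 𝓝 v) ×ˢ 𝓝[≠] 0) ((𝓝 (g x) ×ˢ 𝓝 y) ×ˢ 𝓝[≠] 0) :=
    ((hc.tendsto.comp (tendsto_fst.comp tendsto_fst)).prodMk hg).prodMk tendsto_snd
  refine (Tendsto.comp hf h1).congr' ?_
  filter_upwards [eventually_ne_zero_snd (𝓝 x ×ˢ 𝓝 v)] with p hp
  simp only [Function.comp_apply]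
  rw [smul_smul, mul_inv_cancel₀ hp, one_smul, add_sub_cancel]

/-- Precedes the general chain rule, whose inductive step needs `(x, v) ↦ g x` to be of class `C^k`.
-/
theorem StrictContDiffOn.comp_linear {k : ℕ} {f : F → G} {W : Set F} (hf : StrictContDiffOn k f W)
    (L : E →L[ℝ] F) : StrictContDiffOn k (fun x => f (L x)) (L ⁻¹' W) := by
  induction k generalizing E F with
  | zero => exact ContinuousOn.comp hf L.continuous.continuousOn (mapsTo_preimage _ _)
  | succ k ih =>
    obtain ⟨hc, df, hd, hdf⟩ := hf
    exact ⟨hc.comp L.continuous.continuousOn (mapsTo_preimage _ _), fun p => df (L p.1, L p.2),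
      fun x hx v => (hd _ hx _).comp (hasStrictDirDeriv_linear L x v) L.continuous.continuousAt,
      (ih hdf (L.prodMap L)).mono fun p hp => ⟨hp.1, mem_univ _⟩⟩

/-- The chain rule. -/
theorem StrictContDiffOn.comp {k : ℕ} {f : F → G} {g : E → F} {U : Set E} {W : Set F}
    (hf : StrictContDiffOn k f W) (hg : StrictContDiffOn k g U) (hU : IsOpen U)
    (hm : MapsTo g U W) : StrictContDiffOn k (fun x => f (g x)) U := by
  induction k generalizing E F with
  | zero => exact ContinuousOn.comp hf hg hm
  | succ k ih =>
    have hgk := hg.of_succ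
    obtain ⟨hc, df, hd, hdf⟩ := hf
    obtain ⟨hc', dg, hd', hdg⟩ := hg
    have hU' : IsOpen (U ×ˢ (univ : Set E)) := hU.prod isOpen_univ
    refine ⟨hc.comp hc' hm, fun p => df (g p.1, dg p), fun x hx v => ?_, ?_⟩
    · exact (hd _ (hm hx) _).comp (hd' x hx v) (hc'.continuousAt (hU.mem_nhds hx))
    · have h1 : StrictContDiffOn k (fun p : E × E => g p.1) (U ×ˢ (univ : Set E)) :=
        (hgk.comp_linear (ContinuousLinearMap.fst ℝ E E)).mono fun p hp => hp.1
      exact ih hdf (h1.prodMk hdg) hU' fun p hp => ⟨hm hp.1, mem_univ _⟩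

theorem StrictContDiffOn.linear_comp {k : ℕ} {g : E → F} {U : Set E} (L : F →L[ℝ] G)
    (hg : StrictContDiffOn k g U) (hU : IsOpen U) : StrictContDiffOn k (fun x => L (g x)) U :=
  (strictContDiffOn_linear k L univ).comp hg hU (mapsTo_univ _ _)

theorem StrictContDiffOn.add {k : ℕ} {f g : E → F} {U : Set E} (hf : StrictContDiffOn k f U)
    (hg : StrictContDiffOn k g U) (hU : IsOpen U) : StrictContDiffOn k (fun x => f x + g x) U := by
  have := (hf.prodMk hg).linear_comp
    (ContinuousLinearMap.fst ℝ F F + ContinuousLinearMap.snd ℝ F F) hU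
  simpa using this

theorem StrictContDiffOn.sub {k : ℕ} {f g : E → F} {U : Set E} (hf : StrictContDiffOn k f U)
    (hg : StrictContDiffOn k g U) (hU : IsOpen U) : StrictContDiffOn k (fun x => f x - g x) U := by
  have := (hf.prodMk hg).linear_comp
    (ContinuousLinearMap.fst ℝ F F - ContinuousLinearMap.snd ℝ F F) hU
  simpa using this

variable {H : Type*} [AddCommGroup H] [Module ℝ H] [TopologicalSpace H] [IsTopologicalAddGroup H]
  [ContinuousSMul ℝ H]

/-- For `t ≠ 0` the difference quotient equals `B x.1 v.2 + B v.1 (x.2 + t v.2)` exactly, and this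
is jointly continuous in all variables up to `t = 0`. -/
theorem hasStrictDirDeriv_bilinear (B : F →ₗ[ℝ] G →ₗ[ℝ] H)
    (hB : Continuous fun p : F × G => B p.1 p.2) (x v : F × G) :
    HasStrictDirDeriv (fun p : F × G => B p.1 p.2) x v (B x.1 v.2 + B v.1 x.2) := by
  have h : Continuous fun p : ((F × G) × (F × G)) × ℝ =>
      B p.1.1.1 p.1.2.2 + B p.1.2.1 (p.1.1.2 + p.2 • p.1.2.2) :=
    (hB.comp (f := fun p : ((F × G) × (F × G)) × ℝ => (p.1.1.1, p.1.2.2)) (by fun_prop)).add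
      (hB.comp (f := fun p : ((F × G) × (F × G)) × ℝ => (p.1.2.1, p.1.1.2 + p.2 • p.1.2.2))
        (by fun_prop))
  have h' := h.tendsto ((x, v), 0)
  simp only [zero_smul, add_zero] at h'
  rw [nhds_prod_eq, nhds_prod_eq] at h'
  refine (h'.mono_left (Filter.prod_mono le_rfl nhdsWithin_le_nhds)).congr' ?_
  filter_upwards [eventually_ne_zero_snd (𝓝 x ×ˢ 𝓝 v)] with p hp
  simp only [Prod.fst_add, Prod.snd_add, Prod.smul_fst, Prod.smul_snd, map_add, map_smul,
    LinearMap.add_apply, LinearMap.smul_apply, smul_add]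
  simp only [smul_sub, smul_add, smul_smul, inv_mul_cancel₀ hp, one_smul]
  rw [← mul_assoc, inv_mul_cancel₀ hp, one_mul]
  abel

theorem strictContDiffOn_bilinear (k : ℕ) (B : F →ₗ[ℝ] G →ₗ[ℝ] H)
    (hB : Continuous fun p : F × G => B p.1 p.2) (U : Set (F × G)) :
    StrictContDiffOn k (fun p : F × G => B p.1 p.2) U := by
  induction k generalizing U with
  | zero => exact hB.continuousOn
  | succ k ih =>
    refine ⟨hB.continuousOn, fun p => B p.1.1 p.2.2 + B p.2.1 p.1.2,
      fun x _ v => hasStrictDirDeriv_bilinear B hB x v, ?_⟩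
    refine StrictContDiffOn.mono (U := univ) ?_ (subset_univ _)
    have h1 : StrictContDiffOn k (fun p : (F × G) × (F × G) => (p.1.1, p.2.2)) univ :=
      strictContDiffOn_linear k (((ContinuousLinearMap.fst ℝ F G).comp
        (ContinuousLinearMap.fst ℝ (F × G) (F × G))).prod ((ContinuousLinearMap.snd ℝ F G).comp
        (ContinuousLinearMap.snd ℝ (F × G) (F × G)))) _
    have h2 : StrictContDiffOn k (fun p : (F × G) × (F × G) => (p.2.1, p.1.2)) univ :=
      strictContDiffOn_linear k (((ContinuousLinearMap.fst ℝ F G).comp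
        (ContinuousLinearMap.snd ℝ (F × G) (F × G))).prod ((ContinuousLinearMap.snd ℝ F G).comp
        (ContinuousLinearMap.fst ℝ (F × G) (F × G)))) _
    exact ((ih univ).comp h1 isOpen_univ (mapsTo_univ _ _)).add
      ((ih univ).comp h2 isOpen_univ (mapsTo_univ _ _)) isOpen_univ

theorem StrictContDiffOn.bilinear {k : ℕ} {f : E → F} {g : E → G} {U : Set E}
    (B : F →ₗ[ℝ] G →ₗ[ℝ] H) (hB : Continuous fun p : F × G => B p.1 p.2)
    (hf : StrictContDiffOn k f U) (hg : StrictContDiffOn k g U) (hU : IsOpen U) :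
    StrictContDiffOn k (fun x => B (f x) (g x)) U :=
  (strictContDiffOn_bilinear k B hB univ).comp (hf.prodMk hg) hU (mapsTo_univ _ _)

/-- The difference quotient is exactly `-v / (x (x + t v))`, and the derivative is built from
inversion and multiplication, so induction on `k` closes. -/
theorem strictContDiffOn_inv (k : ℕ) :
    StrictContDiffOn k (fun z : ℂ => z⁻¹) {z | z ≠ 0} := by
  have hopen : IsOpen {z : ℂ | z ≠ 0} := isOpen_ne
  have hc : ContinuousOn (fun z : ℂ => z⁻¹) {z | z ≠ 0} := continuousOn_inv₀
  induction k with
  | zero => exact hc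
  | succ k ih =>
    refine ⟨hc, fun p => -(p.1⁻¹ * p.1⁻¹ * p.2), fun x hx v => ?_, ?_⟩
    · have hx' : x ≠ 0 := hx
      have h1 := tendsto_add_smul x v
      have h2 : Tendsto (fun p : (ℂ × ℂ) × ℝ => p.1.1) ((𝓝 x ×ˢ 𝓝 v) ×ˢ 𝓝[≠] 0) (𝓝 x) :=
        tendsto_fst.comp tendsto_fst
      have h3 : Tendsto (fun p : (ℂ × ℂ) × ℝ => p.1.2) ((𝓝 x ×ˢ 𝓝 v) ×ˢ 𝓝[≠] 0) (𝓝 v) :=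
        tendsto_snd.comp tendsto_fst
      refine ((((h2.inv₀ hx').mul (h1.inv₀ hx')).mul h3).neg).congr' ?_
      filter_upwards [eventually_ne_zero_snd (𝓝 x ×ˢ 𝓝 v), h1.eventually_ne hx',
        h2.eventually_ne hx'] with p hp hp1 hp2
      rw [Complex.real_smul] at hp1
      have hp' : (p.2 : ℂ) ≠ 0 := by exact_mod_cast hp
      simp only [Complex.real_smul, Complex.ofReal_inv]
      field_simp
      ring
    · have hU : IsOpen ({z : ℂ | z ≠ 0} ×ˢ (univ : Set ℂ)) := hopen.prod isOpen_univ
      have h1 : StrictContDiffOn k (fun p : ℂ × ℂ => p.1⁻¹) ({z : ℂ | z ≠ 0} ×ˢ (univ : Set ℂ)) :=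
        ih.comp (strictContDiffOn_linear k (ContinuousLinearMap.fst ℝ ℂ ℂ) _) hU fun p hp => hp.1
      have hmul : Continuous fun p : ℂ × ℂ => LinearMap.mul ℝ ℂ p.1 p.2 := by
        simpa using continuous_mul
      have h2 := StrictContDiffOn.bilinear (LinearMap.mul ℝ ℂ) hmul
        (StrictContDiffOn.bilinear (LinearMap.mul ℝ ℂ) hmul h1 h1 hU)
        (strictContDiffOn_linear k (ContinuousLinearMap.snd ℝ ℂ ℂ) _) hU
      exact h2.linear_comp (-ContinuousLinearMap.id ℝ ℂ) hU

end Operations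

end StrictCalculus

/-! ### Smoothness of exponential and logarithm. -/

section SmoothFunctions

section

variable {E F : Type*} [AddCommGroup E] [Module ℝ E] [TopologicalSpace E]
  [IsTopologicalAddGroup E] [ContinuousSMul ℝ E]
  [AddCommGroup F] [Module ℝ F] [TopologicalSpace F] [IsTopologicalAddGroup F] [ContinuousSMul ℝ F]

theorem strictContDiffOn_id (k : ℕ) (U : Set E) : StrictContDiffOn k (fun x : E => x) U :=
  strictContDiffOn_linear k (ContinuousLinearMap.id ℝ E) U

theorem strictContDiffOn_snd (k : ℕ) (U : Set (E × F)) :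
    StrictContDiffOn k (Prod.snd : E × F → F) U :=
  strictContDiffOn_linear k (ContinuousLinearMap.snd ℝ E F) U

theorem hasStrictDirDeriv_fst (x v : E × F) :
    HasStrictDirDeriv (fun p : E × F => p.1) x v v.1 :=
  hasStrictDirDeriv_linear (ContinuousLinearMap.fst ℝ E F) x v

theorem hasStrictDirDeriv_snd (x v : E × F) :
    HasStrictDirDeriv (fun p : E × F => p.2) x v v.2 :=
  hasStrictDirDeriv_linear (ContinuousLinearMap.snd ℝ E F) x v

theorem StrictContDiffOn.comp_fst {k : ℕ} {f : E → F} {U : Set E} (h : StrictContDiffOn k f U) :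
    StrictContDiffOn k (fun p : E × E => f p.1) (U ×ˢ univ) :=
  (h.comp_linear (ContinuousLinearMap.fst ℝ E E)).mono fun _ hp => hp.1

theorem HasStrictDirDeriv.add_const {f : E → F} {x v : E} {y : F} (h : HasStrictDirDeriv f x v y)
    (a : F) : HasStrictDirDeriv (fun x => f x + a) x v y := by
  refine Tendsto.congr (fun p => ?_) h
  rw [add_sub_add_right_eq_sub]

theorem HasStrictDirDeriv.linear_comp {G : Type*} [AddCommGroup G] [Module ℝ G]
    [TopologicalSpace G] (L : F →L[ℝ] G) {f : E → F} {x v : E} {y : F}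
    (h : HasStrictDirDeriv f x v y) : HasStrictDirDeriv (fun x => L (f x)) x v (L y) := by
  refine Tendsto.congr (fun p => ?_) ((L.continuous.tendsto _).comp h)
  simp

end

variable {n : ℕ} {M : Type*} [TopologicalSpace M] [ChartedSpace (EuclideanSpace ℝ (Fin n)) M]
  [T2Space M] [CompactSpace M] [IsManifold (𝓡 n) ∞ M] {s : WithTop ℝ}
  [hs : Fact ((((n : ℝ) / 2 : ℝ) : WithTop ℝ) < s)]

namespace HsC

variable (n M s) in
/-- The multiplication of `H^s(M, ℂ)` as a real bilinear map. -/
def mulₗ : HsC n M s →ₗ[ℝ] HsC n M s →ₗ[ℝ] HsC n M s :=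
  LinearMap.mk₂ ℝ (fun f g => f * g)
    (fun f f' g => ext_apply fun x => by simp [add_mul])
    (fun a f g => ext_apply fun x => by simp [mul_assoc])
    (fun f g g' => ext_apply fun x => by simp [mul_add])
    (fun a f g => ext_apply fun x => by simp [mul_left_comm])

theorem continuous_mulₗ : Continuous fun p : HsC n M s × HsC n M s => mulₗ n M s p.1 p.2 :=
  continuous_mul

variable (n M s) in
/-- Scalar multiplication as a real bilinear map. -/
def smulₗ : ℂ →ₗ[ℝ] HsC n M s →ₗ[ℝ] HsC n M s :=
  LinearMap.mk₂ ℝ (fun a g => a • g)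
    (fun f f' g => add_smul f f' g)
    (fun a f g => ext_apply fun x => by simp [mul_assoc])
    (fun f g g' => smul_add f g g')
    (fun a f g => ext_apply fun x => by simp [mul_left_comm])

theorem continuous_smulₗ : Continuous fun p : ℂ × HsC n M s => smulₗ n M s p.1 p.2 :=
  continuous_smul

section

variable {E : Type*} [AddCommGroup E] [Module ℝ E] [TopologicalSpace E]
  [IsTopologicalAddGroup E] [ContinuousSMul ℝ E] {U : Set E} {k : ℕ}

theorem strictContDiffOn_mul {f g : E → HsC n M s} (hf : StrictContDiffOn k f U)
    (hg : StrictContDiffOn k g U) (hU : IsOpen U) : StrictContDiffOn k (fun x => f x * g x) U :=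
  StrictContDiffOn.bilinear (mulₗ n M s) continuous_mulₗ hf hg hU

theorem strictContDiffOn_smul {f : E → ℂ} {g : E → HsC n M s} (hf : StrictContDiffOn k f U)
    (hg : StrictContDiffOn k g U) (hU : IsOpen U) : StrictContDiffOn k (fun x => f x • g x) U :=
  StrictContDiffOn.bilinear (smulₗ n M s) continuous_smulₗ hf hg hU

end

/-- `exp (f + t v) - exp f = exp f · (exp (t v) - 1)` reduces the claim to the tangency of `exp - 1`
to the identity at `0`. -/
theorem hasStrictDirDeriv_exp (f v : HsC n M s) : HasStrictDirDeriv exp f v (exp f * v) := by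
  have h1 : Tendsto (fun p : (HsC n M s × HsC n M s) × ℝ => (p.1.2, p.2))
      ((𝓝 f ×ˢ 𝓝 v) ×ˢ 𝓝[≠] 0) (𝓝 v ×ˢ 𝓝[≠] 0) :=
    (tendsto_snd.comp tendsto_fst).prodMk tendsto_snd
  have h2 := ((tangentToId_exp (s := s)).tendsto_div v).comp h1
  have h3 : Tendsto (fun p : (HsC n M s × HsC n M s) × ℝ => exp p.1.1)
      ((𝓝 f ×ˢ 𝓝 v) ×ˢ 𝓝[≠] 0) (𝓝 (exp f)) :=
    (continuous_exp.tendsto f).comp (tendsto_fst.comp tendsto_fst)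
  refine (h3.mul h2).congr fun p => ext_apply fun x => ?_
  simp [Complex.exp_add]
  ring

theorem strictContDiffOn_exp (k : ℕ) (U : Set (HsC n M s)) : StrictContDiffOn k exp U := by
  refine StrictContDiffOn.mono (U := univ) ?_ (subset_univ _)
  induction k with
  | zero => exact continuous_exp.continuousOn
  | succ k ih =>
    refine ⟨continuous_exp.continuousOn, fun p => exp p.1 * p.2,
      fun f _ v => hasStrictDirDeriv_exp f v, ?_⟩
    exact strictContDiffOn_mul ih.comp_fst (strictContDiffOn_snd k _)
      (isOpen_univ.prod isOpen_univ)

/-- By `log1p_eq_add` the increment is itself `log1p (t v exp (-log1p h))`, so the derivative at `0`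
determines it; continuity of `log1p` and `exp` lets base point and direction vary. -/
theorem hasStrictDirDeriv_log1p {h : HsC n M s} (hh : ∀ x, ‖h x‖ < 1) (v : HsC n M s) :
    HasStrictDirDeriv log1p h v (v * exp (-log1p h)) := by
  let l : Filter ((HsC n M s × HsC n M s) × ℝ) := (𝓝 h ×ˢ 𝓝 v) ×ˢ 𝓝[≠] 0
  have hfst : Tendsto (fun p : (HsC n M s × HsC n M s) × ℝ => p.1.1) l (𝓝 h) :=
    tendsto_fst.comp tendsto_fst
  have hO : IsOpen {h : HsC n M s | ∀ x, ‖h x‖ < 1} := isOpen_norm_lt one_pos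
  have h0 : Tendsto (fun p : (HsC n M s × HsC n M s) × ℝ => p.1.2 * exp (-log1p p.1.1)) l
      (𝓝 (v * exp (-log1p h))) := by
    refine (tendsto_snd.comp tendsto_fst).mul ((continuous_exp.tendsto _).comp ?_)
    exact (((continuousOn_log1p.continuousAt (hO.mem_nhds hh)).tendsto).comp hfst).neg
  have h1 : Tendsto (fun p : (HsC n M s × HsC n M s) × ℝ =>
      (p.1.2 * exp (-log1p p.1.1), p.2)) l (𝓝 (v * exp (-log1p h)) ×ˢ 𝓝[≠] 0) :=
    h0.prodMk tendsto_snd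
  refine (((tangentToId_log1p (s := s)).tendsto_div _).comp h1).congr' ?_
  have ht : Tendsto (fun p : (HsC n M s × HsC n M s) × ℝ =>
      p.2 • (p.1.2 * exp (-log1p p.1.1))) l (𝓝 0) := by
    have : Tendsto (fun p : (HsC n M s × HsC n M s) × ℝ => p.2) l (𝓝 0) :=
      (tendsto_snd (f := 𝓝 h ×ˢ 𝓝 v)).mono_right nhdsWithin_le_nhds
    simpa using this.smul h0
  filter_upwards [hfst.eventually (hO.mem_nhds hh),
    (tendsto_add_smul h v).eventually (hO.mem_nhds hh),
    ht.eventually (hO.mem_nhds (by simp))] with p hp hp' hd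
  have e : (p.1.1 + p.2 • p.1.2 - p.1.1) * exp (-log1p p.1.1) =
      p.2 • (p.1.2 * exp (-log1p p.1.1)) := ext_apply fun x => by simp [mul_assoc]
  simp only [Function.comp_apply]
  rw [log1p_eq_add hp hp' (by rwa [e]), e, add_sub_cancel_left]

theorem strictContDiffOn_log1p (k : ℕ) :
    StrictContDiffOn k log1p {h : HsC n M s | ∀ x, ‖h x‖ < 1} := by
  have hO : IsOpen {h : HsC n M s | ∀ x, ‖h x‖ < 1} := isOpen_norm_lt one_pos
  induction k with
  | zero => exact continuousOn_log1p
  | succ k ih =>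
    refine ⟨continuousOn_log1p, fun p => p.2 * exp (-log1p p.1),
      fun h hh v => hasStrictDirDeriv_log1p hh v, ?_⟩
    have hO' := hO.prod (isOpen_univ (X := HsC n M s))
    refine strictContDiffOn_mul (f := Prod.snd) (g := fun p => exp (-log1p p.1))
      (strictContDiffOn_snd k _)
      ((strictContDiffOn_exp k univ).comp ?_ hO' (mapsTo_univ _ _)) hO'
    exact ih.comp_fst.linear_comp (-ContinuousLinearMap.id ℝ (HsC n M s)) hO'

/-- A neighbourhood of `exp u` on which the logarithm that takes the value `u` at `exp u` is
defined. -/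
def logDomain (u : HsC n M s) : Set (HsC n M s) := {ψ | ∀ x, ‖(ψ * exp (-u) - 1) x‖ < 1}

/-- The logarithm near `exp u` that takes the value `u` at `exp u`. -/
def logNear (u ψ : HsC n M s) : HsC n M s := u + log1p (ψ * exp (-u) - 1)

theorem isOpen_logDomain (u : HsC n M s) : IsOpen (logDomain u) :=
  (isOpen_norm_lt one_pos).preimage (by fun_prop : Continuous fun ψ => ψ * exp (-u) - 1)

theorem exp_mem_logDomain (u : HsC n M s) : exp u ∈ logDomain u := fun x => by
  rw [exp_mul_exp_neg, sub_self]
  simp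

theorem exp_logNear {u ψ : HsC n M s} (h : ψ ∈ logDomain u) : exp (logNear u ψ) = ψ := by
  rw [logNear, exp_add, exp_log1p h]
  refine ext_apply fun x => ?_
  have : Complex.exp (u x) * Complex.exp (-u x) = 1 := by rw [← Complex.exp_add]; simp
  simp
  linear_combination ψ x * this

theorem strictContDiffOn_logNear_arg (k : ℕ) (u : HsC n M s) :
    StrictContDiffOn k (fun ψ => ψ * exp (-u) - 1) (logDomain u) :=
  (strictContDiffOn_mul (g := fun _ => exp (-u)) (strictContDiffOn_id k _)
    (strictContDiffOn_const k (exp (-u)) _) (isOpen_logDomain u)).sub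
    (strictContDiffOn_const k (1 : HsC n M s) _) (isOpen_logDomain u)

theorem strictContDiffOn_logNear (k : ℕ) (u : HsC n M s) :
    StrictContDiffOn k (logNear u) (logDomain u) := by
  have hO := isOpen_logDomain u
  have h1 := strictContDiffOn_logNear_arg k u
  exact (strictContDiffOn_const k u _).add
    ((strictContDiffOn_log1p k).comp h1 hO fun _ h => h) hO

theorem continuousOn_logNear (u : HsC n M s) : ContinuousOn (logNear u) (logDomain u) :=
  (strictContDiffOn_logNear 0 u).continuousOn

/-- Multiplication by a fixed function. -/
def mulRight (g : HsC n M s) : HsC n M s →L[ℝ] HsC n M s where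
  toLinearMap := (mulₗ n M s).flip g
  cont := continuous_mul_const g

theorem log1p_zero : log1p (0 : HsC n M s) = 0 := ext_apply fun x => by
  rw [log1p_apply (by simp)]
  simp

theorem hasStrictDirDeriv_logNear (u v : HsC n M s) :
    HasStrictDirDeriv (logNear u) (exp u) v (v * exp (-u)) := by
  have h1 : HasStrictDirDeriv (fun ψ => ψ * exp (-u) - 1) (exp u) v (v * exp (-u)) := by
    simp_rw [sub_eq_add_neg]
    exact (hasStrictDirDeriv_linear (mulRight (exp (-u))) (exp u) v).add_const (-1)
  have h3 : HasStrictDirDeriv log1p (exp u * exp (-u) - 1) (v * exp (-u)) (v * exp (-u)) := by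
    rw [exp_mul_exp_neg, sub_self]
    have := hasStrictDirDeriv_log1p (h := (0 : HsC n M s)) (by simp) (v * exp (-u))
    have e : v * exp (-u) * exp (-log1p 0) = v * exp (-u) := by
      rw [log1p_zero]
      exact ext_apply fun x => by simp
    rwa [e] at this
  have h4 := (h3.comp (g := fun ψ => ψ * exp (-u) - 1) h1 (by fun_prop)).add_const u
  simp_rw [add_comm _ u] at h4
  exact h4

end HsC

end SmoothFunctions

/-! ### Real-valued functions, cosets modulo constants and the model spaces. -/

section RealFunctions

variable {n : ℕ} {M : Type*} [TopologicalSpace M] [ChartedSpace (EuclideanSpace ℝ (Fin n)) M]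
  [T2Space M] [CompactSpace M] [IsManifold (𝓡 n) ∞ M] {s : WithTop ℝ}
  [hs : Fact ((((n : ℝ) / 2 : ℝ) : WithTop ℝ) < s)]

theorem continuous_integral_continuousMap {𝕜 : Type*} [RCLike 𝕜] [MeasurableSpace M]
    [BorelSpace M] (μ : Measure M) [IsProbabilityMeasure μ] :
    Continuous fun f : C(M, 𝕜) => ∫ x, f x ∂μ := by
  let L : C(M, 𝕜) →ₗ[𝕜] 𝕜 :=
    { toFun := fun f => ∫ x, f x ∂μ
      map_add' := fun f g => integral_add (integrable_continuousMap μ f) (integrable_continuousMap μ g)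
      map_smul' := fun a f => integral_const_mul a _ }
  refine (L.mkContinuous 1 fun f => ?_).continuous
  have := norm_integral_le_of_norm_le_const (μ := μ)
    (Eventually.of_forall fun x => f.norm_coe_le_norm x)
  rw [probReal_univ, mul_comm] at this
  exact this

namespace HsR

/-- A continuous function of class `H^s`, as an element of `H^s(M)`. -/
def ofMem (f : C(M, ℝ)) (hf : complexify f ∈ sobolevSubmodule n M s) : HsR n M s := ⟨f, hf⟩

@[simp] theorem ofMem_apply (f : C(M, ℝ)) (hf : complexify f ∈ sobolevSubmodule n M s) (x : M) :
    ofMem f hf x = f x := rfl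

theorem ext_apply {f g : HsR n M s} (h : ∀ x, f x = g x) : f = g :=
  Subtype.ext (ContinuousMap.ext h)

@[simp] theorem add_apply (f g : HsR n M s) (x : M) : (f + g) x = f x + g x := by simp
@[simp] theorem sub_apply (f g : HsR n M s) (x : M) : (f - g) x = f x - g x := by simp
@[simp] theorem smul_apply (a : ℝ) (f : HsR n M s) (x : M) : (a • f) x = a * f x := by simp
@[simp] theorem toHsC_apply (f : HsR n M s) (x : M) : f.toHsC x = (f x : ℂ) := rfl

theorem toHsC_add (f g : HsR n M s) : (f + g).toHsC = f.toHsC + g.toHsC :=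
  HsC.ext_apply fun x => by simp

theorem toHsC_smul (a : ℝ) (f : HsR n M s) : (a • f).toHsC = a • f.toHsC :=
  HsC.ext_apply fun x => by simp

theorem toHsC_neg (f : HsR n M s) : (-f).toHsC = -f.toHsC :=
  HsC.ext_apply fun x => by simp

theorem continuous_toHsC : Continuous (toHsC : HsR n M s → HsC n M s) := continuous_induced_dom

theorem continuous_iff_toHsC {X : Type*} [TopologicalSpace X] {F : X → HsR n M s} :
    Continuous F ↔ Continuous fun x => (F x).toHsC := continuous_induced_rng

instance : IsTopologicalAddGroup (HsR n M s) where
  continuous_add := continuous_iff_toHsC.mpr <| by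
    simp_rw [toHsC_add]
    exact (continuous_toHsC.comp continuous_fst).add (continuous_toHsC.comp continuous_snd)
  continuous_neg := continuous_iff_toHsC.mpr <| by
    simp_rw [toHsC_neg]
    exact continuous_toHsC.neg

instance : ContinuousSMul ℝ (HsR n M s) where
  continuous_smul := continuous_iff_toHsC.mpr <| by
    simp_rw [toHsC_smul]
    exact continuous_fst.smul (continuous_toHsC.comp continuous_snd)

theorem toHsC_injective : Function.Injective (toHsC : HsR n M s → HsC n M s) := fun f g h =>
  ext_apply fun x => by
    have : f.toHsC x = g.toHsC x := by rw [h]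
    rw [toHsC_apply, toHsC_apply] at this
    exact Complex.ofReal_injective this

instance : T2Space (HsR n M s) := T2Space.of_injective_continuous toHsC_injective continuous_toHsC

variable (n M s) in
/-- The inclusion `H^s(M) ⊆ H^s(M, ℂ)` as a continuous linear map. -/
def toHsCL : HsR n M s →L[ℝ] HsC n M s where
  toFun := toHsC
  map_add' := toHsC_add
  map_smul' := toHsC_smul
  cont := continuous_toHsC

theorem continuous_toC : Continuous (toC : HsR n M s → C(M, ℝ)) := by
  have h : Continuous fun f : HsR n M s => HsC.toC f.toHsC :=
    HsC.continuous_toC.comp continuous_toHsC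
  have e : (toC : HsR n M s → C(M, ℝ)) =
      fun f => (⟨Complex.re, Complex.continuous_re⟩ : C(ℂ, ℝ)).comp (HsC.toC f.toHsC) := by
    ext f x
    exact (Complex.ofReal_re _).symm
  rw [e]
  exact (ContinuousMap.continuous_postcomp _).comp h

/-- Positivity is open for uniform convergence on a compact space, and the `H^s` topology is finer.
-/
theorem isOpen_pos : IsOpen {f : HsR n M s | ∀ x, 0 < f x} := by
  have h : IsOpen {f : C(M, ℝ) | MapsTo f univ (Ioi 0)} :=
    ContinuousMap.isOpen_setOfPred_mapsTo isCompact_univ isOpen_Ioi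
  have := h.preimage (continuous_toC (n := n) (s := s))
  convert this using 1
  ext f
  simp [MapsTo]

/-- A constant function. -/
def const (a : ℝ) : HsR n M s := ofMem (ContinuousMap.const M a) <|
  ContMDiff.mem_sobolevSubmodule
    (contMDiff_const : ContMDiff (𝓡 n) 𝓘(ℝ, ℂ) ∞ fun _ : M => (a : ℂ))

@[simp] theorem const_apply (a : ℝ) (x : M) : (const a : HsR n M s) x = a := rfl

variable (n M s) in
/-- The constants as a continuous linear map. -/
def constL : ℝ →L[ℝ] HsR n M s where
  toFun := const
  map_add' a b := ext_apply fun x => by simp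
  map_smul' a b := ext_apply fun x => by simp
  cont := by
    have e : (const : ℝ → HsR n M s) = fun a => a • const 1 := by
      ext a
      exact ext_apply fun x => by simp
    rw [e]
    fun_prop

@[simp] theorem constL_apply (a : ℝ) : constL n M s a = const a := rfl

section Integral

variable [MeasurableSpace M] [BorelSpace M] (μ : Measure M) [IsProbabilityMeasure μ]

variable (n s) in
/-- The integral as a continuous linear form on `H^s(M)`. -/
def integral : HsR n M s →L[ℝ] ℝ where
  toFun f := ∫ x, f x ∂μ
  map_add' f g := by
    simp only [add_apply]
    exact integral_add (integrable_continuousMap μ f.toC) (integrable_continuousMap μ g.toC)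
  map_smul' a f := by
    simp only [smul_apply]
    exact integral_const_mul a _
  cont := (continuous_integral_continuousMap μ).comp continuous_toC

@[simp] theorem integral_apply (f : HsR n M s) : integral n s μ f = ∫ x, f x ∂μ := rfl

end Integral

end HsR

namespace HsC

theorem re_mem (f : HsC n M s) :
    complexify ⟨fun x => (f x).re, by fun_prop⟩ ∈ sobolevSubmodule n M s := by
  have : complexify ⟨fun x => (f x).re, by fun_prop⟩ = ((1 / 2 : ℂ) • (f + conj f)).toC := by
    ext x
    rw [smul_apply, add_apply, conj_apply, Complex.add_conj]
    simp [complexify]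
  rw [this]
  exact ((1 / 2 : ℂ) • (f + conj f)).2

variable (n M s) in
/-- The real part. -/
def re : HsC n M s →L[ℝ] HsR n M s where
  toFun f := HsR.ofMem _ (re_mem f)
  map_add' f g := HsR.ext_apply fun x => by simp [-map_add]
  map_smul' a f := HsR.ext_apply fun x => by
    rw [RingHom.id_apply, HsR.smul_apply, HsR.ofMem_apply, HsR.ofMem_apply]
    exact (congrArg Complex.re (real_smul_apply a f x)).trans (Complex.re_ofReal_mul _ _)
  cont := HsR.continuous_iff_toHsC.mpr <| by
    have : (fun f : HsC n M s => HsR.toHsC (HsR.ofMem _ (re_mem f))) =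
        fun f => (1 / 2 : ℂ) • (f + conj f) := by
      ext f
      refine ext_apply fun x => ?_
      rw [smul_apply, add_apply, conj_apply, Complex.add_conj, HsR.toHsC_apply, HsR.ofMem_apply]
      simp
    rw [this]
    have h := continuous_conj (n := n) (M := M) (s := s)
    fun_prop

@[simp] theorem re_apply (f : HsC n M s) (x : M) : re n M s f x = (f x).re := rfl

variable (n M s) in
/-- Multiplication by a complex number. -/
def smulL (a : ℂ) : HsC n M s →L[ℝ] HsC n M s where
  toLinearMap := smulₗ n M s a
  cont := continuous_const_smul a

@[simp] theorem smulL_apply (a : ℂ) (f : HsC n M s) : smulL n M s a f = a • f := rfl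

variable (n M s) in
/-- The imaginary part. -/
def im : HsC n M s →L[ℝ] HsR n M s := re n M s ∘L smulL n M s (-Complex.I)

@[simp] theorem im_apply (f : HsC n M s) (x : M) : im n M s f x = (f x).im := by
  simp [im]

end HsC

section Model

variable [MeasurableSpace M] [BorelSpace M] (μ : Measure M) [IsProbabilityMeasure μ]

/-- The representative with mean zero of a coset, `[θ] ↦ θ - ∫ θ`. -/
def meanZeroRep : (HsR n M s ⧸ constants n M s) →L[ℝ] HsR n M s where
  toLinearMap := (constants n M s).liftQ
    (ContinuousLinearMap.id ℝ (HsR n M s) - HsR.constL n M s ∘L HsR.integral n s μ).toLinearMap (by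
      rintro f ⟨a, ha⟩
      rw [LinearMap.mem_ker]
      refine HsR.ext_apply fun x => ?_
      change f x - ∫ y, f y ∂μ = _
      simp [ha])
  cont := by
    refine continuous_quot_lift _ ?_
    exact (ContinuousLinearMap.id ℝ (HsR n M s) - HsR.constL n M s ∘L HsR.integral n s μ).continuous

theorem meanZeroRep_mk_apply (θ : HsR n M s) (x : M) :
    meanZeroRep μ (Submodule.Quotient.mk θ) x = θ x - ∫ y, θ y ∂μ := rfl

theorem mk_meanZeroRep (t : HsR n M s ⧸ constants n M s) :
    Submodule.Quotient.mk (meanZeroRep μ t) = t := by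
  induction t using Submodule.Quotient.induction_on with
  | H θ =>
    rw [Submodule.Quotient.eq]
    exact ⟨-∫ y, θ y ∂μ, fun x => by
      rw [HsR.sub_apply, meanZeroRep_mk_apply]
      ring⟩

variable (n M s) in
/-- The quotient map `H^s(M) → H^s(M)/ℝ`. -/
def cosetL : HsR n M s →L[ℝ] HsR n M s ⧸ constants n M s where
  toLinearMap := (constants n M s).mkQ
  cont := continuous_quot_mk

theorem meanZeroRep_injective : Function.Injective (meanZeroRep μ : _ → HsR n M s) :=
  Function.LeftInverse.injective (g := Submodule.Quotient.mk) (mk_meanZeroRep μ)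

/-- The mean-zero representative embeds the quotient continuously into `H^s(M)`. Hausdorffness is
needed to glue local derivatives of the inverse transform. -/
theorem t2Space_coset (μ : Measure M) [IsProbabilityMeasure μ] : T2Space (HsR n M s ⧸ constants n M s) := by
  exact T2Space.of_injective_continuous (meanZeroRep_injective μ) (meanZeroRep μ).continuous

instance (φ : HsC n M s) : ContinuousSMul ℝ (orth μ φ) where
  continuous_smul := continuous_induced_rng.mpr <| by
    change Continuous fun p : ℝ × orth μ φ => p.1 • (p.2 : HsC n M s)
    fun_prop

variable (n s) in
/-- The projection `f ↦ f - ∫ f` onto the functions with vanishing integral. -/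
def meanZero : HsR n M s →L[ℝ] HsZero n s μ :=
  (ContinuousLinearMap.id ℝ (HsR n M s) - HsR.constL n M s ∘L HsR.integral n s μ).codRestrict
    (HsZero n s μ) fun f => by
      change HsR.integral n s μ (f - HsR.const (∫ x, f x ∂μ)) = 0
      rw [map_sub]
      simp

variable (s) in
/-- The linear form `v ↦ ⟨v, φ⟩`. -/
def l2L (φ : HsC n M s) : HsC n M s →L[ℝ] ℂ where
  toFun v := l2 μ v φ
  map_add' v w := l2_add_left μ v w φ
  map_smul' a v := by
    have e : a • v = (a : ℂ) • v := HsC.ext_apply fun x => by simp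
    rw [e, l2_smul_left]
    simp
  cont := by
    exact (continuous_integral_continuousMap μ).comp
      (HsC.continuous_toC.mul (continuous_const (y := star φ.toC)))

/-- The orthogonal projection as a continuous linear map. -/
def orthProjL (φ : HsC n M s) (hφ : l2 μ φ φ = 1) : HsC n M s →L[ℝ] orth μ φ where
  toFun := orthProj μ φ hφ
  map_add' v w := Subtype.ext <| by
    simp only [orthProj, l2_add_left, add_smul]
    exact add_sub_add_comm _ _ _ _
  map_smul' a v := Subtype.ext <| by
    have e : a • v = (a : ℂ) • v := HsC.ext_apply fun x => by simp
    have h : orthProj μ φ hφ (a • v) = (a : ℂ) • orthProj μ φ hφ v := Subtype.ext <| by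
      simp only [orthProj, e, l2_smul_left, mul_smul]
      exact (smul_sub _ _ _).symm
    rw [h]
    exact HsC.ext_apply fun x => by simp
  cont := Continuous.subtype_mk
    (continuous_id.sub ((l2L s μ φ).continuous.smul continuous_const)) _

end Model

end RealFunctions

/-! ### Logarithms of densities, wave functions and normalized densities. -/

section MadelungMap

variable {n : ℕ} {M : Type*} [TopologicalSpace M] [ChartedSpace (EuclideanSpace ℝ (Fin n)) M]
  [T2Space M] [CompactSpace M] [IsManifold (𝓡 n) ∞ M] {s : WithTop ℝ}
  [hs : Fact ((((n : ℝ) / 2 : ℝ) : WithTop ℝ) < s)]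

open HsC

/-- The logarithm of a positive function belongs to `H^s`. -/
theorem complexify_log_mem (ρ : HsR n M s) (hρ : ∀ x, 0 < ρ x) (f : C(M, ℝ))
    (hf : ∀ x, f x = Real.log (ρ x)) : complexify f ∈ sobolevSubmodule n M s := by
  refine mem_of_exp_mem (ψ := ρ.toHsC) fun x => ?_
  rw [HsR.toHsC_apply]
  simp only [complexify, LinearMap.coe_mk, AddHom.coe_mk, ContinuousMap.coe_mk]
  rw [← Complex.ofReal_exp, hf, Real.exp_log (hρ x)]

open Classical in
/-- The logarithm of a positive function, with junk value `0` otherwise. -/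
def logDensity (ρ : HsR n M s) : HsR n M s :=
  if hρ : ∀ x, 0 < ρ x then
    HsR.ofMem ⟨fun x => Real.log (ρ x), ρ.toC.continuous.log fun x => (hρ x).ne'⟩
      (complexify_log_mem ρ hρ _ fun _ => rfl)
  else 0

theorem logDensity_apply {ρ : HsR n M s} (hρ : ∀ x, 0 < ρ x) (x : M) :
    logDensity ρ x = Real.log (ρ x) := by
  rw [logDensity, dif_pos hρ]
  rfl

theorem exp_logDensity {ρ : HsR n M s} (hρ : ∀ x, 0 < ρ x) :
    exp (logDensity ρ).toHsC = ρ.toHsC := HsC.ext_apply fun x => by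
  rw [exp_apply, HsR.toHsC_apply, HsR.toHsC_apply, logDensity_apply hρ, ← Complex.ofReal_exp,
    Real.exp_log (hρ x)]

/-- All complex logarithms of a positive function have real part `log ρ`. The real logarithm is
therefore locally the real part of the smooth branch `logNear`. -/
theorem re_logNear_eq {ρ : HsR n M s} (hρ : ∀ x, 0 < ρ x) {u : HsC n M s}
    (h : ρ.toHsC ∈ logDomain u) : re n M s (logNear u ρ.toHsC) = logDensity ρ :=
  HsR.ext_apply fun x => by
    have h1 : Complex.exp (logNear u ρ.toHsC x) = (ρ x : ℂ) := by
      rw [← exp_apply, exp_logNear h, HsR.toHsC_apply]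
    have h2 := congrArg (fun z : ℂ => Real.log ‖z‖) h1
    simp only [Complex.norm_exp, Real.log_exp, Complex.norm_real, Real.norm_of_nonneg (hρ x).le]
      at h2
    rw [re_apply, logDensity_apply hρ, h2]

variable (n M s) in
/-- The positive functions. -/
def positive : Set (HsR n M s) := {ρ | ∀ x, 0 < ρ x}

theorem isOpen_positive : IsOpen (positive n M s) := HsR.isOpen_pos

/-- A neighbourhood of `ρ` on which `logNear (log ρ)` is defined. -/
def positiveNear (ρ : HsR n M s) : Set (HsR n M s) :=
  positive n M s ∩ HsR.toHsC ⁻¹' logDomain (logDensity ρ).toHsC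

theorem isOpen_positiveNear (ρ : HsR n M s) : IsOpen (positiveNear ρ) :=
  isOpen_positive.inter ((isOpen_logDomain _).preimage HsR.continuous_toHsC)

theorem mem_positiveNear {ρ : HsR n M s} (hρ : ρ ∈ positive n M s) : ρ ∈ positiveNear ρ :=
  ⟨hρ, by
    rw [mem_preimage, ← exp_logDensity hρ]
    exact exp_mem_logDomain _⟩

theorem strictContDiffOn_logDensity (k : ℕ) :
    StrictContDiffOn k (logDensity : HsR n M s → HsR n M s) (positive n M s) := by
  refine StrictContDiffOn.of_local fun ρ hρ => ⟨_, isOpen_positiveNear ρ, mem_positiveNear hρ, ?_⟩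
  have h1 : StrictContDiffOn k (fun ρ' : HsR n M s => logNear (logDensity ρ).toHsC ρ'.toHsC)
      (positiveNear ρ) :=
    ((strictContDiffOn_logNear k (logDensity ρ).toHsC).comp_linear (HsR.toHsCL n M s)).mono
      inter_subset_right
  exact (h1.linear_comp (re n M s) (isOpen_positiveNear ρ)).congr (isOpen_positiveNear ρ)
    fun ρ' h => re_logNear_eq h.1 h.2

theorem hasStrictDirDeriv_logDensity {ρ : HsR n M s} (hρ : ρ ∈ positive n M s) (v : HsR n M s) :
    HasStrictDirDeriv logDensity ρ v (re n M s (v.toHsC * exp (-(logDensity ρ).toHsC))) := by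
  have h1 := hasStrictDirDeriv_logNear (logDensity ρ).toHsC v.toHsC
  rw [exp_logDensity hρ] at h1
  have h2 : HasStrictDirDeriv (fun ρ' : HsR n M s => logNear (logDensity ρ).toHsC ρ'.toHsC) ρ v _ :=
    HasStrictDirDeriv.comp h1 (hasStrictDirDeriv_linear (HsR.toHsCL n M s) ρ v)
      HsR.continuous_toHsC.continuousAt
  exact (h2.linear_comp (re n M s)).congr (isOpen_positiveNear ρ) (mem_positiveNear hρ)
    fun ρ' h => re_logNear_eq h.1 h.2

theorem deriv_logDensity_apply {ρ : HsR n M s} (hρ : ρ ∈ positive n M s) (v : HsR n M s) (x : M) :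
    re n M s (v.toHsC * exp (-(logDensity ρ).toHsC)) x = v x / ρ x := by
  rw [re_apply, HsC.mul_apply, exp_apply, HsC.neg_apply, HsR.toHsC_apply, HsR.toHsC_apply,
    logDensity_apply hρ, ← Complex.ofReal_neg, ← Complex.ofReal_exp, ← Complex.ofReal_mul,
    Complex.ofReal_re, Real.exp_neg, Real.exp_log (hρ x), div_eq_mul_inv]

variable (n M s) in
/-- `(ℓ, θ) ↦ (ℓ + i θ) / 2`. -/
def halfLog : HsR n M s × HsR n M s →L[ℝ] HsC n M s :=
  smulL n M s (1 / 2) ∘L (HsR.toHsCL n M s ∘L ContinuousLinearMap.fst ℝ _ _ +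
    smulL n M s Complex.I ∘L HsR.toHsCL n M s ∘L ContinuousLinearMap.snd ℝ _ _)

theorem halfLog_apply (p : HsR n M s × HsR n M s) (x : M) :
    halfLog n M s p x = 1 / 2 * ((p.1 x : ℂ) + Complex.I * (p.2 x : ℂ)) := by
  change ((1 / 2 : ℂ) • (p.1.toHsC + Complex.I • p.2.toHsC)) x = _
  rw [HsC.smul_apply, HsC.add_apply, HsC.smul_apply, HsR.toHsC_apply, HsR.toHsC_apply]

/-- The wave function `√ρ e^{iθ/2}`. -/
def wave (p : HsR n M s × HsR n M s) : HsC n M s := exp (halfLog n M s (logDensity p.1, p.2))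

theorem wave_apply {ρ : HsR n M s} (hρ : ρ ∈ positive n M s) (θ : HsR n M s) (x : M) :
    wave (ρ, θ) x = madelung (ρ x) (θ x) := by
  rw [wave, exp_apply, halfLog_apply, logDensity_apply hρ, madelung, mul_add, Complex.exp_add]
  congr 1
  · rw [Real.sqrt_eq_rpow, Real.rpow_def_of_pos (hρ x), Complex.ofReal_exp]
    congr 1
    push_cast
    ring
  · congr 1
    ring

theorem strictContDiffOn_wave (k : ℕ) :
    StrictContDiffOn k (wave : HsR n M s × HsR n M s → HsC n M s) (positive n M s ×ˢ univ) := by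
  have hO : IsOpen (positive n M s ×ˢ (univ : Set (HsR n M s))) := isOpen_positive.prod isOpen_univ
  exact (strictContDiffOn_exp k univ).comp ((((strictContDiffOn_logDensity k).comp_fst).prodMk
    (strictContDiffOn_snd k _)).linear_comp (halfLog n M s) hO) hO (mapsTo_univ _ _)

theorem continuousAt_logDensity {ρ : HsR n M s} (hρ : ρ ∈ positive n M s) :
    ContinuousAt (logDensity : HsR n M s → HsR n M s) ρ :=
  (strictContDiffOn_logDensity 0).continuousOn.continuousAt (isOpen_positive.mem_nhds hρ)

theorem continuousAt_log_wave {ρ : HsR n M s} (hρ : ρ ∈ positive n M s) (θ : HsR n M s) :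
    ContinuousAt (fun p : HsR n M s × HsR n M s => halfLog n M s (logDensity p.1, p.2)) (ρ, θ) := by
  have h2 : Tendsto (fun p : HsR n M s × HsR n M s => logDensity p.1) (𝓝 (ρ, θ))
      (𝓝 (logDensity ρ)) :=
    (continuousAt_logDensity hρ).tendsto.comp (continuous_fst.tendsto (ρ, θ))
  have h3 := h2.prodMk_nhds (continuous_snd.tendsto (ρ, θ))
  exact ((halfLog n M s).continuous.tendsto _).comp h3

theorem hasStrictDirDeriv_log_wave {ρ : HsR n M s} (hρ : ρ ∈ positive n M s)
    (θ ρ₁ θ₁ : HsR n M s) :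
    HasStrictDirDeriv (fun p : HsR n M s × HsR n M s => halfLog n M s (logDensity p.1, p.2))
      (ρ, θ) (ρ₁, θ₁) (halfLog n M s
        (re n M s (ρ₁.toHsC * exp (-(logDensity ρ).toHsC)), θ₁)) := by
  have h1 : HasStrictDirDeriv (fun p : HsR n M s × HsR n M s => logDensity p.1) (ρ, θ) (ρ₁, θ₁)
      (re n M s (ρ₁.toHsC * exp (-(logDensity ρ).toHsC))) :=
    HasStrictDirDeriv.comp (f := logDensity) (g := fun p : HsR n M s × HsR n M s => p.1)
      (hasStrictDirDeriv_logDensity hρ ρ₁) (hasStrictDirDeriv_fst (ρ, θ) (ρ₁, θ₁)) continuousAt_fst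
  have h2 := h1.prodMk (hasStrictDirDeriv_snd (ρ, θ) (ρ₁, θ₁))
  exact HasStrictDirDeriv.linear_comp (halfLog n M s)
    (f := fun p : HsR n M s × HsR n M s => (logDensity p.1, p.2)) h2

theorem hasStrictDirDeriv_wave {ρ : HsR n M s} (hρ : ρ ∈ positive n M s) (θ ρ₁ θ₁ : HsR n M s) :
    HasStrictDirDeriv wave (ρ, θ) (ρ₁, θ₁) (wave (ρ, θ) * halfLog n M s
      (re n M s (ρ₁.toHsC * exp (-(logDensity ρ).toHsC)), θ₁)) :=
  HasStrictDirDeriv.comp (f := exp)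
    (g := fun p : HsR n M s × HsR n M s => halfLog n M s (logDensity p.1, p.2))
    (hasStrictDirDeriv_exp (halfLog n M s (logDensity ρ, θ)) _)
    (hasStrictDirDeriv_log_wave hρ θ ρ₁ θ₁) (continuousAt_log_wave hρ θ)

variable [MeasurableSpace M] [BorelSpace M] (μ : Measure M) [IsProbabilityMeasure μ]

/-- `|ψ|²` for `ψ = exp u`. -/
def normSqExp (u : HsC n M s) : HsC n M s := exp ((2 : ℝ) • (re n M s u).toHsC)

theorem normSqExp_apply (u : HsC n M s) (x : M) :
    normSqExp u x = ((Real.exp (2 * (u x).re) : ℝ) : ℂ) := by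
  rw [normSqExp, exp_apply, HsC.real_smul_apply, HsR.toHsC_apply, re_apply]
  push_cast
  rfl

theorem integral_exp_re_pos (u : HsC n M s) : 0 < ∫ x, Real.exp (2 * (u x).re) ∂μ := by
  have hc : Continuous fun x => Real.exp (2 * (u x).re) := by fun_prop
  refine MeasureTheory.integral_exp_pos (f := fun x => 2 * (u x).re) ?_
  exact integrable_continuousMap μ ⟨_, hc⟩

theorem l2_normSqExp_one (u : HsC n M s) :
    l2 μ (normSqExp u) 1 = ((∫ x, Real.exp (2 * (u x).re) ∂μ : ℝ) : ℂ) := by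
  rw [← integral_complex_ofReal]
  refine integral_congr_ae (Eventually.of_forall fun x => ?_)
  simp only [normSqExp_apply, HsC.one_apply, map_one, mul_one]

/-- The normalized density `|ψ|² / ∫ |ψ|²` for `ψ = exp u`. -/
def density (u : HsC n M s) : HsR n M s :=
  re n M s ((l2 μ (normSqExp u) 1)⁻¹ • normSqExp u)

theorem density_apply (u : HsC n M s) (x : M) :
    density μ u x = (∫ y, Real.exp (2 * (u y).re) ∂μ)⁻¹ * Real.exp (2 * (u x).re) := by
  rw [density, re_apply, HsC.smul_apply, l2_normSqExp_one, normSqExp_apply, ← Complex.ofReal_inv,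
    ← Complex.ofReal_mul, Complex.ofReal_re]

theorem density_pos (u : HsC n M s) : density μ u ∈ positive n M s := fun x => by
  rw [density_apply]
  have := integral_exp_re_pos μ u
  positivity

/-- The normalized density as a point of `Dens^s(M)`. -/
def densityPoint (u : HsC n M s) : Dens n s μ :=
  ⟨density μ u, density_pos μ u, by
    simp_rw [density_apply]
    rw [integral_const_mul, inv_mul_cancel₀ (integral_exp_re_pos μ u).ne']⟩

/-- The density is composed of exponential, integration, inversion in `ℂ` and scalar multiplication;
the integral of a positive function never meets the singularity of the inversion. -/
theorem strictContDiffOn_density (k : ℕ) :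
    StrictContDiffOn k (density μ : HsC n M s → HsR n M s) univ := by
  have h1 : StrictContDiffOn k (normSqExp : HsC n M s → HsC n M s) univ :=
    (strictContDiffOn_exp k univ).comp (strictContDiffOn_linear k
      ((2 : ℝ) • (HsR.toHsCL n M s ∘L re n M s)) univ) isOpen_univ (mapsTo_univ _ _)
  have h2 : StrictContDiffOn k (fun u : HsC n M s => (l2 μ (normSqExp u) 1)⁻¹) univ :=
    (strictContDiffOn_inv k).comp (h1.linear_comp (l2L s μ 1) isOpen_univ) isOpen_univ
      fun u _ => by
        change l2 μ (normSqExp u) 1 ≠ 0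
        rw [l2_normSqExp_one]
        exact_mod_cast (integral_exp_re_pos μ u).ne'
  exact (strictContDiffOn_smul h2 h1 isOpen_univ).linear_comp (re n M s) isOpen_univ

end MadelungMap

/-! ### The Madelung transform as a homeomorphism onto its image. -/

section MadelungHomeomorph

variable {n : ℕ} {M : Type*} [TopologicalSpace M] [ChartedSpace (EuclideanSpace ℝ (Fin n)) M]
  [T2Space M] [CompactSpace M] [IsManifold (𝓡 n) ∞ M] {s : WithTop ℝ}
  [hs : Fact ((((n : ℝ) / 2 : ℝ) : WithTop ℝ) < s)]

open HsC

theorem isQuotientMap_projectivization_mk {K V : Type*} [DivisionRing K] [AddCommGroup V]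
    [Module K V] [TopologicalSpace V] :
    IsQuotientMap fun v : {v : V // v ≠ 0} => Projectivization.mk K v.1 v.2 :=
  isQuotientMap_quotient_mk'

/-- Two continuous functions with proportional exponentials differ by a constant. -/
theorem exists_eq_add_const_of_exp_eq_mul {X : Type*} [TopologicalSpace X] [ConnectedSpace X]
    {f g : X → ℂ} (hf : Continuous f) (hg : Continuous g) (a : ℂ)
    (h : ∀ x, Complex.exp (f x) = a * Complex.exp (g x)) : ∃ c : ℂ, ∀ x, f x = g x + c := by
  obtain ⟨x₀⟩ : Nonempty X := inferInstance
  refine ⟨f x₀ - g x₀, fun x => ?_⟩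
  have h0 : a = Complex.exp (f x₀ - g x₀) := by
    rw [Complex.exp_sub, h x₀, mul_div_assoc, div_self (Complex.exp_ne_zero _), mul_one]
  -- Both functions lift the same map through the covering `exp` and agree at `x₀`, so they agree on
  -- the connected space.
  refine congrFun (Complex.isCoveringMap_exp.eq_of_comp_eq hf (hg.add_const (f x₀ - g x₀)) ?_ x₀
    (by ring)) x
  funext y
  apply Subtype.ext
  simp only [Function.comp_apply]
  rw [h y, h0, Complex.exp_add, mul_comm]

theorem wave_mul_conj {ρ : HsR n M s} (hρ : ρ ∈ positive n M s) (θ : HsR n M s) (x : M) :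
    wave (ρ, θ) x * (starRingEnd ℂ) (wave (ρ, θ) x) = (ρ x : ℂ) := by
  rw [wave_apply hρ, madelung, Complex.mul_conj, map_mul, Complex.normSq_ofReal,
    Real.mul_self_sqrt (hρ x).le, Complex.normSq_eq_norm_sq, Complex.norm_exp]
  simp

section Ray

variable [Nonempty M]

theorem exp_ne_zero (u : HsC n M s) : exp u ≠ 0 := fun h => by
  obtain ⟨x⟩ : Nonempty M := inferInstance
  have : exp u x = 0 := by rw [h, HsC.zero_apply]
  exact Complex.exp_ne_zero _ this

/-- The class of `exp u`. -/
def ray (u : HsC n M s) : ℙ ℂ (HsC n M s) := Projectivization.mk ℂ (exp u) (exp_ne_zero u)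

theorem ray_eq_mk_iff {u ψ : HsC n M s} (hψ : ψ ≠ 0) :
    ray u = Projectivization.mk ℂ ψ hψ ↔ ∃ a : ℂ, ∀ x, Complex.exp (u x) = a * ψ x := by
  rw [ray, Projectivization.mk_eq_mk_iff']
  refine exists_congr fun a => ⟨fun h x => ?_, fun h => HsC.ext_apply fun x => ?_⟩
  · rw [← HsC.smul_apply, h, exp_apply]
  · rw [HsC.smul_apply, exp_apply, h]

theorem ray_congr {u u' : HsC n M s} {c : ℂ} (h : ∀ x, u x = u' x + c) : ray u = ray u' :=
  (ray_eq_mk_iff _).mpr ⟨Complex.exp c, fun x => by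
    rw [h, Complex.exp_add, exp_apply, mul_comm]⟩

/-- The proportionality factor is nonzero, so its logarithm can be absorbed into `u`: having a
logarithm depends only on the class. -/
theorem mk_mem_range_ray_iff {ψ : HsC n M s} (hψ : ψ ≠ 0) :
    Projectivization.mk ℂ ψ hψ ∈ range (ray : HsC n M s → _) ↔ ∃ u, exp u = ψ := by
  constructor
  · rintro ⟨u, hu⟩
    obtain ⟨a, ha⟩ := (ray_eq_mk_iff hψ).mp hu
    have ha0 : a ≠ 0 := by
      rintro rfl
      obtain ⟨x⟩ : Nonempty M := inferInstance
      exact Complex.exp_ne_zero (u x) (by rw [ha, zero_mul])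
    refine ⟨u - Complex.log a • 1, HsC.ext_apply fun x => ?_⟩
    rw [exp_apply, HsC.sub_apply, HsC.smul_apply, HsC.one_apply, mul_one, Complex.exp_sub,
      Complex.exp_log ha0, ha, mul_div_cancel_left₀ _ ha0]
  · rintro ⟨u, rfl⟩
    exact ⟨u, rfl⟩

/-- A merely continuous logarithm suffices, since by `mem_of_exp_mem` it is automatically of class
`H^s`. -/
theorem exists_exp_eq_rep {L : ℙ ℂ (HsC n M s)} (w : C(M, ℂ))
    (h : ∀ x, L.rep x = Complex.exp (w x)) : L ∈ range (ray : HsC n M s → _) := by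
  rw [← L.mk_rep, mk_mem_range_ray_iff]
  exact ⟨HsC.ofMem w (mem_of_exp_mem h), HsC.ext_apply fun x => (h x).symm⟩

/-- The imaginary part of a logarithm is a phase; conversely `log |ψ| + iα` is a continuous
logarithm. -/
theorem range_ray : range (ray : HsC n M s → _) = withPhase n M s := by
  ext L
  constructor
  · intro hL
    rw [← L.mk_rep, mk_mem_range_ray_iff] at hL
    obtain ⟨u, hu⟩ := hL
    have hu' : ∀ x, L.rep x = Complex.exp (u x) := fun x => by rw [← hu, exp_apply]
    refine ⟨fun x => by rw [hu']; exact Complex.exp_ne_zero _, (im n M s u).toC, fun x => ?_⟩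
    rw [hu', Complex.norm_exp, im_apply, Complex.ofReal_exp, ← Complex.exp_add]
    congr 1
    rw [mul_comm, Complex.re_add_im]
  · rintro ⟨h0, α, hα⟩
    refine exists_exp_eq_rep ⟨fun x => (Real.log ‖L.rep x‖ : ℂ) + Complex.I * (α x : ℂ), ?_⟩ ?_
    · have : Continuous fun x => Real.log ‖L.rep x‖ :=
        Continuous.log (by fun_prop) fun x => norm_ne_zero_iff.mpr (h0 x)
      fun_prop
    · intro x
      change _ = Complex.exp ((Real.log ‖L.rep x‖ : ℂ) + Complex.I * (α x : ℂ))
      rw [Complex.exp_add, ← Complex.ofReal_exp, Real.exp_log (norm_pos_iff.mpr (h0 x))]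
      exact hα x

/-- A nowhere vanishing function on a simply connected manifold, which is locally path connected,
lifts through the covering `exp`. -/
theorem withPhase_eq_nonvanishing [SimplyConnectedSpace M] :
    withPhase n M s = nonvanishing n M s := by
  refine Subset.antisymm (fun L h => h.1) fun L hL => ?_
  rw [← range_ray]
  have := ChartedSpace.locallyPathConnectedSpace (EuclideanSpace ℝ (Fin n)) M
  obtain ⟨x₀⟩ : Nonempty M := inferInstance
  obtain ⟨w, ⟨-, hw⟩, -⟩ := Complex.isCoveringMapOn_exp.existsUnique_continuousMap_lifts
    L.rep.toC (Complex.exp_log (hL x₀)) hL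
  exact exists_exp_eq_rep w fun x => (congrFun hw x).symm

/-- Wave functions close to `exp u` have the logarithm given by `logNear u`, and openness may be
checked before passing to the quotient. -/
theorem isOpen_range_ray : IsOpen (range (ray : HsC n M s → _)) := by
  rw [← isQuotientMap_projectivization_mk.isOpen_preimage, isOpen_iff_mem_nhds]
  rintro ⟨ψ, hψ⟩ h
  obtain ⟨u, rfl⟩ := (mk_mem_range_ray_iff hψ).mp h
  filter_upwards [((isOpen_logDomain u).preimage continuous_subtype_val).mem_nhds
    (exp_mem_logDomain u)] with ψ' h'
  exact (mk_mem_range_ray_iff ψ'.2).mpr ⟨_, exp_logNear h'⟩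

theorem continuous_ray : Continuous (ray : HsC n M s → _) :=
  isQuotientMap_projectivization_mk.continuous.comp (continuous_exp.subtype_mk exp_ne_zero)

end Ray

variable [MeasurableSpace M] [BorelSpace M] (μ : Measure M) [IsProbabilityMeasure μ]

/-- The logarithm `(log ρ + i θ) / 2` of the Madelung transform of `(ρ, [θ])`, where `∫ θ = 0`. -/
def logMadelung (p : CotDens n s μ) : HsC n M s :=
  halfLog n M s (logDensity p.1.1, meanZeroRep μ p.2)

theorem continuous_logMadelung : Continuous (logMadelung (n := n) (s := s) μ) := by
  have h : Continuous fun ρ : Dens n s μ => logDensity ρ.1 := by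
    rw [continuous_iff_continuousAt]
    intro ρ
    exact (continuousAt_logDensity ρ.2.1).tendsto.comp (continuous_subtype_val.tendsto ρ)
  exact (halfLog n M s).continuous.comp
    ((h.comp continuous_fst).prodMk ((meanZeroRep μ).continuous.comp continuous_snd))

theorem logMadelung_re (p : CotDens n s μ) (x : M) :
    2 * (logMadelung μ p x).re = Real.log (p.1.1 x) := by
  rw [logMadelung, halfLog_apply, logDensity_apply p.1.2.1]
  simp

theorem logMadelung_im (p : CotDens n s μ) (x : M) :
    2 * (logMadelung μ p x).im = meanZeroRep μ p.2 x := by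
  rw [logMadelung, halfLog_apply]
  simp

/-- The point `(|ψ|² / ∫ |ψ|², [2 arg ψ])` for `ψ = exp u`. -/
def polar (u : HsC n M s) : CotDens n s μ :=
  (densityPoint μ u, Submodule.Quotient.mk ((2 : ℝ) • im n M s u))

/-- The real part of the constant rescales `|ψ|²`, which normalization undoes; the imaginary part
shifts the phase, which the quotient by constants forgets. -/
theorem polar_congr {u u' : HsC n M s} {c : ℂ} (h : ∀ x, u x = u' x + c) :
    polar μ u = polar μ u' := by
  refine Prod.ext (Subtype.ext (HsR.ext_apply fun x => ?_)) ?_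
  · change density μ u x = density μ u' x
    simp_rw [density_apply, h, Complex.add_re, mul_add, Real.exp_add]
    rw [integral_mul_const]
    have := integral_exp_re_pos μ u'
    have := Real.exp_pos (2 * c.re)
    field_simp
  · refine (Submodule.Quotient.eq _).mpr ⟨2 * c.im, fun x => ?_⟩
    rw [HsR.sub_apply, HsR.smul_apply, HsR.smul_apply, im_apply, im_apply, h, Complex.add_im]
    ring

theorem polar_logMadelung (p : CotDens n s μ) : polar μ (logMadelung μ p) = p := by
  refine Prod.ext (Subtype.ext (HsR.ext_apply fun x => ?_)) ?_
  · change density μ (logMadelung μ p) x = p.1.1 x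
    simp_rw [density_apply, logMadelung_re, Real.exp_log (p.1.2.1 _)]
    rw [p.1.2.2, inv_one, one_mul]
  · refine Eq.trans ?_ (mk_meanZeroRep μ p.2)
    refine congrArg _ (HsR.ext_apply fun x => ?_)
    rw [HsR.smul_apply, im_apply, logMadelung_im]

theorem exists_logMadelung_polar (u : HsC n M s) :
    ∃ c : ℂ, ∀ x, logMadelung μ (polar μ u) x = u x + c := by
  -- The real part accounts for normalizing the density, the imaginary part for subtracting the mean
  -- of the phase.
  refine ⟨⟨-Real.log (∫ y, Real.exp (2 * (u y).re) ∂μ) / 2,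
    -(∫ y, ((2 : ℝ) • im n M s u) y ∂μ) / 2⟩, fun x => Complex.ext ?_ ?_⟩
  · have h := logMadelung_re μ (polar μ u) x
    change _ = Real.log (density μ u x) at h
    rw [density_apply, Real.log_mul (inv_ne_zero (integral_exp_re_pos μ u).ne')
      (Real.exp_pos _).ne', Real.log_inv, Real.log_exp] at h
    rw [Complex.add_re]
    linarith
  · have h := logMadelung_im μ (polar μ u) x
    rw [polar, meanZeroRep_mk_apply, HsR.smul_apply, im_apply] at h
    rw [Complex.add_im]
    change (logMadelung μ (polar μ u) x).im = _
    rw [polar]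
    linarith

theorem continuous_polar : Continuous (polar μ : HsC n M s → CotDens n s μ) := by
  refine Continuous.prodMk (Continuous.subtype_mk ?_ _) ?_
  · exact continuousOn_univ.mp (strictContDiffOn_density μ 0).continuousOn
  · exact (cosetL n M s).continuous.comp ((im n M s).continuous.const_smul (2 : ℝ))

section Homeomorph

variable [ConnectedSpace M]

/-- Injectivity modulo constants: connectedness forces logarithms of proportional wave functions to
differ by a constant. -/
theorem polar_eq_of_ray_eq {u u' : HsC n M s} (h : ray u = ray u') : polar μ u = polar μ u' := by
  obtain ⟨a, ha⟩ := (ray_eq_mk_iff _).mp h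
  obtain ⟨c, hc⟩ := exists_eq_add_const_of_exp_eq_mul (f := u) (g := u')
    (by fun_prop) (by fun_prop) a ha
  exact polar_congr μ hc

open Classical in
/-- The inverse Madelung transform, with a junk value outside the image. -/
def inverseMadelung (L : ℙ ℂ (HsC n M s)) : CotDens n s μ :=
  if h : ∃ u, ray u = L then polar μ h.choose else polar μ 0

theorem inverseMadelung_ray (u : HsC n M s) : inverseMadelung μ (ray u) = polar μ u := by
  have h : ∃ u', ray u' = ray u := ⟨u, rfl⟩
  rw [inverseMadelung, dif_pos h]
  exact polar_eq_of_ray_eq μ h.choose_spec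

theorem inverseMadelung_mk {u ψ : HsC n M s} (hψ : ψ ≠ 0) (h : exp u = ψ) :
    inverseMadelung μ (Projectivization.mk ℂ ψ hψ) = polar μ u := by
  subst h
  exact inverseMadelung_ray μ u

/-- Near `[exp u]` the inverse is `polar ∘ logNear u`, a continuous expression on wave functions
that descends along the quotient map. -/
theorem continuousOn_inverseMadelung :
    ContinuousOn (inverseMadelung μ) (range (ray : HsC n M s → _)) := by
  rw [continuousOn_open_iff isOpen_range_ray]
  intro t ht
  rw [← isQuotientMap_projectivization_mk.isOpen_preimage, isOpen_iff_mem_nhds]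
  rintro ⟨ψ, hψ⟩ ⟨h, h'⟩
  obtain ⟨u, rfl⟩ := (mk_mem_range_ray_iff hψ).mp h
  have hc : ContinuousAt (fun ψ : {ψ : HsC n M s // ψ ≠ 0} => polar μ (logNear u ψ.1))
      ⟨exp u, hψ⟩ :=
    ((continuous_polar μ).tendsto _).comp
      (((continuousOn_logNear u).continuousAt ((isOpen_logDomain u).mem_nhds
        (exp_mem_logDomain u))).tendsto.comp (continuous_subtype_val.tendsto ⟨exp u, hψ⟩))
  have e : polar μ (logNear u (exp u)) ∈ t := by
    rw [← inverseMadelung_mk μ hψ (exp_logNear (exp_mem_logDomain u))]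
    exact h'
  filter_upwards [((isOpen_logDomain u).preimage continuous_subtype_val).mem_nhds
    (exp_mem_logDomain u), hc.preimage_mem_nhds (ht.mem_nhds e)] with ψ' h1 h2
  refine ⟨(mk_mem_range_ray_iff ψ'.2).mpr ⟨_, exp_logNear h1⟩, ?_⟩
  rw [mem_preimage, inverseMadelung_mk μ ψ'.2 (exp_logNear h1)]
  exact h2

variable (n s) in
/-- The Madelung transform. -/
def madelungTransform : OpenPartialHomeomorph (CotDens n s μ) (ℙ ℂ (HsC n M s)) where
  toFun p := ray (logMadelung μ p)
  invFun := inverseMadelung μ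
  source := univ
  target := range ray
  map_source' p _ := ⟨_, rfl⟩
  map_target' _ _ := mem_univ _
  left_inv' p _ := by rw [inverseMadelung_ray, polar_logMadelung]
  right_inv' := by
    rintro _ ⟨u, rfl⟩
    rw [inverseMadelung_ray]
    obtain ⟨c, hc⟩ := exists_logMadelung_polar μ u
    exact ray_congr hc
  open_source := isOpen_univ
  open_target := isOpen_range_ray
  continuousOn_toFun := (continuous_ray.comp (continuous_logMadelung μ)).continuousOn
  continuousOn_invFun := continuousOn_inverseMadelung μ

/-- Passing from `θ` to its mean-zero representative multiplies the wave function by a constant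
phase. -/
theorem ray_eq_mk_wave (ρ : Dens n s μ) (θ : HsR n M s) (hψ : wave (ρ.1, θ) ≠ 0) :
    ray (logMadelung μ (ρ, Submodule.Quotient.mk θ)) = Projectivization.mk ℂ (wave (ρ.1, θ)) hψ := by
  refine ray_congr (u' := halfLog n M s (logDensity ρ.1, θ))
    (c := -(1 / 2 * (Complex.I * (∫ y, θ y ∂μ : ℝ)))) fun x => ?_
  rw [logMadelung, halfLog_apply, halfLog_apply]
  change 1 / 2 * ((logDensity ρ.1 x : ℂ) + Complex.I * ((θ x - ∫ y, θ y ∂μ : ℝ) : ℂ)) = _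
  push_cast
  ring

theorem l2_wave (ρ : Dens n s μ) (θ : HsR n M s) : l2 μ (wave (ρ.1, θ)) (wave (ρ.1, θ)) = 1 := by
  simp_rw [l2, wave_mul_conj ρ.2.1]
  rw [integral_complex_ofReal, ρ.2.2, Complex.ofReal_one]

end Homeomorph

end MadelungHomeomorph

/-! ### Smoothness of the transform and of its inverse in charts. -/

section SmoothnessInCharts

variable {n : ℕ} {M : Type*} [TopologicalSpace M] [ChartedSpace (EuclideanSpace ℝ (Fin n)) M]
  [T2Space M] [CompactSpace M] [IsManifold (𝓡 n) ∞ M] {s : WithTop ℝ}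
  [hs : Fact ((((n : ℝ) / 2 : ℝ) : WithTop ℝ) < s)]
  [MeasurableSpace M] [BorelSpace M] (μ : Measure M) [IsProbabilityMeasure μ]

open HsC

/-- `ψ / ⟨ψ, φ⟩` is homogeneous of degree zero, so the chosen representative of the class is
irrelevant. -/
theorem projChart_mk (φ : HsC n M s) (hφ : l2 μ φ φ = 1) {ψ : HsC n M s} (hψ : ψ ≠ 0) :
    projChart μ φ hφ (Projectivization.mk ℂ ψ hψ) = orthProj μ φ hφ ((l2 μ ψ φ)⁻¹ • ψ) := by
  obtain ⟨a, ha⟩ := Projectivization.exists_smul_eq_mk_rep ℂ ψ hψ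
  have ha0 : (a : ℂ) ≠ 0 := a.ne_zero
  change orthProj μ φ hφ ((l2 μ (Projectivization.mk ℂ ψ hψ).rep φ)⁻¹ •
    (Projectivization.mk ℂ ψ hψ).rep) = _
  rw [← ha, Units.smul_def, l2_smul_left, smul_smul, mul_inv, mul_right_comm,
    inv_mul_cancel₀ ha0, one_mul]

theorem mk_mem_projChart_source (φ : HsC n M s) (hφ : l2 μ φ φ = 1) {ψ : HsC n M s} (hψ : ψ ≠ 0) :
    Projectivization.mk ℂ ψ hψ ∈ (projChart μ φ hφ).source ↔ l2 μ ψ φ ≠ 0 := by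
  obtain ⟨a, ha⟩ := Projectivization.exists_smul_eq_mk_rep ℂ ψ hψ
  have ha0 : (a : ℂ) ≠ 0 := a.ne_zero
  change l2 μ (Projectivization.mk ℂ ψ hψ).rep φ ≠ 0 ↔ _
  rw [← ha, Units.smul_def, l2_smul_left]
  simp [ha0]

/-- The inclusion of the orthogonal complement as a continuous real linear map. -/
def orthIncl (φ : HsC n M s) : orth μ φ →L[ℝ] HsC n M s where
  toFun v := v.1
  map_add' _ _ := rfl
  map_smul' _ _ := rfl
  cont := continuous_subtype_val

variable (n s) in
/-- `(a, [θ]) ↦ (a, θ)`, where `θ` has mean zero. -/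
def modelIncl : CotModel n s μ →L[ℝ] HsR n M s × HsR n M s :=
  ((HsZero n s μ).subtypeL).prodMap (meanZeroRep μ)

/-- The Madelung transform in the chart of `T*Dens^s(M)` with origin `ρ₀`, as a wave function. -/
def chartWave (ρ₀ : HsR n M s) (q : CotModel n s μ) : HsC n M s :=
  wave ((ρ₀, 0) + modelIncl n s μ q)

theorem chartWave_eq (ρ₀ : HsR n M s) (q : CotModel n s μ) :
    chartWave μ ρ₀ q = wave (ρ₀ + q.1.1, meanZeroRep μ q.2) :=
  congrArg wave (Prod.ext rfl (zero_add _))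

theorem isOpen_cotChart_target (ρ₀ : Dens n s μ) : IsOpen (cotChart ρ₀).target := by
  have h : Continuous fun q : CotModel n s μ => ρ₀.1 + q.1.1 := by fun_prop
  exact isOpen_positive.preimage h

theorem strictContDiffOn_chartWave (k : ℕ) (ρ₀ : Dens n s μ) :
    StrictContDiffOn k (chartWave μ ρ₀.1) (cotChart ρ₀).target := by
  have hO := isOpen_cotChart_target μ ρ₀
  exact (strictContDiffOn_wave k).comp ((strictContDiffOn_const k (ρ₀.1, 0) _).add
    (strictContDiffOn_linear k (modelIncl n s μ) _) hO) hO fun q hq => ⟨hq, mem_univ _⟩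

variable [ConnectedSpace M]

theorem chartWave_ne_zero (ρ₀ : HsR n M s) (q : CotModel n s μ) : chartWave μ ρ₀ q ≠ 0 :=
  exp_ne_zero _

theorem madelungTransform_cotChart_symm (ρ₀ : Dens n s μ) {q : CotModel n s μ}
    (hq : q ∈ (cotChart ρ₀).target) :
    madelungTransform n s μ ((cotChart ρ₀).symm q) =
      Projectivization.mk ℂ (chartWave μ ρ₀.1 q) (chartWave_ne_zero μ ρ₀.1 q) := by
  -- Reading the first component off the right-inverse law avoids the case distinction in the
  -- inverse chart.
  have h1 : ((cotChart ρ₀).symm q).1.1 = ρ₀.1 + q.1.1 := by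
    have := congrArg (fun q : CotModel n s μ => ρ₀.1 + q.1.1) ((cotChart ρ₀).right_inv hq)
    change ρ₀.1 + (((cotChart ρ₀).symm q).1.1 - ρ₀.1) = _ at this
    rwa [add_sub_cancel] at this
  have h2 : wave (((cotChart ρ₀).symm q).1.1, meanZeroRep μ q.2) = chartWave μ ρ₀.1 q := by
    rw [h1, chartWave_eq]
  refine (ray_eq_mk_iff _).mpr ⟨1, fun x => ?_⟩
  rw [one_mul, ← h2]
  rfl

theorem chart_madelungTransform (ρ₀ : Dens n s μ) (φ : HsC n M s) (hφ : l2 μ φ φ = 1)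
    {q : CotModel n s μ} (hq : q ∈ (cotChart ρ₀).target) :
    projChart μ φ hφ (madelungTransform n s μ ((cotChart ρ₀).symm q)) =
      orthProjL μ φ hφ ((l2 μ (chartWave μ ρ₀.1 q) φ)⁻¹ • chartWave μ ρ₀.1 q) := by
  rw [madelungTransform_cotChart_symm μ ρ₀ hq, projChart_mk]
  rfl

/-- The domain of the Madelung transform, read in charts. -/
def chartDomain (ρ₀ : Dens n s μ) (φ : HsC n M s) : Set (CotModel n s μ) :=
  (cotChart ρ₀).target ∩ (fun q => l2 μ (chartWave μ ρ₀.1 q) φ) ⁻¹' {z | z ≠ 0}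

theorem strictContDiffOn_l2_chartWave (k : ℕ) (ρ₀ : Dens n s μ) (φ : HsC n M s) :
    StrictContDiffOn k (fun q => l2 μ (chartWave μ ρ₀.1 q) φ) (cotChart ρ₀).target :=
  (strictContDiffOn_chartWave μ k ρ₀).linear_comp (l2L s μ φ) (isOpen_cotChart_target μ ρ₀)

theorem isOpen_chartDomain (ρ₀ : Dens n s μ) (φ : HsC n M s) : IsOpen (chartDomain μ ρ₀ φ) :=
  (strictContDiffOn_l2_chartWave μ 0 ρ₀ φ).continuousOn.isOpen_inter_preimage
    (isOpen_cotChart_target μ ρ₀) isOpen_ne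

theorem strictContDiffOn_chartWave_normalized (k : ℕ) (ρ₀ : Dens n s μ) (φ : HsC n M s) :
    StrictContDiffOn k (fun q => (l2 μ (chartWave μ ρ₀.1 q) φ)⁻¹ • chartWave μ ρ₀.1 q)
      (chartDomain μ ρ₀ φ) := by
  have hO := isOpen_chartDomain μ ρ₀ φ
  exact strictContDiffOn_smul ((strictContDiffOn_inv k).comp
    ((strictContDiffOn_l2_chartWave μ k ρ₀ φ).mono inter_subset_left) hO fun q hq => hq.2)
    ((strictContDiffOn_chartWave μ k ρ₀).mono inter_subset_left) hO

theorem smoothInCharts_madelungTransform (ρ₀ : Dens n s μ) (φ : HsC n M s) (hφ : l2 μ φ φ = 1) :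
    SmoothInCharts (cotChart ρ₀) (projChart μ φ hφ) (madelungTransform n s μ)
      (madelungTransform n s μ).source := by
  intro k
  have h := ((strictContDiffOn_chartWave_normalized μ k ρ₀ φ).linear_comp (orthProjL μ φ hφ)
    (isOpen_chartDomain μ ρ₀ φ)).congr (isOpen_chartDomain μ ρ₀ φ)
    fun q hq => (chart_madelungTransform μ ρ₀ φ hφ hq.1).symm
  refine (h.mono ?_).contDiffOnTVS
  rintro q ⟨hq, -, hq'⟩
  rw [madelungTransform_cotChart_symm μ ρ₀ hq, mk_mem_projChart_source] at hq'
  exact ⟨hq, hq'⟩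

/-- The inverse Madelung transform in charts, as a function of the logarithm of the wave
function. -/
def chartPolar (ρ₀ : HsR n M s) (u : HsC n M s) : CotModel n s μ :=
  (meanZero n s μ (density μ u - ρ₀), cosetL n M s ((2 : ℝ) • im n M s u))

/-- Two probability densities differ by a function of integral zero, so the projection built into
`chartPolar` changes nothing; it only makes that map globally defined. -/
theorem cotChart_polar (ρ₀ : Dens n s μ) (u : HsC n M s) :
    cotChart ρ₀ (polar μ u) = chartPolar μ ρ₀.1 u := by
  refine Prod.ext (Subtype.ext ?_) rfl
  have h : ∫ x, (density μ u - ρ₀.1) x ∂μ = 0 := by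
    have := map_sub (HsR.integral n s μ) (density μ u) ρ₀.1
    have h1 : HsR.integral n s μ (density μ u) = 1 := (densityPoint μ u).2.2
    have h2 : HsR.integral n s μ ρ₀.1 = 1 := ρ₀.2.2
    rw [h1, h2, sub_self] at this
    exact this
  change density μ u - ρ₀.1 = density μ u - ρ₀.1 - HsR.const (∫ x, (density μ u - ρ₀.1) x ∂μ)
  rw [h]
  exact HsR.ext_apply fun x => by
    rw [HsR.sub_apply (density μ u - ρ₀.1), HsR.const_apply, sub_zero]

theorem strictContDiffOn_chartPolar (k : ℕ) (ρ₀ : HsR n M s) :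
    StrictContDiffOn k (chartPolar μ ρ₀) univ :=
  ((((strictContDiffOn_density μ k).sub (strictContDiffOn_const k ρ₀ _) isOpen_univ).linear_comp
    (meanZero n s μ) isOpen_univ)).prodMk
    (strictContDiffOn_linear k (cosetL n M s ∘L ((2 : ℝ) • im n M s)) univ)

/-- No global logarithm is chosen: around each point the inverse is `chartPolar ∘ logNear u` applied
to `φ + w`, and being of class `C^k` is local. -/
theorem smoothInCharts_madelungTransform_symm (ρ₀ : Dens n s μ) (φ : HsC n M s)
    (hφ : l2 μ φ φ = 1) :
    SmoothInCharts (projChart μ φ hφ) (cotChart ρ₀) (madelungTransform n s μ).symm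
      (madelungTransform n s μ).target := by
  intro k
  have := t2Space_coset (n := n) (s := s) μ
  refine StrictContDiffOn.contDiffOnTVS (StrictContDiffOn.of_local ?_)
  rintro w ⟨-, hw, -⟩
  obtain ⟨u, hu⟩ := (mk_mem_range_ray_iff _).mp hw
  have hc : Continuous fun w : orth μ φ => φ + w.1 := by fun_prop
  have hO : IsOpen ((fun w : orth μ φ => φ + w.1) ⁻¹' logDomain u) :=
    (isOpen_logDomain u).preimage hc
  refine ⟨_, hO, ?_, ?_⟩
  · rw [mem_preimage, ← hu]
    exact exp_mem_logDomain u
  · have h1 : StrictContDiffOn k (fun w : orth μ φ => φ + w.1)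
        ((fun w : orth μ φ => φ + w.1) ⁻¹' logDomain u) :=
      (strictContDiffOn_const k φ _).add (strictContDiffOn_linear k (orthIncl μ φ) _) hO
    have h2 := (strictContDiffOn_chartPolar μ k ρ₀.1).comp
      ((strictContDiffOn_logNear k u).comp h1 hO fun w hw => hw) hO (mapsTo_univ _ _)
    refine h2.congr hO fun w' hw' => ?_
    change chartPolar μ ρ₀.1 (logNear u (φ + w'.1)) =
      cotChart ρ₀ (inverseMadelung μ (Projectivization.mk ℂ (φ + w'.1) _))
    rw [inverseMadelung_mk μ _ (exp_logNear hw'), cotChart_polar]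

end SmoothnessInCharts

/-! ### Horizontal lifts and the comparison of the two metrics. -/

section Metric

variable {n : ℕ} {M : Type*} [TopologicalSpace M] [ChartedSpace (EuclideanSpace ℝ (Fin n)) M]
  [T2Space M] [CompactSpace M] [IsManifold (𝓡 n) ∞ M] {s : WithTop ℝ}
  [hs : Fact ((((n : ℝ) / 2 : ℝ) : WithTop ℝ) < s)]
  [MeasurableSpace M] [BorelSpace M] (μ : Measure M) [IsProbabilityMeasure μ]

open HsC

/-- The horizontal tangent vector `ψ (ρ₁ / ρ + i θ₁) / 2`. -/
def horizontalLift (ψ : HsC n M s) (ρ ρ₁ θ₁ : HsR n M s) : HsC n M s :=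
  ψ * halfLog n M s (re n M s (ρ₁.toHsC * exp (-(logDensity ρ).toHsC)), θ₁)

theorem horizontalLift_apply (ψ : HsC n M s) {ρ : HsR n M s} (hρ : ρ ∈ positive n M s)
    (ρ₁ θ₁ : HsR n M s) (x : M) :
    horizontalLift ψ ρ ρ₁ θ₁ x =
      ψ x * (1 / 2 * (((ρ₁ x / ρ x : ℝ) : ℂ) + Complex.I * (θ₁ x : ℂ))) := by
  rw [horizontalLift, HsC.mul_apply, halfLog_apply, deriv_logDensity_apply hρ]

/-- Since `|ψ|² = ρ`, the product is `(∫ ρ₁ + i ∫ θ₁ρ) / 2`. Preservation of mass kills the first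
integral, the normalization of `θ₁` the second. -/
theorem l2_horizontalLift_self {ψ : HsC n M s} {ρ : HsR n M s} (hρ : ρ ∈ positive n M s)
    (hψ : ∀ x, ψ x * (starRingEnd ℂ) (ψ x) = (ρ x : ℂ)) {ρ₁ θ₁ : HsR n M s}
    (h₁ : ∫ x, ρ₁ x ∂μ = 0) (h₂ : ∫ x, θ₁ x * ρ x ∂μ = 0) :
    l2 μ (horizontalLift ψ ρ ρ₁ θ₁) ψ = 0 := by
  have e : ∀ x, horizontalLift ψ ρ ρ₁ θ₁ x * (starRingEnd ℂ) (ψ x) =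
      (1 / 2 : ℂ) * (ρ₁ x : ℂ) + (Complex.I / 2) * ((θ₁ x * ρ x : ℝ) : ℂ) := fun x => by
    have hx : (ρ x : ℂ) ≠ 0 := by exact_mod_cast (hρ x).ne'
    rw [horizontalLift_apply ψ hρ, mul_right_comm, hψ]
    push_cast
    field_simp
  have i1 : Integrable (fun x => (ρ₁ x : ℂ)) μ := (integrable_continuousMap μ ρ₁.toC).ofReal
  have i2 : Integrable (fun x => ((θ₁ x * ρ x : ℝ) : ℂ)) μ :=
    (integrable_continuousMap μ (θ₁.toC * ρ.toC)).ofReal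
  simp_rw [l2, e]
  rw [integral_add (i1.const_mul _) (i2.const_mul _), integral_const_mul, integral_const_mul,
    integral_complex_ofReal, integral_complex_ofReal, h₁, h₂]
  simp

/-- The integrand is `(ρ/4) Re ((ρ₁/ρ + iθ₁)(ρ₂/ρ - iθ₂))`; the mixed density–phase terms are purely
imaginary. -/
theorem re_l2_horizontalLift {ψ : HsC n M s} {ρ : Dens n s μ}
    (hψ : ∀ x, ψ x * (starRingEnd ℂ) (ψ x) = (ρ.1 x : ℂ)) (ρ₁ θ₁ ρ₂ θ₂ : HsR n M s) :
    (l2 μ (horizontalLift ψ ρ.1 ρ₁ θ₁) (horizontalLift ψ ρ.1 ρ₂ θ₂)).re =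
      sasakiFisherRao μ ρ ρ₁ θ₁ ρ₂ θ₂ := by
  have hi := integrable_continuousMap μ
    ((horizontalLift ψ ρ.1 ρ₁ θ₁).toC * star (horizontalLift ψ ρ.1 ρ₂ θ₂).toC)
  rw [sasakiFisherRao, ← integral_const_mul, l2]
  refine (Complex.reCLM.integral_comp_comm hi).symm.trans ?_
  refine integral_congr_ae (Eventually.of_forall fun x => ?_)
  have hx : ρ.1 x ≠ 0 := (ρ.2.1 x).ne'
  have e : horizontalLift ψ ρ.1 ρ₁ θ₁ x * (starRingEnd ℂ) (horizontalLift ψ ρ.1 ρ₂ θ₂ x) =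
      ((ρ.1 x / 4 : ℝ) : ℂ) * ((((ρ₁ x / ρ.1 x : ℝ) : ℂ) + Complex.I * (θ₁ x : ℂ)) *
        (((ρ₂ x / ρ.1 x : ℝ) : ℂ) - Complex.I * (θ₂ x : ℂ))) := by
    rw [horizontalLift_apply ψ ρ.2.1, horizontalLift_apply ψ ρ.2.1, map_mul, mul_mul_mul_comm, hψ]
    simp [Complex.conj_ofNat]
    ring
  change (horizontalLift ψ ρ.1 ρ₁ θ₁ x * (starRingEnd ℂ) (horizontalLift ψ ρ.1 ρ₂ θ₂ x)).re = _
  rw [e, Complex.re_ofReal_mul]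
  simp only [Complex.mul_re, Complex.add_re, Complex.sub_re, Complex.add_im, Complex.sub_im,
    Complex.ofReal_re, Complex.ofReal_im, Complex.I_re, Complex.I_im, Complex.mul_im]
  field_simp
  ring

/-- The chart sees the representative with `∫ θ₁ μ = 0` rather than `∫ θ₁ρ μ = 0`. The discrepancy
is a constant, which contributes a multiple of `ψ`. -/
theorem hasStrictDirDeriv_chartWave (ρ : Dens n s μ) (t : HsR n M s ⧸ constants n M s)
    (v : CotModel n s μ) :
    HasStrictDirDeriv (chartWave μ ρ.1) (cotChart ρ (ρ, t)) v
      (horizontalLift (wave (ρ.1, meanZeroRep μ t)) ρ.1 v.1.1 (meanZeroRep μ v.2)) := by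
  have h0 : (ρ.1, (0 : HsR n M s)) + modelIncl n s μ (cotChart ρ (ρ, t)) =
      (ρ.1, meanZeroRep μ t) :=
    Prod.ext (add_sub_cancel ρ.1 ρ.1) (zero_add _)
  have h1 : HasStrictDirDeriv (fun q => (ρ.1, (0 : HsR n M s)) + modelIncl n s μ q)
      (cotChart ρ (ρ, t)) v (modelIncl n s μ v) := by
    have := (hasStrictDirDeriv_linear (modelIncl n s μ) (cotChart ρ (ρ, t)) v).add_const
      (ρ.1, (0 : HsR n M s))
    simp_rw [add_comm _ (ρ.1, (0 : HsR n M s))] at this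
    exact this
  refine HasStrictDirDeriv.comp (f := wave) ?_ h1 (by fun_prop)
  rw [h0]
  exact hasStrictDirDeriv_wave ρ.2.1 (meanZeroRep μ t) v.1.1 (meanZeroRep μ v.2)

variable [ConnectedSpace M]

theorem exists_smul_wave {ρ : Dens n s μ} {t : HsR n M s ⧸ constants n M s} {ψ : HsC n M s}
    (hψ : ψ ≠ 0) (h : madelungTransform n s μ (ρ, t) = Projectivization.mk ℂ ψ hψ) :
    ∃ a : ℂ, a • wave (ρ.1, meanZeroRep μ t) = ψ :=
  (Projectivization.mk_eq_mk_iff' ℂ _ _ hψ (exp_ne_zero _)).mp h.symm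

/-- Both wave functions have norm one, so the factor between them is a phase and does not affect
`|ψ|² = ρ`. -/
theorem mul_conj_of_smul_wave {ρ : Dens n s μ} {θ : HsR n M s} {ψ : HsC n M s}
    (hψ₁ : l2 μ ψ ψ = 1) {a : ℂ} (ha : a • wave (ρ.1, θ) = ψ) (x : M) :
    ψ x * (starRingEnd ℂ) (ψ x) = (ρ.1 x : ℂ) := by
  have h : ∀ x, ψ x * (starRingEnd ℂ) (ψ x) = a * (starRingEnd ℂ) a * (ρ.1 x : ℂ) := fun x => by
    rw [← ha, HsC.smul_apply, map_mul, mul_mul_mul_comm, wave_mul_conj ρ.2.1]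
  have h1 : a * (starRingEnd ℂ) a = 1 := by
    simp_rw [l2, h] at hψ₁
    rwa [integral_const_mul, integral_complex_ofReal, ρ.2.2, Complex.ofReal_one, mul_one] at hψ₁
  rw [h, h1, one_mul]

/-- In the chart centered at `[ψ]`, differentiation followed by orthogonal projection retains the
horizontal part; everything proportional to `ψ` disappears. -/
theorem hasDirDeriv_madelungTransform {ρ : Dens n s μ} {t : HsR n M s ⧸ constants n M s}
    {ψ : HsC n M s} (hψ : ψ ≠ 0) (hψ₁ : l2 μ ψ ψ = 1)
    (h : madelungTransform n s μ (ρ, t) = Projectivization.mk ℂ ψ hψ) (ρ₁ : HsZero n s μ)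
    (θ₁ : HsR n M s) (hθ : ∫ x, θ₁ x * ρ.1 x ∂μ = 0) :
    ∃ y : orth μ ψ, y.1 = horizontalLift ψ ρ.1 ρ₁.1 θ₁ ∧
      HasDirDeriv (fun q => projChart μ ψ hψ₁ (madelungTransform n s μ ((cotChart ρ).symm q)))
        (cotChart ρ (ρ, t)) (ρ₁, Submodule.Quotient.mk θ₁) y := by
  obtain ⟨a, ha⟩ := exists_smul_wave μ hψ h
  have hnorm := mul_conj_of_smul_wave μ hψ₁ ha
  have ha0 : a ≠ 0 := by
    rintro rfl
    exact hψ (by rw [← ha, zero_smul])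
  set v : CotModel n s μ := (ρ₁, Submodule.Quotient.mk θ₁) with hv
  set q₀ := cotChart ρ (ρ, t) with hq₀
  set ψ' := wave (ρ.1, meanZeroRep μ t) with hψ'
  set D := horizontalLift ψ' ρ.1 ρ₁.1 (meanZeroRep μ (Submodule.Quotient.mk θ₁)) with hD
  have hl : l2 μ ψ' ψ = a⁻¹ := by
    have := l2_smul_left μ a ψ' ψ
    rw [ha, hψ₁] at this
    exact eq_inv_of_mul_eq_one_right this.symm
  have hq : q₀ ∈ (cotChart ρ).target := (cotChart ρ).map_source (mem_univ _)
  have hwave : chartWave μ ρ.1 q₀ = ψ' := by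
    rw [chartWave_eq, hψ']
    exact congrArg wave (Prod.ext (add_sub_cancel ρ.1 ρ.1) rfl)
  have d1 : HasStrictDirDeriv (chartWave μ ρ.1) q₀ v D := hasStrictDirDeriv_chartWave μ ρ t v
  have d2 : HasStrictDirDeriv (fun q => l2 μ (chartWave μ ρ.1 q) ψ) q₀ v (l2 μ D ψ) :=
    d1.linear_comp (l2L s μ ψ)
  -- Only the existence of the derivative of the scalar factor matters: its value multiplies `ψ'`
  -- and is removed by the projection.
  obtain ⟨-, dinv, hinv, -⟩ := strictContDiffOn_inv 1
  have hl0 : l2 μ (chartWave μ ρ.1 q₀) ψ ≠ 0 := by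
    rw [hwave, hl]
    exact inv_ne_zero ha0
  have d3 : HasStrictDirDeriv (fun q => (l2 μ (chartWave μ ρ.1 q) ψ)⁻¹) q₀ v
      (dinv (l2 μ (chartWave μ ρ.1 q₀) ψ, l2 μ D ψ)) :=
    HasStrictDirDeriv.comp (f := fun z : ℂ => z⁻¹) (hinv _ hl0 _) d2
      ((strictContDiffOn_l2_chartWave μ 0 ρ ψ).continuousOn.continuousAt
        ((isOpen_cotChart_target μ ρ).mem_nhds hq))
  set b := dinv (l2 μ (chartWave μ ρ.1 q₀) ψ, l2 μ D ψ)
  have d4 : HasStrictDirDeriv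
      (fun q => (l2 μ (chartWave μ ρ.1 q) ψ)⁻¹ • chartWave μ ρ.1 q) q₀ v (a • D + b • ψ') := by
    have hc : ContinuousAt (fun q => ((l2 μ (chartWave μ ρ.1 q) ψ)⁻¹, chartWave μ ρ.1 q)) q₀ :=
      ContinuousAt.prodMk
        (((strictContDiffOn_l2_chartWave μ 0 ρ ψ).continuousOn.continuousAt
          ((isOpen_cotChart_target μ ρ).mem_nhds hq)).inv₀ hl0)
        ((strictContDiffOn_chartWave μ 0 ρ).continuousOn.continuousAt
          ((isOpen_cotChart_target μ ρ).mem_nhds hq))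
    have := HasStrictDirDeriv.comp (f := fun p : ℂ × HsC n M s => smulₗ n M s p.1 p.2)
      (hasStrictDirDeriv_bilinear (smulₗ n M s) continuous_smulₗ _ _) (d3.prodMk d1) hc
    dsimp only at this
    rw [hwave, hl, inv_inv] at this
    exact this
  have d5 := ((d4.linear_comp (orthProjL μ ψ hψ₁)).congr (isOpen_chartDomain μ ρ ψ) ⟨hq, hl0⟩
    fun q hq => (chart_madelungTransform μ ρ ψ hψ₁ hq.1).symm).hasDirDeriv
  refine ⟨_, ?_, d5⟩
  set T := horizontalLift ψ ρ.1 ρ₁.1 θ₁ with hT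
  -- The vertical component: `b / a` comes from the varying scalar factor, the integral from
  -- replacing the mean-zero representative by `θ₁`.
  set c : ℂ := b / a - Complex.I / 2 * (∫ y, θ₁ y ∂μ : ℝ) with hc
  have e : a • D + b • ψ' = T + c • ψ := HsC.ext_apply fun x => by
    have hx : ψ x = a * ψ' x := by rw [← ha, HsC.smul_apply]
    rw [HsC.add_apply, HsC.add_apply, HsC.smul_apply, HsC.smul_apply, HsC.smul_apply, hT, hD,
      horizontalLift_apply _ ρ.2.1, horizontalLift_apply _ ρ.2.1, meanZeroRep_mk_apply, hx, hc]
    push_cast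
    field_simp
    ring
  have hT0 : l2 μ T ψ = 0 := l2_horizontalLift_self μ ρ.2.1 hnorm ρ₁.2 hθ
  rw [e]
  change T + c • ψ - l2 μ (T + c • ψ) ψ • ψ = T
  rw [l2_add_left, l2_smul_left, hT0, hψ₁, zero_add, mul_one, add_sub_cancel_right]

/-- For a unit vector `ψ` the correction term contains the product of the first tangent vector with
`ψ`, so horizontality of that one vector suffices. -/
theorem fubiniStudy_horizontalLift {ψ : HsC n M s} {ρ : Dens n s μ} (hψ₁ : l2 μ ψ ψ = 1)
    (hψ : ∀ x, ψ x * (starRingEnd ℂ) (ψ x) = (ρ.1 x : ℂ)) {ρ₁ : HsZero n s μ} {θ₁ : HsR n M s}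
    (h₁ : ∫ x, θ₁ x * ρ.1 x ∂μ = 0) (ρ₂ θ₂ : HsR n M s) :
    (fubiniStudy μ ψ (horizontalLift ψ ρ.1 ρ₁.1 θ₁) (horizontalLift ψ ρ.1 ρ₂ θ₂)).re =
      sasakiFisherRao μ ρ ρ₁.1 θ₁ ρ₂ θ₂ := by
  rw [fubiniStudy, hψ₁, l2_horizontalLift_self μ ρ.2.1 hψ ρ₁.2 h₁, div_one, zero_mul, zero_div,
    sub_zero, re_l2_horizontalLift μ hψ]

end Metric

end Madelung

end

/-! ### The Madelung transform is an isometry. -/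

open Madelung in
theorem theorem3p2 (n : ℕ) (s : WithTop ℝ) (hs : (((n : ℝ) / 2 : ℝ) : WithTop ℝ) < s)
    (M : Type*) [TopologicalSpace M] [ChartedSpace (EuclideanSpace ℝ (Fin n)) M]
    [IsManifold (𝓡 n) ∞ M] [T2Space M] [CompactSpace M] [ConnectedSpace M]
    [MeasurableSpace M] [BorelSpace M]
    (μ : Measure M) [IsProbabilityMeasure μ] (hμ : IsSmoothVolume n μ) :
    ∃ Φ : OpenPartialHomeomorph (CotDens n s μ) (ℙ ℂ (HsC n M s)),
      -- `Φ` is defined on all of `T*Dens^s(M)`, and it is the Madelung transform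
      Φ.source = univ ∧
      (∀ (ρ : Dens n s μ) (θ : HsR n M s), ∃ (ψ : HsC n M s) (hψ : ψ ≠ 0),
        (∀ x, ψ x = madelung (ρ.1 x) (θ x)) ∧ l2 μ ψ ψ = 1 ∧
        Φ (ρ, Submodule.Quotient.mk θ) = Projectivization.mk ℂ ψ hψ) ∧
      -- its (open) image
      Φ.target = withPhase n M s ∧
      (SimplyConnectedSpace M → Φ.target = nonvanishing n M s) ∧
      -- `Φ` is a diffeomorphism onto its image
      (∀ (ρ₀ : Dens n s μ) (φ : HsC n M s) (hφ : l2 μ φ φ = 1),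
        SmoothInCharts (cotChart ρ₀) (projChart μ φ hφ) Φ Φ.source ∧
        SmoothInCharts (projChart μ φ hφ) (cotChart ρ₀) Φ.symm Φ.target) ∧
      -- `Φ` pulls back the Fubini-Study metric to the Sasaki-Fisher-Rao metric; the tangent vector
      -- at `[ψ]`, `‖ψ‖ = 1`, is read in the chart centered at `[ψ]`, where the class of `v` in
      -- `H^s(M, ℂ) / ℂ ψ` becomes the component of `v` orthogonal to `ψ`
      (∀ (ρ : Dens n s μ) (θ : HsR n M s) (ψ : HsC n M s) (hψ : ψ ≠ 0) (hψ₁ : l2 μ ψ ψ = 1),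
        Φ (ρ, Submodule.Quotient.mk θ) = Projectivization.mk ℂ ψ hψ →
        ∀ (ρ₁ ρ₂ : HsZero n s μ) (θ₁ θ₂ : HsR n M s),
          ∫ x, θ₁ x * ρ.1 x ∂μ = 0 → ∫ x, θ₂ x * ρ.1 x ∂μ = 0 →
          ∃ ψ₁ ψ₂ : orth μ ψ,
            HasDirDeriv (fun q => projChart μ ψ hψ₁ (Φ ((cotChart ρ).symm q)))
              (cotChart ρ (ρ, Submodule.Quotient.mk θ)) (ρ₁, Submodule.Quotient.mk θ₁) ψ₁ ∧
            HasDirDeriv (fun q => projChart μ ψ hψ₁ (Φ ((cotChart ρ).symm q)))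
              (cotChart ρ (ρ, Submodule.Quotient.mk θ)) (ρ₂, Submodule.Quotient.mk θ₂) ψ₂ ∧
            (fubiniStudy μ ψ ψ₁.1 ψ₂.1).re = sasakiFisherRao μ ρ ρ₁.1 θ₁ ρ₂.1 θ₂) := by
  have := Fact.mk hs
  refine ⟨madelungTransform n s μ, rfl, fun ρ θ => ?_, range_ray, fun _ => ?_, fun ρ₀ φ hφ => ?_, ?_⟩
  · exact ⟨wave (ρ.1, θ), exp_ne_zero _, wave_apply ρ.2.1 θ, l2_wave μ ρ θ,
      ray_eq_mk_wave μ ρ θ _⟩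
  · exact range_ray.trans withPhase_eq_nonvanishing
  · exact ⟨smoothInCharts_madelungTransform μ ρ₀ φ hφ,
      smoothInCharts_madelungTransform_symm μ ρ₀ φ hφ⟩
  · intro ρ θ ψ hψ hψ₁ h ρ₁ ρ₂ θ₁ θ₂ h₁ h₂
    obtain ⟨y₁, hy₁, hd₁⟩ := hasDirDeriv_madelungTransform μ hψ hψ₁ h ρ₁ θ₁ h₁
    obtain ⟨y₂, hy₂, hd₂⟩ := hasDirDeriv_madelungTransform μ hψ hψ₁ h ρ₂ θ₂ h₂
    obtain ⟨a, ha⟩ := exists_smul_wave μ hψ h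
    refine ⟨y₁, y₂, hd₁, hd₂, ?_⟩
    rw [hy₁, hy₂]
    exact fubiniStudy_horizontalLift μ hψ₁ (mul_conj_of_smul_wave μ hψ₁ ha) h₁ ρ₂.1 θ₂
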